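/- Fix $n\ge 1$, $N=2^n$, and identify $[N]$ with $\{0,1\}^n$. Sample a uniformly random $S\subseteq[N]$ with $|S|=N/2$ and a uniformly random $Z\subseteq[N]$; then, independently for each $r\in[N]$, let $F(r,\cdot)$ be the product of a uniformly random cycle on $S$ and a uniformly random cycle on $\overline S$ if $r\in Z$, and a uniformly random $N$-cycle on $[N]$ if $r\notin Z$. A $T$-query verifier is a quantum algorithm (arbitrary unitaries, arbitrarily many ancilla qubits) making $T$ controlled quantum queries; access to a permutation includes access to its inverse. *Interactive game.* A prover sends a classical witness $w\in\{0,1\}^W$ depending on $F$. The verifier gets $w$, a uniformly random $r\in[N]$, and makes $T$ queries to the whole of $F$; output $1$ means the guess $r\in Z$. A QCMA pair $(P,V)$ has correctness $c$ and soundness error $s$ if $\Pr[V=1\mid r\in Z]\ge c$ with prover $P$, and $\Pr[V=1\mid r\notin Z]\le s$ for every prover. *Distributional oracle game.* In the Yes case (conditioned on $Z\neq\emptyset$) let $D$ be the distribution of $F(r,\cdot)$ for uniform $r\in Z$; in the No case (conditioned on $Z\ne[N]$) the same for uniform $r\in[N]\setminus Z$. The prover sends a witness ($W$ classical bits for QCMA,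 a $W$-qubit pure state for QMA) depending only on $D$; then $r$ is sampled uniformly from $Z$, resp. $[N]\setminus Z$, and the verifier gets the witness and makes $T$ queries to $F(r,\cdot)$ only. A pair $(P',V')$ has completeness $c$ and soundness $s$ if $V'$ outputs $1$ with probability at least $c$ in the Yes case with prover $P'$, and with probability at most $s$ in the No case for every prover (classical for QCMA, quantum for QMA). All probabilities include the sampling of $S,Z,F,r$. **Theorem.** 1. (Reduction) Let $n\ge1$ and $W,T\ge0$. If there is a QCMA pair with $W$-bit witnesses and $T$ queries in the distributional oracle game with completeness $1-\varepsilon_1$ and soundness $\varepsilon_2$, then there is a QCMA pair with $W$-bit witnesses and $T$ queries in the interactive game with correctness $3/4-\varepsilon_1$ and soundness error $1/4+\varepsilon_2$. In particular, negligible $\varepsilon_1,\varepsilon_2$ give $3/4-\mathrm{negl}(n)$ and $1/4+\mathrm{negl}(n)$. 2. (QMA/QCMA separation relative to distributional oracles) (a) For every $k$ there is an $l$ such that for all sufficiently large $n$ the distributional oracle game has a QMA pair with at most $n^l$ witness qubits, at most $n^l$ queries, completeness $1$ and soundness $n^{-k}$. (b) For every $k$ and all sufficiently large $n$, no QCMA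 pair with at most $n^k$ witness bits and at most $n^k$ queries has completeness $2/3$ and soundness $1/3$ in the distributional oracle game. -/

import Mathlib

open scoped BigOperators

noncomputable section

/-- Bit strings of length `n`; the addition is bitwise XOR. The set `[N]`, `N = 2 ^ n`. -/
abbrev Bits (n : ℕ) : Type := Fin n → ZMod 2

instance Bits.instDecidableEq (n : ℕ) : DecidableEq (Bits n) := fun a b => Fintype.decidablePiFintype a b

/-! ### Quantum query algorithms -/

/-- Normalized pure states on a register with computational basis `I`. -/
def QState (I : Type) [Fintype I] : Type := {ψ : I → ℂ // ∑ i, ‖ψ i‖ ^ 2 = 1}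

/-- The computational basis state `|i⟩`. -/
def QState.basis {I : Type} [Fintype I] [DecidableEq I] (i : I) : QState I :=
  ⟨fun j => if j = i then 1 else 0, by
    rw [Finset.sum_eq_single i] <;> simp +contextual⟩

/-- Basis labels of an algorithm: control bit, query input, query target, input register, ancillas. -/
abbrev QIndex (X : Type) (m : ℕ) (I : Type) (a : ℕ) : Type :=
  Bool × X × Bits m × I × Bits a

/-- A `T`-query quantum algorithm for oracles `X → Bits m`, with an input register with basis `I`.
Arbitrary unitaries are applied between the queries (only `U 0, …, U T` are used), and at the end
all registers are measured in the computational basis; the output bit is `1` when the outcome is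
in `accept`. -/
structure QueryAlg (X : Type) [Fintype X] [DecidableEq X] (m : ℕ)
    (I : Type) [Fintype I] [DecidableEq I] (T : ℕ) where
  ancillas : ℕ
  U : ℕ → Matrix.unitaryGroup (QIndex X m I ancillas) ℂ
  accept : Finset (QIndex X m I ancillas)

/-- The controlled oracle `|b, x, y, i, a⟩ ↦ |b, x, y ⊕ b O(x), i, a⟩`. -/
def applyQuery {X : Type} {m : ℕ} {I : Type} {a : ℕ} (O : X → Bits m)
    (φ : QIndex X m I a → ℂ) : QIndex X m I a → ℂ :=
  fun q => φ (q.1, q.2.1, q.2.2.1 + (if q.1 then O q.2.1 else 0), q.2.2.2)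

namespace QueryAlg

variable {X : Type} [Fintype X] [DecidableEq X] [Zero X] {m : ℕ}
  {I : Type} [Fintype I] [DecidableEq I] {T : ℕ}

/-- `ψ` in the input register, every other register set to zero. -/
def init (V : QueryAlg X m I T) (ψ : QState I) : QIndex X m I V.ancillas → ℂ :=
  fun q => if q.1 = false ∧ q.2.1 = 0 ∧ q.2.2.1 = 0 ∧ q.2.2.2.2 = 0 then ψ.1 q.2.2.2.1 else 0

/-- The state after `t` queries (and the unitary that follows the last of them). -/
def state (V : QueryAlg X m I T) (O : X → Bits m) (ψ : QState I) :
    ℕ → QIndex X m I V.ancillas → ℂ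
  | 0 => Matrix.mulVec (V.U 0).1 (V.init ψ)
  | t + 1 => Matrix.mulVec (V.U (t + 1)).1 (applyQuery O (V.state O ψ t))

/-- Probability that the algorithm outputs `1` with oracle `O` and input state `ψ`. -/
def acceptProb (V : QueryAlg X m I T) (O : X → Bits m) (ψ : QState I) : ℝ :=
  ∑ q ∈ V.accept, ‖V.state O ψ T q‖ ^ 2

end QueryAlg

/-! ### The random oracle -/

/-- The subsets `S` of `[N]` of size `N / 2`. -/
def halves (n : ℕ) : Finset (Finset (Bits n)) :=
  Finset.powersetCard (2 ^ n / 2) Finset.univ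

open Classical in
/-- Products of a single cycle on `S` and a single cycle on the complement of `S`. -/
def twoCycles {n : ℕ} (S : Finset (Bits n)) : Finset (Equiv.Perm (Bits n)) :=
  Finset.univ.filter fun π => π.IsCycleOn (S : Set (Bits n)) ∧ π.IsCycleOn (S : Set (Bits n))ᶜ

open Classical in
/-- Single cycles on all of `[N]`. -/
def fullCycles (n : ℕ) : Finset (Equiv.Perm (Bits n)) :=
  Finset.univ.filter fun π => π.IsCycleOn (Set.univ : Set (Bits n))

/-- The families `F`, `[R] = [N]`, whose rows `r ∈ Z` are two-cycle permutations for the partition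
`(S, Sᶜ)` and whose rows `r ∉ Z` are `N`-cycles. A uniform element of this product has independent
uniform rows. -/
def families {n : ℕ} (S Z : Finset (Bits n)) : Finset (Bits n → Equiv.Perm (Bits n)) :=
  Fintype.piFinset fun r => if r ∈ Z then twoCycles S else fullCycles n

/-- Expectation of `g Z F` when `S` is a uniform half, `Z` is uniform in `Zs`, and `F` is then
sampled row by row. -/
def sampleExp {n : ℕ} (Zs : Finset (Finset (Bits n)))
    (g : Finset (Bits n) → (Bits n → Equiv.Perm (Bits n)) → ℝ) : ℝ :=
  Finset.expect (halves n) fun S =>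
    Finset.expect Zs fun Z => Finset.expect (families S Z) fun F => g Z F

/-- Query access to `π` and to `π⁻¹`. -/
def permOracle {n : ℕ} (π : Equiv.Perm (Bits n)) : ZMod 2 × Bits n → Bits n :=
  fun q => if q.1 = 0 then π q.2 else π⁻¹ q.2

/-- Query access to the whole oracle: `(r, 0, x) ↦ F(r, x)` and `(r, 1, x) ↦ F⁻¹(r, x)`. -/
def familyOracle {n : ℕ} (F : Bits n → Equiv.Perm (Bits n)) :
    Bits n × ZMod 2 × Bits n → Bits n :=
  fun q => permOracle (F q.1) q.2

/-! ### The interactive oracle-distinguishing game -/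

/-- A verifier with a `W`-bit witness register and a register holding the challenge `r`, making `T`
queries to the whole of `F`. Output `1` is the guess that `F(r, ·)` is a product of two cycles. -/
abbrev IntVerifier (n W T : ℕ) : Type :=
  QueryAlg (Bits n × ZMod 2 × Bits n) n (Bits W × Bits n) T

/-- A prover sending a classical witness that depends on `F`. -/
abbrev IntProver (n W : ℕ) : Type := (Bits n → Equiv.Perm (Bits n)) → Bits W

/-- Probability that the verifier outputs `1` on the witness `P F` and the challenge `r`. -/
def intAccept {n W T : ℕ} (V : IntVerifier n W T) (P : IntProver n W)
    (F : Bits n → Equiv.Perm (Bits n)) (r : Bits n) : ℝ :=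
  V.acceptProb (familyOracle F) (QState.basis (P F, r))

/-- `Pr[V outputs 1 | r ∈ Z]`, for `S`, `Z`, `F` and `r` sampled as in the game. -/
def intCorrectness {n W T : ℕ} (V : IntVerifier n W T) (P : IntProver n W) : ℝ :=
  sampleExp Finset.univ (fun Z F =>
      Finset.expect Finset.univ fun r => if r ∈ Z then intAccept V P F r else 0) /
    sampleExp Finset.univ (fun Z (_ : Bits n → Equiv.Perm (Bits n)) =>
      Finset.expect Finset.univ fun r => if r ∈ Z then (1 : ℝ) else 0)

/-- `Pr[V outputs 1 | r ∉ Z]`, for `S`, `Z`, `F` and `r` sampled as in the game. -/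
def intSoundnessError {n W T : ℕ} (V : IntVerifier n W T) (P : IntProver n W) : ℝ :=
  sampleExp Finset.univ (fun Z F =>
      Finset.expect Finset.univ fun r => if r ∉ Z then intAccept V P F r else 0) /
    sampleExp Finset.univ (fun Z (_ : Bits n → Equiv.Perm (Bits n)) =>
      Finset.expect Finset.univ fun r => if r ∉ Z then (1 : ℝ) else 0)

/-! ### The distributional oracle game -/

/-- A verifier with a `W`-(qu)bit witness register making `T` queries to one permutation and its
inverse. -/
abbrev DistVerifier (n W T : ℕ) : Type := QueryAlg (ZMod 2 × Bits n) n (Bits W) T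

open Classical in
/-- The law of `F(r, ·)` for uniform `r ∈ A`, as a probability mass function. -/
def oracleLaw {n : ℕ} (A : Finset (Bits n)) (F : Bits n → Equiv.Perm (Bits n)) :
    Equiv.Perm (Bits n) → ℝ :=
  fun π => Finset.expect A fun r => if F r = π then 1 else 0

/-- A prover sending a quantum witness that depends on the distribution of the oracle. -/
abbrev QuantumProver (n W : ℕ) : Type := (Equiv.Perm (Bits n) → ℝ) → QState (Bits W)

/-- A prover sending a classical witness that depends on the distribution of the oracle. -/
abbrev ClassicalProver (n W : ℕ) : Type := (Equiv.Perm (Bits n) → ℝ) → Bits W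

/-- A classical witness `w`, sent as the basis state `|w⟩`. -/
def ClassicalProver.toQuantum {n W : ℕ} (P : ClassicalProver n W) : QuantumProver n W :=
  fun D => QState.basis (P D)

/-- Yes-case: probability that the verifier outputs `1` when the prover knows the law of `F(r, ·)`,
`r` uniform in `Z`, and the verifier queries `F(r, ·)` for one such `r`. The sampling of `Z` is
conditioned on `Z ≠ ∅`. -/
def distYesAccept {n W T : ℕ} (V : DistVerifier n W T) (P : QuantumProver n W) : ℝ :=
  sampleExp (Finset.univ.filter fun Z => Z ≠ ∅) fun Z F =>
    Finset.expect Z fun r => V.acceptProb (permOracle (F r)) (P (oracleLaw Z F))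

/-- No-case: the same with `r` uniform outside `Z`, conditioned on the complement being nonempty. -/
def distNoAccept {n W T : ℕ} (V : DistVerifier n W T) (P : QuantumProver n W) : ℝ :=
  sampleExp (Finset.univ.filter fun Z => Zᶜ ≠ ∅) fun Z F =>
    Finset.expect Zᶜ fun r => V.acceptProb (permOracle (F r)) (P (oracleLaw Zᶜ F))

/-- The prover–verifier pair `(P, V)` is a QCMA pair for the distributional oracle game with
completeness `c` and soundness `s` (against every classical witness). -/
def IsDistQCMA {n W T : ℕ} (V : DistVerifier n W T) (P : ClassicalProver n W) (c s : ℝ) : Prop :=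
  c ≤ distYesAccept V P.toQuantum ∧
    ∀ Q : ClassicalProver n W, distNoAccept V Q.toQuantum ≤ s

/-- The prover–verifier pair `(P, V)` is a QMA pair for the distributional oracle game with
completeness `c` and soundness `s` (against every quantum witness). -/
def IsDistQMA {n W T : ℕ} (V : DistVerifier n W T) (P : QuantumProver n W) (c s : ℝ) : Prop :=
  c ≤ distYesAccept V P ∧ ∀ Q : QuantumProver n W, distNoAccept V Q ≤ s

/-- The prover–verifier pair `(P, V)` is a QCMA pair for the interactive game with correctness `c`
and soundness error `s` (against every classical witness). -/
def IsIntQCMA {n W T : ℕ} (V : IntVerifier n W T) (P : IntProver n W) (c s : ℝ) : Prop :=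
  c ≤ intCorrectness V P ∧ ∀ Q : IntProver n W, intSoundnessError V Q ≤ s

end

open scoped BigOperators

noncomputable section

set_option linter.unusedSectionVars false
set_option synthInstance.maxSize 1000

/-! ### Uniform averages -/

/-! Reduction. The interactive verifier copies `r` into the row register and runs the given verifier
on that row; its prover reads `Z` off `F`, since a product of two cycles is not a full cycle.
Conditioning on `r ∈ Z` makes `Z` size-biased, whereas the distributional game draws it uniformly
among nonempty sets. Cauchy–Schwarz bounds the total variation distance by `1/4`
(`abs_sizeBiased_sub_uniform_le`), which is the whole loss. A prover who knows `F` gains nothing in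
soundness, because the average acceptance is linear in the law of the row
(`exists_optimal_classicalProver`).

QMA verifier. The witness is the state with sign `+` on `S` and `-` off `S`. The verifier applies a
uniform superposition of the powers `π ^ j`, `j < J`, tests that the exponent register is still
uniform, and tests that the position is orthogonal to the uniform state. The sign state passes with
certainty. In the No case the acceptance probability is a quadratic form in the witness. Averaged
over full cycles the form is at most `1/J`, and the independent rows make its deviation small in
Hilbert–Schmidt norm, uniformly over witnesses that depend on the law (`expect_families_walk_le`).

No QCMA verifier. Each fixed witness string accepts a random full cycle with probability at most
`1/3`. The core is `expect_halves_lt`: such a string accepts two-cycle permutations with probability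
at least `1/2` only for a fraction `2 ^ -(W + 7)` of the halves `S`. A union bound over strings, and
a Chernoff-type bound for strings chosen after seeing the rows (`expect_families_accept_le`), keep
the Yes acceptance below `2/3`.

For the core, place `[N]` at random on a grid of two copies of `K` rows of length `l`, with one
fixed full cycle running through the rows. Random row signs `g` choose which copy of each row goes
into `S`, and two cycles running through `S` and its complement in the same order differ from the
full cycle only near row ends (`exists_block_cycles`). A hybrid argument shows that `T` queries
rarely notice the change (`exists_queryError`). If a family `F` of halves has density `μ`, the
average of `F` over `g` must therefore be shown to be nearly `μ` for most placements
(`halfMean_mul_le`).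

This concentration is `expect_blockMean_sq_le`. In Fourier space over the choices of copies, the
second moment sees only character sets with an even number of points in every row. By symmetry the
weight of a character depends only on its size, and even sets are an exponentially small fraction of
each level. A hypercontractive inequality for indicator functions bounds the damped weight of the
nonempty levels, so nearly all that remains is the empty character. Its weight is compared with `μ ^
2` through the correlations of two independent halves (`halfMean_sq_eq`, `abs_signCorr_le`). -/

theorem expect_comp_of_equiv_fibers {Ω P : Type*} [Fintype Ω] [Nonempty Ω]
    (m : Ω → P) (B : Finset P) (hm : ∀ ω, m ω ∈ B)
    (hB : ∀ b ∈ B, ∀ b' ∈ B, ∃ e : Ω ≃ Ω, ∀ ω, m ω = b ↔ m (e ω) = b') (φ : P → ℝ) :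
    Finset.expect Finset.univ (fun ω => φ (m ω)) = Finset.expect B φ := by
  classical
  obtain ⟨ω₀⟩ := ‹Nonempty Ω›
  set b₀ := m ω₀
  set k := (Finset.univ.filter fun ω => m ω = b₀).card
  -- The given bijections match any two fibres over `B`, so all fibres have size `k` and the uniform
  -- law is pushed to the uniform law.
  have hk : ∀ b ∈ B, (Finset.univ.filter fun ω => m ω = b).card = k := by
    intro b hb
    obtain ⟨e, he⟩ := hB b hb b₀ (hm ω₀)
    refine Finset.card_bij (fun ω _ => e ω) ?_ ?_ ?_
    · intro ω hω
      simpa [← he] using hω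
    · intro _ _ _ _ h
      exact e.injective h
    · intro ω hω
      exact ⟨e.symm ω, by simpa [he] using hω, by simp⟩
  have hkpos : (k : ℝ) ≠ 0 := by
    have : 0 < k := Finset.card_pos.2 ⟨ω₀, by simp [b₀]⟩
    positivity
  have key : ∀ ψ : P → ℝ, ∑ ω, ψ (m ω) = k * ∑ b ∈ B, ψ b := by
    intro ψ
    rw [← Finset.sum_fiberwise_of_maps_to (s := Finset.univ) (t := B) (g := m) (fun ω _ => hm ω),
      Finset.mul_sum]
    refine Finset.sum_congr rfl fun b hb => ?_
    rw [← hk b hb, Finset.sum_congr rfl (g := fun _ => ψ b)]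
    · simp
    · intro ω hω
      rw [(Finset.mem_filter.1 hω).2]
  have hcard : (Fintype.card Ω : ℝ) = k * B.card := by
    have := key (fun _ => 1)
    simpa using this
  rw [Fintype.expect_eq_sum_div_card, Finset.expect_eq_sum_div_card, key, hcard]
  rw [mul_div_mul_left _ _ hkpos]

theorem expect_piFinset_prod {ι κ : Type*} [Fintype ι] [DecidableEq ι]
    (t : ι → Finset κ) (f : ι → κ → ℝ) :
    Finset.expect (Fintype.piFinset t) (fun F => ∏ i, f i (F i)) =
      ∏ i, Finset.expect (t i) (f i) := by
  simp only [Finset.expect_eq_sum_div_card, Finset.prod_div_distrib, Finset.prod_univ_sum,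
    Fintype.card_piFinset]
  push_cast
  rfl

theorem expect_piFinset_apply {ι κ : Type*} [Fintype ι] [DecidableEq ι]
    (t : ι → Finset κ) (ht : ∀ i, (t i).Nonempty) (i : ι) (g : κ → ℝ) :
    Finset.expect (Fintype.piFinset t) (fun F => g (F i)) = Finset.expect (t i) g := by
  have h := expect_piFinset_prod t (fun j x => if j = i then g x else 1)
  rw [Finset.prod_eq_single i] at h
  · simpa [Finset.prod_ite_eq'] using h
  · intro j _ hj
    simp [hj, Finset.expect_const (ht j)]
  · simp

theorem expect_piFinset_apply_mul_apply {ι κ : Type*} [Fintype ι] [DecidableEq ι]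
    (t : ι → Finset κ) (ht : ∀ i, (t i).Nonempty) {i j : ι} (hij : i ≠ j) (g h : κ → ℝ) :
    Finset.expect (Fintype.piFinset t) (fun F => g (F i) * h (F j)) =
      Finset.expect (t i) g * Finset.expect (t j) h := by
  have H := expect_piFinset_prod t
    (fun k x => (if k = i then g x else 1) * (if k = j then h x else 1))
  simp only [Finset.prod_mul_distrib, Finset.prod_ite_eq', Finset.mem_univ, if_true] at H
  rw [H, ← Finset.mul_prod_erase _ _ (Finset.mem_univ i),
    ← Finset.mul_prod_erase _ _ (Finset.mem_erase.2 ⟨hij.symm, Finset.mem_univ j⟩),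
    Finset.prod_eq_one]
  · simp [hij, hij.symm]
  · intro k hk
    simp only [Finset.mem_erase, Finset.mem_univ, and_true] at hk
    simp [hk.1, hk.2, Finset.expect_const (ht k)]

theorem expect_mono {ι : Type*} {s : Finset ι} {f g : ι → ℝ} (h : ∀ i ∈ s, f i ≤ g i) :
    Finset.expect s f ≤ Finset.expect s g := by
  rw [Finset.expect_eq_sum_div_card, Finset.expect_eq_sum_div_card]
  gcongr with i hi
  exact h i hi

theorem expect_nonneg_of {ι : Type*} {s : Finset ι} {f : ι → ℝ} (h : ∀ i ∈ s, 0 ≤ f i) :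
    0 ≤ Finset.expect s f := by
  rw [Finset.expect_eq_sum_div_card]
  exact div_nonneg (Finset.sum_nonneg h) (Nat.cast_nonneg _)

theorem expect_le_of {ι : Type*} {s : Finset ι} {f : ι → ℝ} {c : ℝ} (hc : 0 ≤ c)
    (h : ∀ i ∈ s, f i ≤ c) : Finset.expect s f ≤ c := by
  rcases s.eq_empty_or_nonempty with rfl | hs
  · simpa
  · exact (expect_mono h).trans (Finset.expect_const hs c).le

/-! ### Moments of the size of a random subset -/

theorem sum_powerset_card_moments {α : Type*} [DecidableEq α] (s : Finset α) :
    ∑ Z ∈ s.powerset, (Z.card : ℝ) = s.card * 2 ^ s.card / 2 ∧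
    ∑ Z ∈ s.powerset, (Z.card : ℝ) ^ 2 = s.card * (s.card + 1) * 2 ^ s.card / 4 := by
  induction s using Finset.induction_on with
  | empty => simp
  | insert a s ha ih =>
    have h1 : ∀ Z ∈ s.powerset, (insert a Z).card = Z.card + 1 := fun Z hZ =>
      Finset.card_insert_of_notMem fun h => ha (Finset.mem_powerset.1 hZ h)
    have h2 : ∀ φ : ℕ → ℝ, ∑ Z ∈ s.powerset, φ (insert a Z).card =
        ∑ Z ∈ s.powerset, φ (Z.card + 1) := fun φ =>
      Finset.sum_congr rfl fun Z hZ => by rw [h1 Z hZ]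
    have e1 := h2 (fun k => (k : ℝ))
    have e2 := h2 (fun k => (k : ℝ) ^ 2)
    rw [Finset.sum_powerset_insert ha, Finset.sum_powerset_insert ha, e1, e2,
      Finset.card_insert_of_notMem ha]
    push_cast
    simp only [add_sq, Finset.sum_add_distrib, one_pow, mul_one, ← Finset.mul_sum, ih.1, ih.2,
      Finset.sum_const, Finset.card_powerset, nsmul_eq_mul]
    push_cast
    constructor <;> ring

theorem sum_card_univ (α : Type*) [Fintype α] [DecidableEq α] :
    ∑ Z : Finset α, (Z.card : ℝ) = Fintype.card α * 2 ^ Fintype.card α / 2 := by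
  simpa using (sum_powerset_card_moments (Finset.univ : Finset α)).1

theorem sum_card_sq_univ (α : Type*) [Fintype α] [DecidableEq α] :
    ∑ Z : Finset α, (Z.card : ℝ) ^ 2 =
      Fintype.card α * (Fintype.card α + 1) * 2 ^ Fintype.card α / 4 := by
  simpa using (sum_powerset_card_moments (Finset.univ : Finset α)).2

theorem card_filter_ne_empty (α : Type*) [Fintype α] [DecidableEq α] :
    ((Finset.univ.filter fun Z : Finset α => Z ≠ ∅).card : ℝ) = 2 ^ Fintype.card α - 1 := by
  rw [Finset.filter_ne', Finset.card_erase_of_mem (Finset.mem_univ _), Finset.card_univ,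
    Fintype.card_finset, Nat.cast_sub Nat.one_le_two_pow]
  simp

/-- For `m ≥ N / 4` the constant suffices; below that, `m` is at least `N / 4` away from `N / 2` and
the quadratic term alone is at least `N`. A bound quadratic in `m` lets two moments control the mean
of `N / |Z|`. -/
theorem div_card_le {N m : ℝ} (hm : 1 ≤ m) (hN : 1 ≤ N) :
    N / m ≤ 4 + 16 * (m - N / 2) ^ 2 / N := by
  rcases le_or_gt (N / 4) m with h | h
  · have : N / m ≤ 4 := by
      rw [div_le_iff₀ (by linarith)]
      linarith
    have : 0 ≤ 16 * (m - N / 2) ^ 2 / N := by positivity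
    linarith
  · have h1 : N / m ≤ N := div_le_self (by linarith) hm
    have h2 : N ≤ 16 * (m - N / 2) ^ 2 / N := by
      rw [le_div_iff₀ (by linarith)]
      nlinarith
    linarith

theorem expect_inv_card_le (α : Type*) [Fintype α] [DecidableEq α] [Nonempty α] :
    Finset.expect (Finset.univ.filter fun Z : Finset α => Z ≠ ∅)
      (fun Z => (Fintype.card α : ℝ) / Z.card) ≤ 16 := by
  set N : ℝ := (Fintype.card α : ℝ) with hN
  have hN1 : 1 ≤ N := by
    rw [hN]
    exact_mod_cast Fintype.card_pos (α := α)
  have hpow : (2 : ℝ) ≤ 2 ^ Fintype.card α := by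
    have h := pow_le_pow_right₀ (one_le_two (α := ℝ)) (Fintype.card_pos (α := α))
    linarith
  have h1 : ∑ Z ∈ Finset.univ.filter (fun Z : Finset α => Z ≠ ∅), N / (Z.card : ℝ) ≤
      ∑ Z : Finset α, (4 + 16 * ((Z.card : ℝ) - N / 2) ^ 2 / N) := by
    refine (Finset.sum_le_sum fun Z hZ => ?_).trans
      (Finset.sum_le_sum_of_subset_of_nonneg (Finset.filter_subset _ _) fun Z _ _ => ?_)
    · refine div_card_le ?_ hN1
      have := Finset.card_pos.2 (Finset.nonempty_iff_ne_empty.2 (Finset.mem_filter.1 hZ).2)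
      exact_mod_cast this
    · positivity
  -- The variance of `|Z|` is `N / 4`, so the mean of the summand is `8`; conditioning on `Z ≠ ∅`
  -- costs at most another factor `2`.
  have h2 : ∑ Z : Finset α, (4 + 16 * ((Z.card : ℝ) - N / 2) ^ 2 / N) =
      8 * 2 ^ Fintype.card α := by
    have e : ∀ Z : Finset α, (4 + 16 * ((Z.card : ℝ) - N / 2) ^ 2 / N) =
        (16 / N) * (Z.card : ℝ) ^ 2 - 16 * (Z.card : ℝ) + (4 + 4 * N) := by
      intro Z
      field_simp
      ring
    rw [Finset.sum_congr rfl fun Z _ => e Z, Finset.sum_add_distrib, Finset.sum_sub_distrib,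
      ← Finset.mul_sum, ← Finset.mul_sum, sum_card_univ, sum_card_sq_univ, Finset.sum_const,
      Finset.card_univ, Fintype.card_finset, nsmul_eq_mul]
    push_cast
    rw [← hN]
    field_simp
    ring
  rw [Finset.expect_eq_sum_div_card, card_filter_ne_empty, div_le_iff₀ (by linarith)]
  linarith

theorem expect_inv_card_compl_le (α : Type*) [Fintype α] [DecidableEq α] [Nonempty α] :
    Finset.expect (Finset.univ.filter fun Z : Finset α => Zᶜ ≠ ∅)
      (fun Z => (Fintype.card α : ℝ) / (Zᶜ).card) ≤ 16 := by
  refine le_of_eq_of_le ?_ (expect_inv_card_le α)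
  refine Finset.expect_equiv (Equiv.ofBijective (fun Z : Finset α => Zᶜ) compl_bijective) ?_ ?_
  · simp
  · simp

/-! ### Cycles -/

theorem Equiv.Perm.IsCycleOn.congr {α : Type*} [Finite α] {f g : Equiv.Perm α} {s : Set α}
    (hf : f.IsCycleOn s) (h : ∀ x ∈ s, f x = g x) : g.IsCycleOn s := by
  refine ⟨hf.1.congr h, fun x hx y hy => ?_⟩
  obtain ⟨k, hk⟩ := hf.exists_pow_eq' s.toFinite hx hy
  have key : ∀ j : ℕ, (g ^ j) x = (f ^ j) x := by
    intro j
    induction j with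
    | zero => simp
    | succ j ih =>
      rw [pow_succ', pow_succ', Equiv.Perm.mul_apply, Equiv.Perm.mul_apply, ih, h]
      exact hf.1.mapsTo.perm_pow j hx
  exact ⟨k, by rw [zpow_natCast, key, hk]⟩

theorem exists_glued_cycles {α : Type*} [Fintype α] {f f' : Equiv.Perm α} {s : Set α}
    (hf : f.IsCycleOn s) (hf' : f'.IsCycleOn sᶜ) :
    ∃ g : Equiv.Perm α, g.IsCycleOn s ∧ g.IsCycleOn sᶜ ∧ (∀ x ∈ s, g x = f x) ∧
      ∀ x ∈ sᶜ, g x = f' x := by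
  classical
  let g₀ : α → α := fun x => if x ∈ s then f x else f' x
  have hg : Function.Injective g₀ := by
    intro x y hxy
    by_cases hx : x ∈ s <;> by_cases hy : y ∈ s
    · simpa [g₀, hx, hy] using hxy
    · have h1 := hf.1.mapsTo hx
      have h2 := hf'.1.mapsTo (show y ∈ sᶜ from hy)
      simp only [g₀, hx, hy, if_true, if_false] at hxy
      exact absurd (hxy ▸ h1) h2
    · have h1 := hf.1.mapsTo hy
      have h2 := hf'.1.mapsTo (show x ∈ sᶜ from hx)
      simp only [g₀, hx, hy, if_true, if_false] at hxy
      exact absurd (hxy ▸ h1) h2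
    · simpa [g₀, hx, hy] using hxy
  let g : Equiv.Perm α := Equiv.ofBijective g₀ (Finite.injective_iff_bijective.1 hg)
  have h1 : ∀ x ∈ s, g x = f x := fun x hx => if_pos hx
  have h2 : ∀ x ∈ sᶜ, g x = f' x := fun x hx => if_neg hx
  exact ⟨g, hf.congr fun x hx => (h1 x hx).symm, hf'.congr fun x hx => (h2 x hx).symm, h1, h2⟩

/-- Send `π ^ k a` to `π' ^ k a'` for chosen base points. Equal cycle lengths make this well defined
and injective. -/
theorem exists_equivariant_bijOn {α β : Type*} {π : Equiv.Perm α} {π' : Equiv.Perm β}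
    {s : Finset α} {s' : Finset β} (hs : s.Nonempty) (hcard : s.card = s'.card)
    (h : π.IsCycleOn (s : Set α)) (h' : π'.IsCycleOn (s' : Set β)) :
    ∃ f : α → β, Set.BijOn f s s' ∧ ∀ x ∈ s, f (π x) = π' (f x) := by
  classical
  obtain ⟨a, ha⟩ := hs
  obtain ⟨a', ha'⟩ : s'.Nonempty := Finset.card_pos.1 (hcard ▸ Finset.card_pos.2 ⟨a, ha⟩)
  have hex : ∀ x ∈ s, ∃ k : ℕ, (π ^ k) a = x := fun x hx => by
    obtain ⟨k, -, hk⟩ := h.exists_pow_eq ha hx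
    exact ⟨k, hk⟩
  let f : α → β := fun x => if hx : x ∈ s then (π' ^ (hex x hx).choose) a' else a'
  have hf : ∀ k : ℕ, f ((π ^ k) a) = (π' ^ k) a' := by
    intro k
    have hx : (π ^ k) a ∈ s := h.1.mapsTo.perm_pow k ha
    simp only [f, hx, dif_pos]
    have := (hex _ hx).choose_spec
    rw [h.pow_apply_eq_pow_apply ha] at this
    rw [h'.pow_apply_eq_pow_apply ha', ← hcard]
    exact this
  refine ⟨f, ⟨?_, ?_, ?_⟩, ?_⟩
  · intro x hx
    obtain ⟨k, rfl⟩ := hex x hx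
    rw [hf]
    exact h'.1.mapsTo.perm_pow k ha'
  · intro x hx y hy hxy
    obtain ⟨k, rfl⟩ := hex x hx
    obtain ⟨j, rfl⟩ := hex y hy
    rw [hf, hf, h'.pow_apply_eq_pow_apply ha', ← hcard] at hxy
    rwa [h.pow_apply_eq_pow_apply ha]
  · intro y hy
    obtain ⟨k, -, hk⟩ := h'.exists_pow_eq ha' hy
    exact ⟨(π ^ k) a, h.1.mapsTo.perm_pow k ha, by rw [hf, hk]⟩
  · intro x hx
    obtain ⟨k, rfl⟩ := hex x hx
    rw [hf, ← Equiv.Perm.mul_apply, ← pow_succ', hf, pow_succ', Equiv.Perm.mul_apply]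

theorem exists_equiv_conj_fullCycle {α β : Type*} [Fintype α] [Fintype β] [Nonempty α]
    {π : Equiv.Perm α} {π' : Equiv.Perm β} (hcard : Fintype.card α = Fintype.card β)
    (h : π.IsCycleOn Set.univ) (h' : π'.IsCycleOn Set.univ) :
    ∃ e : α ≃ β, ∀ x, e (π x) = π' (e x) := by
  obtain ⟨f, hf, hfe⟩ := exists_equivariant_bijOn (s := Finset.univ) (s' := Finset.univ)
    Finset.univ_nonempty hcard (by simpa using h) (by simpa using h')
  exact ⟨Equiv.ofBijective f (by simpa [Set.bijOn_univ] using hf),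
    fun x => hfe x (Finset.mem_univ x)⟩

theorem exists_equiv_conj_twoCycles {α β : Type*} [Fintype α] [Fintype β]
    [DecidableEq α] [DecidableEq β]
    {π : Equiv.Perm α} {π' : Equiv.Perm β} {s : Finset α} {s' : Finset β}
    (hs : s.Nonempty) (hsc : sᶜ.Nonempty)
    (hcard : s.card = s'.card) (hcardc : sᶜ.card = s'ᶜ.card)
    (h : π.IsCycleOn (s : Set α)) (hc : π.IsCycleOn (s : Set α)ᶜ)
    (h' : π'.IsCycleOn (s' : Set β)) (hc' : π'.IsCycleOn (s' : Set β)ᶜ) :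
    ∃ e : α ≃ β, (∀ x, x ∈ s ↔ e x ∈ s') ∧ ∀ x, e (π x) = π' (e x) := by
  obtain ⟨f, hf, hfe⟩ := exists_equivariant_bijOn hs hcard h h'
  obtain ⟨g, hg, hge⟩ := exists_equivariant_bijOn hsc hcardc (by simpa using hc)
    (by simpa using hc')
  let e₀ : α → β := fun x => if x ∈ s then f x else g x
  have hmem : ∀ x, x ∈ s ↔ e₀ x ∈ s' := by
    intro x
    by_cases hx : x ∈ s
    · simpa [e₀, hx] using hf.mapsTo hx
    · simpa [e₀, hx] using hg.mapsTo (show x ∈ ((sᶜ : Finset α) : Set α) by simpa using hx)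
  have hinj : Function.Injective e₀ := by
    intro x y hxy
    by_cases hx : x ∈ s
    · have hy : y ∈ s := by rw [hmem, ← hxy, ← hmem]; exact hx
      simp only [e₀, hx, hy, if_true] at hxy
      exact hf.injOn hx hy hxy
    · have hy : y ∉ s := by rw [hmem, ← hxy, ← hmem]; exact hx
      simp only [e₀, hx, hy, if_false] at hxy
      exact hg.injOn (by simpa using hx) (by simpa using hy) hxy
  have hcardU : Fintype.card α = Fintype.card β := by
    rw [← Finset.card_add_card_compl s, ← Finset.card_add_card_compl s', hcard, hcardc]
  refine ⟨Equiv.ofBijective e₀ ((Fintype.bijective_iff_injective_and_card _).2 ⟨hinj, hcardU⟩),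
    hmem, fun x => ?_⟩
  change e₀ (π x) = π' (e₀ x)
  by_cases hx : x ∈ s
  · have hx' : π x ∈ s := h.1.mapsTo hx
    simp only [e₀, hx, hx', if_true]
    exact hfe x hx
  · have hx' : π x ∉ s := hc.1.mapsTo (show x ∈ (s : Set α)ᶜ from hx)
    simp only [e₀, hx, hx', if_false]
    exact hge x (by simpa using hx)

theorem mem_fullCycles {n : ℕ} {π : Equiv.Perm (Bits n)} :
    π ∈ fullCycles n ↔ π.IsCycleOn Set.univ := by
  simp [fullCycles]

theorem mem_twoCycles {n : ℕ} {S : Finset (Bits n)} {π : Equiv.Perm (Bits n)} :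
    π ∈ twoCycles S ↔ π.IsCycleOn (S : Set (Bits n)) ∧ π.IsCycleOn (S : Set (Bits n))ᶜ := by
  simp [twoCycles]

theorem card_bits (n : ℕ) : Fintype.card (Bits n) = 2 ^ n := by
  simp [Bits, ZMod.card]

theorem fullCycles_nonempty (n : ℕ) : (fullCycles n).Nonempty := by
  obtain ⟨f, hf, -⟩ := Finset.exists_cycleOn (Finset.univ : Finset (Bits n))
  exact ⟨f, mem_fullCycles.2 (by simpa using hf)⟩

theorem twoCycles_nonempty {n : ℕ} (S : Finset (Bits n)) : (twoCycles S).Nonempty := by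
  obtain ⟨f, hf, -⟩ := Finset.exists_cycleOn S
  obtain ⟨f', hf', -⟩ := Finset.exists_cycleOn Sᶜ
  obtain ⟨g, h1, h2, -⟩ := exists_glued_cycles hf (by simpa using hf')
  exact ⟨g, mem_twoCycles.2 ⟨h1, h2⟩⟩

theorem halves_nonempty (n : ℕ) : (halves n).Nonempty := by
  refine Finset.powersetCard_nonempty.2 ?_
  rw [Finset.card_univ, card_bits]
  exact Nat.div_le_self _ _

theorem two_pow_div_two {n : ℕ} (hn : 1 ≤ n) : 2 ^ n / 2 = 2 ^ (n - 1) := by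
  obtain ⟨k, rfl⟩ := Nat.exists_eq_add_of_le' hn
  simp [pow_succ]

theorem mem_halves {n : ℕ} (hn : 1 ≤ n) {S : Finset (Bits n)} :
    S ∈ halves n ↔ S.card = 2 ^ (n - 1) := by
  rw [halves, Finset.mem_powersetCard, two_pow_div_two hn]
  simp

theorem card_compl_of_mem_halves {n : ℕ} (hn : 1 ≤ n) {S : Finset (Bits n)} (hS : S ∈ halves n) :
    Sᶜ.card = 2 ^ (n - 1) := by
  rw [Finset.card_compl, (mem_halves hn).1 hS, card_bits]
  obtain ⟨k, rfl⟩ := Nat.exists_eq_add_of_le' hn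
  simp [pow_succ]
  omega

theorem nonempty_of_mem_halves {n : ℕ} (hn : 1 ≤ n) {S : Finset (Bits n)} (hS : S ∈ halves n) :
    S.Nonempty ∧ Sᶜ.Nonempty := by
  constructor <;> rw [← Finset.card_pos]
  · rw [(mem_halves hn).1 hS]; positivity
  · rw [card_compl_of_mem_halves hn hS]; positivity

/-- The orbit of a point of `S` stays in `S`, while a full cycle would reach the nonempty
complement. This is what makes `Z` recoverable from `F`. -/
theorem notMem_fullCycles_of_mem_twoCycles {n : ℕ} (hn : 1 ≤ n) {S : Finset (Bits n)}
    (hS : S ∈ halves n) {π : Equiv.Perm (Bits n)} (hπ : π ∈ twoCycles S) : π ∉ fullCycles n := by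
  intro h
  obtain ⟨⟨a, ha⟩, ⟨b, hb⟩⟩ := nonempty_of_mem_halves hn hS
  obtain ⟨k, hk⟩ := (mem_fullCycles.1 h).2 (Set.mem_univ a) (Set.mem_univ b)
  have := ((mem_twoCycles.1 hπ).1.1.perm_zpow k).mapsTo ha
  rw [hk] at this
  exact (Finset.mem_compl.1 hb) this

theorem families_nonempty_rows {n : ℕ} (S Z : Finset (Bits n)) (r : Bits n) :
    (if r ∈ Z then twoCycles S else fullCycles n).Nonempty := by
  split_ifs
  · exact twoCycles_nonempty S
  · exact fullCycles_nonempty n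

theorem expect_families_apply {n : ℕ} (S Z : Finset (Bits n)) (r : Bits n)
    (g : Equiv.Perm (Bits n) → ℝ) :
    Finset.expect (families S Z) (fun F => g (F r)) =
      Finset.expect (if r ∈ Z then twoCycles S else fullCycles n) g :=
  expect_piFinset_apply _ (families_nonempty_rows S Z) r g

theorem families_nonempty {n : ℕ} (S Z : Finset (Bits n)) : (families S Z).Nonempty :=
  Fintype.piFinset_nonempty.2 (families_nonempty_rows S Z)

/-! ### Random cycles as random relabellings -/

theorem isCycleOn_permCongr {α β : Type*} (σ : α ≃ β) {c : Equiv.Perm α} {s : Set α}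
    (h : c.IsCycleOn s) : (σ.permCongr c).IsCycleOn (σ '' s) := by
  constructor
  · refine ⟨?_, (σ.permCongr c).injective.injOn, ?_⟩
    · rintro _ ⟨x, hx, rfl⟩
      exact ⟨c x, h.1.mapsTo hx, by simp [Equiv.permCongr_apply]⟩
    · rintro _ ⟨x, hx, rfl⟩
      obtain ⟨y, hy, rfl⟩ := h.1.surjOn hx
      exact ⟨σ y, ⟨y, hy, rfl⟩, by simp [Equiv.permCongr_apply]⟩
  · rintro _ ⟨x, hx, rfl⟩ _ ⟨y, hy, rfl⟩
    obtain ⟨k, hk⟩ := h.2 hx hy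
    refine ⟨k, ?_⟩
    have : (σ.permCongr c) ^ k = σ.permCongr (c ^ k) := (map_zpow σ.permCongrHom c k).symm
    rw [this, Equiv.permCongr_apply, σ.symm_apply_apply, hk]

theorem permCongr_trans_eq {α β : Type*} {σ : α ≃ β} {c : Equiv.Perm α} {e : Equiv.Perm β}
    {π π' : Equiv.Perm β} (he : ∀ x, e (π x) = π' (e x)) (h : σ.permCongr c = π) :
    (σ.trans e).permCongr c = π' := by
  ext x
  obtain ⟨y, rfl⟩ := e.surjective x
  rw [← he, ← h]
  simp [Equiv.permCongr_apply]

theorem equivariant_symm {β : Type*} {e : Equiv.Perm β}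
    {π π' : Equiv.Perm β} (he : ∀ x, e (π x) = π' (e x)) : ∀ x, e.symm (π' x) = π (e.symm x) := by
  intro x
  rw [Equiv.symm_apply_eq, he, Equiv.apply_symm_apply]

/-- Any two full cycles are conjugate, and composing relabellings with a conjugator matches the
fibres of `σ ↦ σ c σ⁻¹`. Hence a random relabelling of one fixed cycle is a uniform full cycle. -/
theorem expect_fullCycles_eq {n : ℕ} {Y : Type*} [Fintype Y] [DecidableEq Y]
    [Nonempty (Y ≃ Bits n)] {c : Equiv.Perm Y} (hc : c.IsCycleOn Set.univ)
    (φ : Equiv.Perm (Bits n) → ℝ) :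
    Finset.expect (fullCycles n) φ =
      Finset.expect Finset.univ fun σ : Y ≃ Bits n => φ (σ.permCongr c) := by
  symm
  refine expect_comp_of_equiv_fibers (fun σ : Y ≃ Bits n => σ.permCongr c) (fullCycles n)
    (fun σ => ?_) (fun π hπ π' hπ' => ?_) φ
  · have := isCycleOn_permCongr σ hc
    rw [Set.image_univ, σ.range_eq_univ] at this
    exact mem_fullCycles.2 this
  · obtain ⟨e, he⟩ := exists_equiv_conj_fullCycle rfl (mem_fullCycles.1 hπ) (mem_fullCycles.1 hπ')
    refine ⟨Equiv.equivCongr (Equiv.refl Y) e, fun σ => ⟨fun h => ?_, fun h => ?_⟩⟩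
    · exact permCongr_trans_eq he h
    · have := permCongr_trans_eq (equivariant_symm he) h
      rw [← this]
      congr 1
      ext x
      simp [Equiv.equivCongr]

theorem card_twoCycles_eq {n : ℕ} {S S' : Finset (Bits n)} (hn : 1 ≤ n)
    (hS : S ∈ halves n) (hS' : S' ∈ halves n) : (twoCycles S).card = (twoCycles S').card := by
  obtain ⟨π, hπ⟩ := twoCycles_nonempty S
  obtain ⟨π', hπ'⟩ := twoCycles_nonempty S'
  rw [mem_twoCycles] at hπ hπ'
  obtain ⟨e, he, -⟩ := exists_equiv_conj_twoCycles (nonempty_of_mem_halves hn hS).1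
    (nonempty_of_mem_halves hn hS).2 (by rw [(mem_halves hn).1 hS, (mem_halves hn).1 hS'])
    (by rw [card_compl_of_mem_halves hn hS, card_compl_of_mem_halves hn hS'])
    hπ.1 hπ.2 hπ'.1 hπ'.2
  have himg : e '' (S : Set (Bits n)) = S' := by
    ext x
    constructor
    · rintro ⟨y, hy, rfl⟩
      exact (he y).1 hy
    · intro hx
      exact ⟨e.symm x, (he _).2 (by simpa using hx), by simp⟩
  have himgc : e '' (S : Set (Bits n))ᶜ = (S' : Set (Bits n))ᶜ := by
    rw [Set.image_compl_eq e.bijective, himg]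
  refine Finset.card_bij (fun f _ => e.permCongr f) ?_ ?_ ?_
  · intro f hf
    rw [mem_twoCycles] at hf ⊢
    rw [← himgc, ← himg]
    exact ⟨isCycleOn_permCongr e hf.1, isCycleOn_permCongr e hf.2⟩
  · intro _ _ _ _ h
    exact e.permCongr.injective h
  · intro f hf
    refine ⟨e.permCongr.symm f, ?_, e.permCongr.apply_symm_apply f⟩
    rw [mem_twoCycles] at hf ⊢
    have h1 := isCycleOn_permCongr e.symm hf.1
    have h2 := isCycleOn_permCongr e.symm hf.2
    rw [← himg, e.symm_image_image] at h1
    rw [← himgc, e.symm_image_image] at h2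
    exact ⟨h1, h2⟩

/-- The same argument for the pair (half, permutation): the sets `twoCycles S` all have the same
size, so choosing `S` and then `π` is choosing a uniform pair, and any two pairs are conjugate. -/
theorem expect_twoCycles_eq {n : ℕ} (hn : 1 ≤ n) {Y : Type*} [Fintype Y] [DecidableEq Y]
    [Nonempty (Y ≃ Bits n)] {A : Finset Y} (hA : A.card = 2 ^ (n - 1))
    {τ : Equiv.Perm Y} (hτ : τ.IsCycleOn (A : Set Y)) (hτc : τ.IsCycleOn (A : Set Y)ᶜ)
    (φ : Finset (Bits n) → Equiv.Perm (Bits n) → ℝ) :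
    Finset.expect (halves n) (fun S => Finset.expect (twoCycles S) (φ S)) =
      Finset.expect Finset.univ
        fun σ : Y ≃ Bits n => φ (A.map σ.toEmbedding) (σ.permCongr τ) := by
  set B : Finset (Σ _ : Finset (Bits n), Equiv.Perm (Bits n)) := (halves n).sigma twoCycles
  have hB : Finset.expect (halves n) (fun S => Finset.expect (twoCycles S) (φ S)) =
      Finset.expect B fun p => φ p.1 p.2 := by
    obtain ⟨S₀, hS₀⟩ := halves_nonempty n
    have hcard : ∀ S ∈ halves n, (twoCycles S).card = (twoCycles S₀).card := fun S hS =>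
      card_twoCycles_eq hn hS hS₀
    rw [Finset.expect_eq_sum_div_card, Finset.expect_eq_sum_div_card, Finset.sum_sigma,
      Finset.card_sigma, Finset.sum_congr rfl hcard, Finset.sum_const,
      Finset.sum_congr rfl (g := fun S => (∑ π ∈ twoCycles S, φ S π) / (twoCycles S₀).card),
      ← Finset.sum_div, div_div]
    · congr 1
      simp [mul_comm]
    · intro S hS
      rw [Finset.expect_eq_sum_div_card, hcard S hS]
  rw [hB]
  symm
  refine expect_comp_of_equiv_fibers (P := Σ _ : Finset (Bits n), Equiv.Perm (Bits n))
    (fun σ : Y ≃ Bits n => ⟨A.map σ.toEmbedding, σ.permCongr τ⟩) B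
    (fun σ => ?_) (fun p hp p' hp' => ?_) (fun p => φ p.1 p.2)
  · refine Finset.mem_sigma.2 ⟨(mem_halves hn).2 (by simp [hA]), mem_twoCycles.2 ⟨?_, ?_⟩⟩
    · simpa using isCycleOn_permCongr σ hτ
    · have := isCycleOn_permCongr σ hτc
      rw [Set.image_compl_eq σ.bijective] at this
      simpa using this
  · obtain ⟨hS, hπ⟩ := Finset.mem_sigma.1 hp
    obtain ⟨hS', hπ'⟩ := Finset.mem_sigma.1 hp'
    rw [mem_twoCycles] at hπ hπ'
    obtain ⟨e, hmem, he⟩ := exists_equiv_conj_twoCycles (nonempty_of_mem_halves hn hS).1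
      (nonempty_of_mem_halves hn hS).2 (by rw [(mem_halves hn).1 hS, (mem_halves hn).1 hS'])
      (by rw [card_compl_of_mem_halves hn hS, card_compl_of_mem_halves hn hS'])
      hπ.1 hπ.2 hπ'.1 hπ'.2
    have hSS' : p.1.map e.toEmbedding = p'.1 := by
      ext x
      rw [Finset.mem_map_equiv, hmem, e.apply_symm_apply]
    refine ⟨Equiv.equivCongr (Equiv.refl Y) e, fun σ => ⟨fun h => ?_, fun h => ?_⟩⟩
    · obtain ⟨S, π⟩ := p
      obtain ⟨S', π'⟩ := p'
      simp only [Sigma.mk.injEq, heq_eq_eq] at h ⊢ hSS'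
      refine ⟨?_, permCongr_trans_eq he h.2⟩
      rw [← hSS', ← h.1, Finset.map_map]
      rfl
    · obtain ⟨S, π⟩ := p
      obtain ⟨S', π'⟩ := p'
      simp only [Sigma.mk.injEq, heq_eq_eq] at h ⊢ hSS'
      constructor
      · apply Finset.map_injective e.toEmbedding
        rw [hSS', ← h.1, Finset.map_map]
        rfl
      · have := permCongr_trans_eq (equivariant_symm he) h.2
        refine Eq.trans ?_ this
        congr 1
        ext x
        simp [Equiv.equivCongr]

/-! ### Unitaries -/

/-- The unitary that permutes the computational basis: it maps `φ` to `φ ∘ σ`. -/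
def permUnitary {ι : Type*} [Fintype ι] [DecidableEq ι] (σ : Equiv.Perm ι) :
    Matrix.unitaryGroup ι ℂ :=
  ⟨σ.permMatrix ℂ, by
    rw [Matrix.mem_unitaryGroup_iff, Matrix.star_eq_conjTranspose,
      Matrix.conjTranspose_permMatrix, ← Matrix.permMatrix_mul, inv_mul_cancel,
      Matrix.permMatrix_one]⟩

theorem permUnitary_mulVec {ι : Type*} [Fintype ι] [DecidableEq ι] (σ : Equiv.Perm ι)
    (φ : ι → ℂ) : Matrix.mulVec (permUnitary σ).1 φ = φ ∘ σ :=
  Matrix.permMatrix_mulVec _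

/-- The unitary `U` acting on one factor of a product register. -/
def liftUnitary {α β γ : Type*} [Fintype α] [DecidableEq α] [Fintype β] [DecidableEq β]
    [Fintype γ] [DecidableEq γ] (e : α ≃ β × γ) (U : Matrix.unitaryGroup β ℂ) :
    Matrix.unitaryGroup α ℂ :=
  ⟨(Matrix.kroneckerMap (· * ·) U.1 (1 : Matrix γ γ ℂ)).submatrix e e, by
    have h := Matrix.kronecker_mem_unitary U.2 (one_mem (unitary (Matrix γ γ ℂ)))
    rw [Unitary.mem_iff] at h
    rw [Matrix.mem_unitaryGroup_iff, Matrix.star_eq_conjTranspose, Matrix.conjTranspose_submatrix,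
      Matrix.submatrix_mul_equiv, ← Matrix.star_eq_conjTranspose, h.2, Matrix.submatrix_one_equiv]⟩

theorem liftUnitary_mulVec {α β γ : Type*} [Fintype α] [DecidableEq α] [Fintype β] [DecidableEq β]
    [Fintype γ] [DecidableEq γ] (e : α ≃ β × γ) (U : Matrix.unitaryGroup β ℂ) (φ : α → ℂ) (q : α) :
    Matrix.mulVec (liftUnitary e U).1 φ q =
      ∑ b, U.1 (e q).1 b * φ (e.symm (b, (e q).2)) := by
  rw [Matrix.mulVec, dotProduct, ← e.symm.sum_comp, Fintype.sum_prod_type]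
  refine Finset.sum_congr rfl fun b _ => ?_
  rw [Finset.sum_eq_single (e q).2]
  · simp [liftUnitary]
  · intro c _ hc
    simp [liftUnitary, hc.symm]
  · simp

theorem sum_norm_sq_mulVec {ι : Type*} [Fintype ι] [DecidableEq ι]
    (U : Matrix.unitaryGroup ι ℂ) (φ : ι → ℂ) :
    ∑ i, ‖Matrix.mulVec U.1 φ i‖ ^ 2 = ∑ i, ‖φ i‖ ^ 2 := by
  have key : ∀ χ : ι → ℂ, ((∑ i, ‖χ i‖ ^ 2 : ℝ) : ℂ) = dotProduct (star χ) χ := by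
    intro χ
    push_cast
    refine Finset.sum_congr rfl fun i _ => ?_
    rw [Pi.star_apply, Complex.star_def, ← Complex.normSq_eq_conj_mul_self, Complex.normSq_eq_norm_sq]
    push_cast
    rfl
  have h : dotProduct (star (Matrix.mulVec U.1 φ)) (Matrix.mulVec U.1 φ) =
      dotProduct (star φ) φ := by
    have hU := (Matrix.mem_unitaryGroup_iff').1 U.2
    rw [Matrix.star_mulVec, ← Matrix.dotProduct_mulVec, Matrix.mulVec_mulVec,
      ← Matrix.star_eq_conjTranspose, hU, Matrix.one_mulVec]
  have := (key _).trans (h.trans (key φ).symm)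
  exact_mod_cast this

/-- A unit vector extends to an orthonormal basis. Used to obtain unitaries that prepare uniform
superpositions. -/
theorem exists_unitary_column {ι : Type*} [Fintype ι] [DecidableEq ι] (a : ι) (u : ι → ℂ)
    (hu : ∑ i, ‖u i‖ ^ 2 = 1) : ∃ U : Matrix.unitaryGroup ι ℂ, ∀ i, U.1 i a = u i := by
  have hon : Orthonormal ℂ (({a} : Set ι).domRestrict
      fun _ : ι => (WithLp.toLp 2 u : EuclideanSpace ℂ ι)) := by
    constructor
    · rintro ⟨i, hi⟩
      rw [← sq_eq_sq₀ (norm_nonneg _) zero_le_one, one_pow]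
      simpa [Set.domRestrict, EuclideanSpace.norm_sq_eq] using hu
    · rintro ⟨i, hi⟩ ⟨j, hj⟩ hij
      exact absurd (Subtype.ext ((Set.mem_singleton_iff.1 hi).trans (Set.mem_singleton_iff.1 hj).symm)) hij
  obtain ⟨b, hb⟩ := hon.exists_orthonormalBasis_extension_of_card_eq (by simp)
  refine ⟨⟨(EuclideanSpace.basisFun ι ℂ).toBasis.toMatrix b,
    (EuclideanSpace.basisFun ι ℂ).toMatrix_orthonormalBasis_mem_unitary b⟩, fun i => ?_⟩
  simp [Module.Basis.toMatrix_apply, hb a rfl]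

/-! ### Norms of states -/

/-- The `ℓ²` norm of a vector. -/
def l2norm {ι : Type*} [Fintype ι] (φ : ι → ℂ) : ℝ := ‖(WithLp.toLp 2 φ : EuclideanSpace ℂ ι)‖

theorem l2norm_sq {ι : Type*} [Fintype ι] (φ : ι → ℂ) : l2norm φ ^ 2 = ∑ i, ‖φ i‖ ^ 2 := by
  simp [l2norm, EuclideanSpace.norm_sq_eq]

theorem l2norm_nonneg {ι : Type*} [Fintype ι] (φ : ι → ℂ) : 0 ≤ l2norm φ := norm_nonneg _

theorem l2norm_add_le {ι : Type*} [Fintype ι] (φ χ : ι → ℂ) :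
    l2norm (φ + χ) ≤ l2norm φ + l2norm χ := by
  simpa [l2norm] using
    norm_add_le (WithLp.toLp 2 φ : EuclideanSpace ℂ ι) (WithLp.toLp 2 χ : EuclideanSpace ℂ ι)

theorem l2norm_sub_le {ι : Type*} [Fintype ι] (φ χ : ι → ℂ) :
    l2norm (φ - χ) ≤ l2norm φ + l2norm χ := by
  simpa [l2norm] using
    norm_sub_le (WithLp.toLp 2 φ : EuclideanSpace ℂ ι) (WithLp.toLp 2 χ : EuclideanSpace ℂ ι)

theorem l2norm_eq_of_sum_eq {ι κ : Type*} [Fintype ι] [Fintype κ] {φ : ι → ℂ} {χ : κ → ℂ}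
    (h : ∑ i, ‖φ i‖ ^ 2 = ∑ i, ‖χ i‖ ^ 2) : l2norm φ = l2norm χ := by
  rw [← sq_eq_sq₀ (l2norm_nonneg _) (l2norm_nonneg _), l2norm_sq, l2norm_sq, h]

theorem l2norm_le_of_sum_le {ι κ : Type*} [Fintype ι] [Fintype κ] {φ : ι → ℂ} {χ : κ → ℂ}
    (h : ∑ i, ‖φ i‖ ^ 2 ≤ ∑ i, ‖χ i‖ ^ 2) : l2norm φ ≤ l2norm χ := by
  rw [← sq_le_sq₀ (l2norm_nonneg _) (l2norm_nonneg _), l2norm_sq, l2norm_sq]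
  exact h

theorem l2norm_mulVec {ι : Type*} [Fintype ι] [DecidableEq ι]
    (U : Matrix.unitaryGroup ι ℂ) (φ : ι → ℂ) : l2norm (Matrix.mulVec U.1 φ) = l2norm φ :=
  l2norm_eq_of_sum_eq (sum_norm_sq_mulVec U φ)

/-! ### Query algorithms -/

/-- The permutation of the basis labels made by a query. -/
def queryPerm {X : Type} {m : ℕ} {I : Type} {a : ℕ} (O : X → Bits m) :
    Equiv.Perm (QIndex X m I a) where
  toFun q := (q.1, q.2.1, q.2.2.1 + (if q.1 then O q.2.1 else 0), q.2.2.2)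
  invFun q := (q.1, q.2.1, q.2.2.1 - (if q.1 then O q.2.1 else 0), q.2.2.2)
  left_inv q := by simp
  right_inv q := by simp

section Query

variable {X : Type} [Fintype X] [DecidableEq X] {m : ℕ}
  {I : Type} [Fintype I] [DecidableEq I] {T a : ℕ}

theorem l2norm_applyQuery (O : X → Bits m) (φ : QIndex X m I a → ℂ) :
    l2norm (applyQuery O φ) = l2norm φ :=
  l2norm_eq_of_sum_eq (Equiv.sum_comp (queryPerm O) fun q => ‖φ q‖ ^ 2)

/-- The part of the state whose query register lies in `D`. -/
def queryPart (D : Finset X) (φ : QIndex X m I a → ℂ) : QIndex X m I a → ℂ :=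
  fun q => if q.2.1 ∈ D then φ q else 0

theorem l2norm_queryPart_sq (D : Finset X) (φ : QIndex X m I a → ℂ) :
    l2norm (queryPart D φ) ^ 2 = ∑ q, if q.2.1 ∈ D then ‖φ q‖ ^ 2 else 0 := by
  rw [l2norm_sq]
  refine Finset.sum_congr rfl fun q _ => ?_
  simp only [queryPart]
  split_ifs <;> simp

/-- Outside `D` the oracles act alike, so the difference is `O'` applied to `φ - φ'` plus two
vectors of the norm of the part of `φ` that queries `D`. -/
theorem l2norm_applyQuery_sub_le (O O' : X → Bits m) (D : Finset X)
    (hD : ∀ x, x ∉ D → O x = O' x) (φ φ' : QIndex X m I a → ℂ) :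
    l2norm (applyQuery O φ - applyQuery O' φ') ≤
      l2norm (φ - φ') + 2 * l2norm (queryPart D φ) := by
  have h : applyQuery O φ - applyQuery O' φ' = applyQuery O' (φ - φ') +
      (applyQuery O (queryPart D φ) - applyQuery O' (queryPart D φ)) := by
    ext q
    simp only [applyQuery, queryPart, Pi.sub_apply, Pi.add_apply]
    by_cases hq : q.2.1 ∈ D
    · simp [hq]
    · simp [hq, hD _ hq]
  rw [h]
  refine (l2norm_add_le _ _).trans ?_
  rw [l2norm_applyQuery]
  have := l2norm_sub_le (applyQuery O (queryPart D φ)) (applyQuery O' (queryPart D φ))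
  rw [l2norm_applyQuery, l2norm_applyQuery] at this
  linarith

variable [Zero X]

namespace QueryAlg

theorem l2norm_init (V : QueryAlg X m I T) (ψ : QState I) : l2norm (V.init ψ) = 1 := by
  rw [← sq_eq_sq₀ (l2norm_nonneg _) zero_le_one, one_pow, l2norm_sq, ← ψ.2]
  simp only [Fintype.sum_prod_type, init]
  rw [Finset.sum_eq_single false]
  rotate_left
  · intro b _ hb
    simp [hb]
  · simp
  rw [Finset.sum_eq_single 0]
  rotate_left
  · intro b _ hb
    simp [hb]
  · simp
  rw [Finset.sum_eq_single 0]
  rotate_left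
  · intro b _ hb
    simp [hb]
  · simp
  refine Finset.sum_congr rfl fun i _ => ?_
  rw [Finset.sum_eq_single 0]
  · simp
  · intro b _ hb
    simp [hb]
  · simp

theorem l2norm_state (V : QueryAlg X m I T) (O : X → Bits m) (ψ : QState I) (t : ℕ) :
    l2norm (V.state O ψ t) = 1 := by
  induction t with
  | zero => rw [state, l2norm_mulVec, l2norm_init]
  | succ t ih => rw [state, l2norm_mulVec, l2norm_applyQuery, ih]

theorem acceptProb_nonneg (V : QueryAlg X m I T) (O : X → Bits m) (ψ : QState I) :
    0 ≤ V.acceptProb O ψ :=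
  Finset.sum_nonneg fun _ _ => sq_nonneg _

theorem acceptProb_le_one (V : QueryAlg X m I T) (O : X → Bits m) (ψ : QState I) :
    V.acceptProb O ψ ≤ 1 := by
  have h : V.acceptProb O ψ ≤ ∑ q, ‖V.state O ψ T q‖ ^ 2 :=
    Finset.sum_le_sum_of_subset_of_nonneg (Finset.subset_univ _) fun _ _ _ => sq_nonneg _
  rwa [← l2norm_sq, l2norm_state, one_pow] at h

/-- The hybrid argument. The bound involves only the run with `O`, so it is the same for every `O'`
that differs from `O` on `D`; later this makes the error independent of the block signs. -/
theorem l2norm_state_sub_le (V : QueryAlg X m I T) (O O' : X → Bits m) (D : Finset X)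
    (hD : ∀ x, x ∉ D → O x = O' x) (ψ : QState I) (t : ℕ) :
    l2norm (V.state O ψ t - V.state O' ψ t) ≤
      2 * ∑ s ∈ Finset.range t, l2norm (queryPart D (V.state O ψ s)) := by
  induction t with
  | zero => simp [state, l2norm]
  | succ t ih =>
    rw [state, state, ← Matrix.mulVec_sub, l2norm_mulVec, Finset.sum_range_succ]
    have := l2norm_applyQuery_sub_le O O' D hD (V.state O ψ t) (V.state O' ψ t)
    linarith

theorem acceptProb_le_add (V : QueryAlg X m I T) (O O' : X → Bits m) (D : Finset X)
    (hD : ∀ x, x ∉ D → O x = O' x) (ψ : QState I) :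
    V.acceptProb O' ψ ≤ V.acceptProb O ψ +
      4 * ∑ s ∈ Finset.range T, l2norm (queryPart D (V.state O ψ s)) := by
  set φ := V.state O ψ T with hφ
  set φ' := V.state O' ψ T with hφ'
  let P : (QIndex X m I V.ancillas → ℂ) → QIndex X m I V.ancillas → ℂ :=
    fun χ q => if q ∈ V.accept then χ q else 0
  have hP : ∀ χ, l2norm (P χ) ^ 2 = ∑ q ∈ V.accept, ‖χ q‖ ^ 2 := by
    intro χ
    rw [l2norm_sq, Finset.sum_congr rfl (g := fun q => if q ∈ V.accept then ‖χ q‖ ^ 2 else 0)]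
    · simp
    · intro q _
      simp only [P]
      split_ifs <;> simp
  have hPle : ∀ χ, l2norm (P χ) ≤ l2norm χ := by
    intro χ
    refine l2norm_le_of_sum_le (Finset.sum_le_sum fun q _ => ?_)
    simp only [P]
    split_ifs
    · exact le_rfl
    · simp
  have h1 : l2norm (P φ) ≤ 1 := (hPle _).trans (V.l2norm_state O ψ T).le
  have h1' : l2norm (P φ') ≤ 1 := (hPle _).trans (V.l2norm_state O' ψ T).le
  have h2 : l2norm (P φ') ≤ l2norm (P φ) + l2norm (φ - φ') := by
    have e : P φ' = P φ - P (φ - φ') := by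
      ext q
      simp only [P, Pi.sub_apply]
      split_ifs <;> simp
    rw [e]
    exact (l2norm_sub_le _ _).trans (by linarith [hPle (φ - φ')])
  have h3 := V.l2norm_state_sub_le O O' D hD ψ T
  change ∑ q ∈ V.accept, ‖φ' q‖ ^ 2 ≤ ∑ q ∈ V.accept, ‖φ q‖ ^ 2 + _
  rw [← hP, ← hP]
  -- A difference of squares of two numbers in `[0, 1]` is at most twice their difference.
  nlinarith [l2norm_nonneg (P φ), l2norm_nonneg (P φ'), l2norm_nonneg (φ - φ')]

end QueryAlg

end Query

/-! ### Size-biased random subsets -/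

/-- From `N = 4` on, `1 + 1 / N ≤ 5 / 4` is enough; for `N = 2, 3` the `- 1` is needed. -/
theorem chi_square_size_bias {N : ℕ} (hN : 2 ≤ N) :
    ((2 : ℝ) ^ N - 1) * (N + 1) ≤ 5 / 4 * (N * 2 ^ N) := by
  rcases eq_or_lt_of_le hN with rfl | h
  · norm_num
  rcases eq_or_lt_of_le (show 3 ≤ N from h) with rfl | h
  · norm_num
  have h4 : (4 : ℝ) ≤ N := by exact_mod_cast h
  have hp : (0 : ℝ) < 2 ^ N := by positivity
  nlinarith

/-- By Cauchy–Schwarz the squared `ℓ¹` distance between the size-biased law `p` and the uniform law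
`q` on nonempty sets is at most their chi-square distance, which is at most `1 / 4`. The difference
of means of a `[0, 1]`-valued function is at most half the `ℓ¹` distance. -/
theorem abs_sizeBiased_sub_uniform_le {α : Type*} [Fintype α] [DecidableEq α]
    (hα : 2 ≤ Fintype.card α) (h : Finset α → ℝ) (h0 : ∀ Z, 0 ≤ h Z) (h1 : ∀ Z, h Z ≤ 1) :
    |Finset.expect Finset.univ (fun Z => (Z.card : ℝ) / Fintype.card α * h Z) / (1 / 2) -
      Finset.expect (Finset.univ.filter fun Z => Z ≠ ∅) h| ≤ 1 / 4 := by
  set N := Fintype.card α with hN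
  have hN0 : (0 : ℝ) < N := by exact_mod_cast (by omega : 0 < N)
  have hpow : (4 : ℝ) ≤ 2 ^ N := by
    have := pow_le_pow_right₀ (one_le_two (α := ℝ)) hα
    linarith
  have hpow1 : (2 : ℝ) ^ N - 1 ≠ 0 := by linarith
  set A := Finset.univ.filter fun Z : Finset α => Z ≠ ∅ with hA
  have hAc : (A.card : ℝ) = 2 ^ N - 1 := card_filter_ne_empty α
  set q : ℝ := 1 / (2 ^ N - 1) with hq
  set p : Finset α → ℝ := fun Z => 2 * (Z.card / (N * 2 ^ N)) with hp
  have hsumA : ∀ g : Finset α → ℝ, g ∅ = 0 → ∑ Z ∈ A, g Z = ∑ Z, g Z := by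
    intro g hg
    refine Finset.sum_subset (Finset.subset_univ _) fun Z _ hZ => ?_
    have : Z = ∅ := by simpa [hA] using hZ
    rw [this, hg]
  have hsp : ∑ Z ∈ A, p Z = 1 := by
    rw [hsumA _ (by simp [hp]), ← Finset.mul_sum, ← Finset.sum_div, sum_card_univ, ← hN]
    field_simp
  have hsp2 : ∑ Z ∈ A, p Z ^ 2 = (N + 1) / (N * 2 ^ N) := by
    rw [hsumA _ (by simp [hp])]
    simp only [hp, mul_pow, div_pow]
    rw [← Finset.mul_sum, ← Finset.sum_div, sum_card_sq_univ, ← hN]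
    field_simp
    norm_num
  have hsq : ∑ Z ∈ A, q = 1 := by
    rw [Finset.sum_const, nsmul_eq_mul, hAc, hq, mul_one_div_cancel hpow1]
  have hsd2 : ∑ Z ∈ A, (p Z - q) ^ 2 = (N + 1) / (N * 2 ^ N) - q := by
    have e : ∀ Z, (p Z - q) ^ 2 = p Z ^ 2 - 2 * q * p Z + q * q := fun Z => by ring
    rw [Finset.sum_congr rfl fun Z _ => e Z, Finset.sum_add_distrib, Finset.sum_sub_distrib,
      ← Finset.mul_sum A p, ← Finset.mul_sum A (fun _ => q), hsp, hsp2, hsq]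
    ring
  have hcs : (∑ Z ∈ A, |p Z - q|) ^ 2 ≤ 1 / 4 := by
    refine sq_sum_le_card_mul_sum_sq.trans ?_
    simp only [sq_abs]
    rw [hsd2, hAc, mul_sub, hq, mul_one_div_cancel (by linarith)]
    have := chi_square_size_bias hα
    have h2 : ((2 : ℝ) ^ N - 1) * ((N + 1) / (N * 2 ^ N)) ≤ 5 / 4 := by
      rw [← mul_div_assoc, div_le_iff₀ (by positivity)]
      exact this
    linarith
  have habs : ∑ Z ∈ A, |p Z - q| ≤ 1 / 2 :=
    abs_le_of_sq_le_sq' (by linarith) (by norm_num) |>.2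
  have e1 : Finset.expect Finset.univ (fun Z => (Z.card : ℝ) / N * h Z) / (1 / 2) =
      ∑ Z ∈ A, p Z * h Z := by
    rw [hsumA _ (by simp [hp]), Fintype.expect_eq_sum_div_card, Fintype.card_finset, ← hN,
      Finset.sum_div, Finset.sum_div]
    refine Finset.sum_congr rfl fun Z _ => ?_
    simp only [hp]
    push_cast
    field_simp
  have e2 : Finset.expect A h = ∑ Z ∈ A, q * h Z := by
    rw [Finset.expect_eq_sum_div_card, hAc, ← Finset.mul_sum, hq]
    ring
  -- Both laws have mass one, so `h` may be recentred at `1 / 2`; this gains the factor `1 / 2`.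
  have e3 : ∑ Z ∈ A, p Z * h Z - ∑ Z ∈ A, q * h Z = ∑ Z ∈ A, (p Z - q) * (h Z - 1 / 2) := by
    have e : ∀ Z, (p Z - q) * (h Z - 1 / 2) = p Z * h Z - q * h Z - 1 / 2 * p Z + 1 / 2 * q :=
      fun Z => by ring
    rw [Finset.sum_congr rfl fun Z _ => e Z, Finset.sum_add_distrib, Finset.sum_sub_distrib,
      Finset.sum_sub_distrib, ← Finset.mul_sum A p, ← Finset.mul_sum A (fun _ => q), hsp, hsq]
    ring
  rw [e1, e2, e3]
  refine (Finset.abs_sum_le_sum_abs _ _).trans ?_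
  calc ∑ Z ∈ A, |(p Z - q) * (h Z - 1 / 2)| ≤ ∑ Z ∈ A, |p Z - q| * (1 / 2) := by
        refine Finset.sum_le_sum fun Z _ => ?_
        rw [abs_mul]
        refine mul_le_mul_of_nonneg_left ?_ (abs_nonneg _)
        rw [abs_le]
        constructor <;> linarith [h0 Z, h1 Z]
    _ ≤ 1 / 4 := by
        rw [← Finset.sum_mul]
        linarith

theorem expect_ite_mem_eq {α : Type*} [Fintype α] [DecidableEq α] (Z : Finset α) (f : α → ℝ) :
    Finset.expect Finset.univ (fun r => if r ∈ Z then f r else 0) =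
      (Z.card : ℝ) / Fintype.card α * Finset.expect Z f := by
  rw [Fintype.expect_eq_sum_div_card, Finset.expect_eq_sum_div_card, Finset.sum_ite_mem,
    Finset.univ_inter]
  rcases Z.eq_empty_or_nonempty with rfl | hZ
  · simp
  · have : (Z.card : ℝ) ≠ 0 := by
      have := Finset.card_pos.2 hZ
      positivity
    field_simp

/-! ### Simulating a verifier of the distributional game in the interactive game -/

/-- Separate the registers of the simulated algorithm from the two copies of the challenge. -/
def challengeSplit (n W a : ℕ) : QIndex (Bits n × ZMod 2 × Bits n) n (Bits W × Bits n) a ≃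
    QIndex (ZMod 2 × Bits n) n (Bits W) a × (Bits n × Bits n) where
  toFun q := ((q.1, q.2.1.2, q.2.2.1, q.2.2.2.1.1, q.2.2.2.2), (q.2.1.1, q.2.2.2.1.2))
  invFun p := (p.1.1, (p.2.1, p.1.2.1), p.1.2.2.1, (p.1.2.2.2.1, p.2.2), p.1.2.2.2.2)
  left_inv _ := rfl
  right_inv _ := rfl

/-- Copying the challenge to the query register. -/
def challengeCopy (n W a : ℕ) :
    Equiv.Perm (QIndex (Bits n × ZMod 2 × Bits n) n (Bits W × Bits n) a) where
  toFun q := (q.1, (q.2.1.1 - q.2.2.2.1.2, q.2.1.2), q.2.2)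
  invFun q := (q.1, (q.2.1.1 + q.2.2.2.1.2, q.2.1.2), q.2.2)
  left_inv q := by simp
  right_inv q := by simp

/-- The verifier of the interactive game that runs `V` on the row `F(r, ·)`. -/
def DistVerifier.onChallenge {n W T : ℕ} (V : DistVerifier n W T) : IntVerifier n W T where
  ancillas := V.ancillas
  U t := if t = 0 then liftUnitary (challengeSplit n W V.ancillas) (V.U 0) *
      permUnitary (challengeCopy n W V.ancillas)
    else liftUnitary (challengeSplit n W V.ancillas) (V.U t)
  accept := Finset.univ.filter fun q => (challengeSplit n W V.ancillas q).1 ∈ V.accept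

theorem liftUnitary_challenge_mulVec {n W a : ℕ}
    (U : Matrix.unitaryGroup (QIndex (ZMod 2 × Bits n) n (Bits W) a) ℂ)
    (r : Bits n) (φ : QIndex (ZMod 2 × Bits n) n (Bits W) a → ℂ) :
    Matrix.mulVec (liftUnitary (challengeSplit n W a) U).1
      (fun q => if (challengeSplit n W a q).2 = (r, r) then φ (challengeSplit n W a q).1 else 0) =
    fun q => if (challengeSplit n W a q).2 = (r, r) then
      Matrix.mulVec U.1 φ (challengeSplit n W a q).1 else 0 := by
  ext q
  rw [liftUnitary_mulVec]
  simp only [Equiv.apply_symm_apply]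
  split_ifs with h
  · rfl
  · simp

/-- Once the challenge has been copied, neither copy is ever changed, so every query goes to row `r`
and the remaining registers follow the run of `V` on `F r`. -/
theorem DistVerifier.state_onChallenge {n W T : ℕ} (V : DistVerifier n W T)
    (F : Bits n → Equiv.Perm (Bits n)) (w : Bits W) (r : Bits n) (t : ℕ) :
    QueryAlg.state V.onChallenge (familyOracle F) (QState.basis (w, r)) t =
      fun q => if (challengeSplit n W V.ancillas q).2 = (r, r) then
        QueryAlg.state V (permOracle (F r)) (QState.basis w) t
          (challengeSplit n W V.ancillas q).1 else 0 := by
  induction t with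
  | zero =>
    let φ₀ : QIndex (Bits n × ZMod 2 × Bits n) n (Bits W × Bits n) V.ancillas → ℂ :=
      fun q => if q.1 = false ∧ q.2.1 = 0 ∧ q.2.2.1 = 0 ∧ q.2.2.2.2 = 0 then
        (QState.basis (w, r)).1 q.2.2.2.1 else 0
    have h : φ₀ ∘ challengeCopy n W V.ancillas =
        fun q => if (challengeSplit n W V.ancillas q).2 = (r, r) then
          QueryAlg.init V (QState.basis w) (challengeSplit n W V.ancillas q).1 else 0 := by
      ext ⟨b, ⟨r', x⟩, y, ⟨w', s⟩, c⟩
      have hx : ((r' - s, x) : Bits n × ZMod 2 × Bits n) = 0 ↔ r' = s ∧ x = 0 := by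
        rw [Prod.mk_eq_zero, sub_eq_zero]
      simp only [φ₀, Function.comp, challengeCopy, challengeSplit, QueryAlg.init, QState.basis,
        Equiv.coe_fn_mk, Prod.mk.injEq, hx]
      by_cases hs : s = r
      · subst hs
        by_cases hr : r' = s
        · simp [hr]
          rfl
        · simp [hr]
      · simp [hs]
    rw [QueryAlg.state, QueryAlg.state]
    change Matrix.mulVec ((liftUnitary (challengeSplit n W V.ancillas) (V.U 0)).1 *
      (permUnitary (challengeCopy n W V.ancillas)).1) φ₀ = _
    rw [← Matrix.mulVec_mulVec, permUnitary_mulVec, h]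
    exact liftUnitary_challenge_mulVec _ _ _
  | succ t ih =>
    have h : applyQuery (familyOracle F)
        (QueryAlg.state V.onChallenge (familyOracle F) (QState.basis (w, r)) t) =
        fun q => if (challengeSplit n W V.ancillas q).2 = (r, r) then
          applyQuery (permOracle (F r)) (QueryAlg.state V (permOracle (F r)) (QState.basis w) t)
            (challengeSplit n W V.ancillas q).1 else 0 := by
      rw [ih]
      ext ⟨b, ⟨r', x⟩, y, ⟨w', s⟩, c⟩
      simp only [applyQuery, challengeSplit, Equiv.coe_fn_mk, Prod.mk.injEq, familyOracle]
      by_cases hr : r' = r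
      · subst hr
        rfl
      · simp [hr]
    rw [QueryAlg.state, QueryAlg.state, h]
    exact liftUnitary_challenge_mulVec _ _ _

theorem DistVerifier.acceptProb_onChallenge {n W T : ℕ} (V : DistVerifier n W T)
    (F : Bits n → Equiv.Perm (Bits n)) (w : Bits W) (r : Bits n) :
    QueryAlg.acceptProb V.onChallenge (familyOracle F) (QState.basis (w, r)) =
      QueryAlg.acceptProb V (permOracle (F r)) (QState.basis w) := by
  rw [QueryAlg.acceptProb, V.state_onChallenge]
  change ∑ q ∈ Finset.univ.filter (fun q => (challengeSplit n W V.ancillas q).1 ∈ V.accept), _ = _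
  rw [Finset.sum_filter]
  rw [← (challengeSplit n W V.ancillas).symm.sum_comp, Fintype.sum_prod_type, QueryAlg.acceptProb]
  simp only [Equiv.apply_symm_apply]
  rw [← Finset.sum_filter_add_sum_filter_not Finset.univ (· ∈ V.accept)]
  rw [Finset.sum_congr rfl (g := fun q =>
    ‖QueryAlg.state V (permOracle (F r)) (QState.basis w) T q‖ ^ 2), Finset.sum_congr rfl
    (g := fun _ => (0 : ℝ)) (s₂ := Finset.univ.filter fun q => q ∉ V.accept)]
  · simp
  · intro q hq
    simp [(Finset.mem_filter.1 hq).2]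
  · intro q hq
    rw [Finset.sum_eq_single (r, r)]
    · simp [(Finset.mem_filter.1 hq).2]
    · intro p _ hp
      simp [hp]
    · simp

/-! ### The reduction -/

theorem sampleExp_eq {n : ℕ} (Zs : Finset (Finset (Bits n)))
    (g : Finset (Bits n) → (Bits n → Equiv.Perm (Bits n)) → ℝ) :
    sampleExp Zs g = Finset.expect Zs fun Z =>
      Finset.expect (halves n) fun S => Finset.expect (families S Z) fun F => g Z F :=
  Finset.expect_comm _ _ _

theorem sampleExp_mul_left {n : ℕ} (Zs : Finset (Finset (Bits n))) (u : Finset (Bits n) → ℝ)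
    (g : Finset (Bits n) → (Bits n → Equiv.Perm (Bits n)) → ℝ) :
    sampleExp Zs (fun Z F => u Z * g Z F) = Finset.expect Zs fun Z => u Z *
      Finset.expect (halves n) fun S => Finset.expect (families S Z) fun F => g Z F := by
  rw [sampleExp_eq]
  simp only [Finset.mul_expect]

theorem sampleExp_mono {n : ℕ} {Zs : Finset (Finset (Bits n))}
    {g g' : Finset (Bits n) → (Bits n → Equiv.Perm (Bits n)) → ℝ}
    (h : ∀ S ∈ halves n, ∀ Z ∈ Zs, ∀ F ∈ families S Z, g Z F ≤ g' Z F) :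
    sampleExp Zs g ≤ sampleExp Zs g' :=
  expect_mono fun S hS => expect_mono fun Z hZ => expect_mono fun F hF => h S hS Z hZ F hF

theorem sampleExp_congr {n : ℕ} {Zs : Finset (Finset (Bits n))}
    {g g' : Finset (Bits n) → (Bits n → Equiv.Perm (Bits n)) → ℝ}
    (h : ∀ S ∈ halves n, ∀ Z ∈ Zs, ∀ F ∈ families S Z, g Z F = g' Z F) :
    sampleExp Zs g = sampleExp Zs g' :=
  le_antisymm (sampleExp_mono fun S hS Z hZ F hF => (h S hS Z hZ F hF).le)
    (sampleExp_mono fun S hS Z hZ F hF => (h S hS Z hZ F hF).ge)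

theorem expect_card_div_card (n : ℕ) :
    Finset.expect Finset.univ (fun Z : Finset (Bits n) => (Z.card : ℝ) / Fintype.card (Bits n)) =
      1 / 2 := by
  rw [← Finset.expect_div, Fintype.expect_eq_sum_div_card, sum_card_univ, Fintype.card_finset]
  have : (0 : ℝ) < Fintype.card (Bits n) := by exact_mod_cast Fintype.card_pos
  push_cast
  field_simp

theorem sampleExp_mem_eq_half (n : ℕ) :
    sampleExp Finset.univ (fun Z (_ : Bits n → Equiv.Perm (Bits n)) =>
      Finset.expect Finset.univ fun r => if r ∈ Z then (1 : ℝ) else 0) = 1 / 2 := by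
  have h := sampleExp_mul_left (n := n) Finset.univ
    (fun Z => (Z.card : ℝ) / Fintype.card (Bits n)) (fun _ _ => 1)
  rw [← expect_card_div_card n]
  refine Eq.trans (sampleExp_congr fun S _ Z _ F _ => ?_) (h.trans ?_)
  · rw [expect_ite_mem_eq]
    rcases Z.eq_empty_or_nonempty with rfl | hZ
    · simp
    · rw [Finset.expect_const hZ]
  · refine Finset.expect_congr rfl fun Z _ => ?_
    rw [Finset.expect_congr rfl fun S _ => Finset.expect_const (families_nonempty S Z) (1 : ℝ),
      Finset.expect_const (halves_nonempty n), mul_one]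

theorem sampleExp_notMem_eq_half (n : ℕ) :
    sampleExp Finset.univ (fun Z (_ : Bits n → Equiv.Perm (Bits n)) =>
      Finset.expect Finset.univ fun r => if r ∉ Z then (1 : ℝ) else 0) = 1 / 2 := by
  have h := sampleExp_mul_left (n := n) Finset.univ
    (fun Z => (Zᶜ.card : ℝ) / Fintype.card (Bits n)) (fun _ _ => 1)
  rw [← expect_card_div_card n]
  refine Eq.trans (sampleExp_congr fun S _ Z _ F _ => ?_) (h.trans ?_)
  · simp only [← Finset.mem_compl]
    rw [expect_ite_mem_eq]
    rcases Zᶜ.eq_empty_or_nonempty with h | hZ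
    · simp [h]
    · rw [Finset.expect_const hZ]
  · refine Fintype.expect_equiv (Equiv.ofBijective (fun Z : Finset (Bits n) => Zᶜ)
      compl_bijective) _ _ fun Z => ?_
    rw [Finset.expect_congr rfl fun S _ => Finset.expect_const (families_nonempty S Z) (1 : ℝ),
      Finset.expect_const (halves_nonempty n), mul_one]
    simp

theorem two_le_card_bits {n : ℕ} (hn : 1 ≤ n) : 2 ≤ Fintype.card (Bits n) := by
  rw [card_bits]
  calc 2 = 2 ^ 1 := rfl
    _ ≤ 2 ^ n := Nat.pow_le_pow_right (by norm_num) hn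

theorem le_sizeBiased_sampleExp {n : ℕ} (hn : 1 ≤ n)
    (g : Finset (Bits n) → (Bits n → Equiv.Perm (Bits n)) → ℝ)
    (h0 : ∀ Z F, 0 ≤ g Z F) (h1 : ∀ Z F, g Z F ≤ 1) :
    sampleExp (Finset.univ.filter fun Z => Z ≠ ∅) g - 1 / 4 ≤
      sampleExp Finset.univ (fun Z F => (Z.card : ℝ) / Fintype.card (Bits n) * g Z F) /
        (1 / 2) := by
  rw [sampleExp_eq, sampleExp_mul_left]
  have := abs_sizeBiased_sub_uniform_le (two_le_card_bits hn)
    (fun Z => Finset.expect (halves n) fun S => Finset.expect (families S Z) fun F => g Z F)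
    (fun Z => expect_nonneg_of fun S _ => expect_nonneg_of fun F _ => h0 Z F)
    (fun Z => expect_le_of zero_le_one fun S _ => expect_le_of zero_le_one fun F _ => h1 Z F)
  linarith [(abs_le.1 this).1]

/-- Complementation preserves the uniform law on subsets, so this is the size-bias estimate for
`Zᶜ`. -/
theorem sizeBiased_compl_sampleExp_le {n : ℕ} (hn : 1 ≤ n)
    (g : Finset (Bits n) → (Bits n → Equiv.Perm (Bits n)) → ℝ)
    (h0 : ∀ Z F, 0 ≤ g Z F) (h1 : ∀ Z F, g Z F ≤ 1) :
    sampleExp Finset.univ (fun Z F => (Zᶜ.card : ℝ) / Fintype.card (Bits n) * g Z F) / (1 / 2) ≤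
      sampleExp (Finset.univ.filter fun Z => Zᶜ ≠ ∅) g + 1 / 4 := by
  rw [sampleExp_mul_left, sampleExp_eq]
  have := abs_sizeBiased_sub_uniform_le (two_le_card_bits hn)
    (fun Z => Finset.expect (halves n) fun S => Finset.expect (families S Zᶜ) fun F => g Zᶜ F)
    (fun Z => expect_nonneg_of fun S _ => expect_nonneg_of fun F _ => h0 _ F)
    (fun Z => expect_le_of zero_le_one fun S _ => expect_le_of zero_le_one fun F _ => h1 _ F)
  have e1 : Finset.expect Finset.univ (fun Z : Finset (Bits n) =>
      (Zᶜ.card : ℝ) / Fintype.card (Bits n) * Finset.expect (halves n)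
        fun S => Finset.expect (families S Z) fun F => g Z F) =
      Finset.expect Finset.univ (fun Z : Finset (Bits n) =>
      (Z.card : ℝ) / Fintype.card (Bits n) * Finset.expect (halves n)
        fun S => Finset.expect (families S Zᶜ) fun F => g Zᶜ F) :=
    Fintype.expect_equiv (Equiv.ofBijective (fun Z : Finset (Bits n) => Zᶜ)
      compl_bijective) _ _ fun Z => by simp
  have e2 : Finset.expect (Finset.univ.filter fun Z : Finset (Bits n) => Zᶜ ≠ ∅) (fun Z =>
      Finset.expect (halves n) fun S => Finset.expect (families S Z) fun F => g Z F) =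
      Finset.expect (Finset.univ.filter fun Z : Finset (Bits n) => Z ≠ ∅) (fun Z =>
      Finset.expect (halves n) fun S => Finset.expect (families S Zᶜ) fun F => g Zᶜ F) :=
    Finset.expect_equiv (Equiv.ofBijective (fun Z : Finset (Bits n) => Zᶜ)
      compl_bijective) (by simp) (by simp)
  rw [e1, e2]
  linarith [(abs_le.1 this).2]

theorem expect_eq_sum_oracleLaw {n : ℕ} (A : Finset (Bits n)) (F : Bits n → Equiv.Perm (Bits n))
    (f : Equiv.Perm (Bits n) → ℝ) :
    Finset.expect A (fun r => f (F r)) = ∑ π, oracleLaw A F π * f π := by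
  simp only [oracleLaw, Finset.expect_mul]
  rw [← Finset.expect_sum_comm]
  simp

/-- The acceptance averaged over `r ∈ A` is linear in the law of `F r`, so a best witness can be
chosen from the law alone. A prover who sees all of `F` has no advantage. -/
theorem exists_optimal_classicalProver {n W T : ℕ} (V : DistVerifier n W T) :
    ∃ Q : ClassicalProver n W, ∀ (A : Finset (Bits n)) (F : Bits n → Equiv.Perm (Bits n))
      (w : Bits W),
      Finset.expect A (fun r => QueryAlg.acceptProb V (permOracle (F r)) (QState.basis w)) ≤
        Finset.expect A (fun r => QueryAlg.acceptProb V (permOracle (F r))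
          (QState.basis (Q (oracleLaw A F)))) := by
  have h : ∀ D : Equiv.Perm (Bits n) → ℝ, ∃ w₀ : Bits W, ∀ w : Bits W,
      ∑ π, D π * QueryAlg.acceptProb V (permOracle π) (QState.basis w) ≤
        ∑ π, D π * QueryAlg.acceptProb V (permOracle π) (QState.basis w₀) :=
    fun D => Finite.exists_max _
  choose Q hQ using h
  refine ⟨Q, fun A F w => ?_⟩
  rw [expect_eq_sum_oracleLaw A F
      (fun π => QueryAlg.acceptProb V (permOracle π) (QState.basis w)),
    expect_eq_sum_oracleLaw A F
      (fun π => QueryAlg.acceptProb V (permOracle π) (QState.basis (Q (oracleLaw A F))))]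
  exact hQ _ w

open Classical in
/-- The set `Z` of two-cycle rows, read off from the family. -/
def twoCycleRows {n : ℕ} (F : Bits n → Equiv.Perm (Bits n)) : Finset (Bits n) :=
  Finset.univ.filter fun r => F r ∉ fullCycles n

theorem twoCycleRows_eq {n : ℕ} (hn : 1 ≤ n) {S Z : Finset (Bits n)} (hS : S ∈ halves n)
    {F : Bits n → Equiv.Perm (Bits n)} (hF : F ∈ families S Z) : twoCycleRows F = Z := by
  ext r
  have h := Fintype.mem_piFinset.1 hF r
  by_cases hr : r ∈ Z
  · rw [if_pos hr] at h
    simp [twoCycleRows, hr, notMem_fullCycles_of_mem_twoCycles hn hS h]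
  · rw [if_neg hr] at h
    simp [twoCycleRows, hr, h]

theorem intQCMA_of_distQCMA {n W T : ℕ} (hn : 1 ≤ n) (V : DistVerifier n W T)
    (P : ClassicalProver n W) {ε₁ ε₂ : ℝ} (h : IsDistQCMA V P (1 - ε₁) ε₂) :
    IsIntQCMA V.onChallenge (fun F => P (oracleLaw (twoCycleRows F) F))
      (3 / 4 - ε₁) (1 / 4 + ε₂) := by
  obtain ⟨hc, hs⟩ := h
  have hbound : ∀ (A : Finset (Bits n)) (F : Bits n → Equiv.Perm (Bits n)) (w : Bits W),
      0 ≤ Finset.expect A (fun r =>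
        QueryAlg.acceptProb V (permOracle (F r)) (QState.basis w)) ∧
      Finset.expect A (fun r =>
        QueryAlg.acceptProb V (permOracle (F r)) (QState.basis w)) ≤ 1 := fun A F w =>
    ⟨expect_nonneg_of fun r _ => QueryAlg.acceptProb_nonneg _ _ _,
      expect_le_of zero_le_one fun r _ => QueryAlg.acceptProb_le_one _ _ _⟩
  constructor
  · have key := le_sizeBiased_sampleExp hn
      (fun Z F => Finset.expect Z fun r =>
        QueryAlg.acceptProb V (permOracle (F r)) (P.toQuantum (oracleLaw Z F)))
      (fun Z F => (hbound Z F _).1) (fun Z F => (hbound Z F _).2)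
    rw [intCorrectness, sampleExp_mem_eq_half]
    have e : sampleExp Finset.univ (fun Z F => Finset.expect Finset.univ fun r =>
        if r ∈ Z then intAccept V.onChallenge (fun F => P (oracleLaw (twoCycleRows F) F)) F r
          else 0) = sampleExp Finset.univ (fun Z F => (Z.card : ℝ) / Fintype.card (Bits n) *
        Finset.expect Z fun r =>
          QueryAlg.acceptProb V (permOracle (F r)) (P.toQuantum (oracleLaw Z F))) := by
      refine sampleExp_congr fun S hS Z _ F hF => ?_
      rw [expect_ite_mem_eq]
      congr 1
      refine Finset.expect_congr rfl fun r _ => ?_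
      rw [intAccept, V.acceptProb_onChallenge, twoCycleRows_eq hn hS hF]
      rfl
    rw [e]
    unfold distYesAccept at hc
    linarith
  · intro Q
    obtain ⟨Q', hQ'⟩ := exists_optimal_classicalProver V
    have key := sizeBiased_compl_sampleExp_le hn
      (fun Z F => Finset.expect Zᶜ fun r =>
        QueryAlg.acceptProb V (permOracle (F r)) (Q'.toQuantum (oracleLaw Zᶜ F)))
      (fun Z F => (hbound Zᶜ F _).1) (fun Z F => (hbound Zᶜ F _).2)
    have hs' := hs Q'
    unfold distNoAccept at hs'
    rw [intSoundnessError, sampleExp_notMem_eq_half]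
    refine le_trans ?_ (key.trans (by linarith))
    refine div_le_div_of_nonneg_right (sampleExp_mono fun S hS Z _ F hF => ?_) (by norm_num)
    simp only [← Finset.mem_compl]
    rw [expect_ite_mem_eq]
    refine mul_le_mul_of_nonneg_left ?_ (by positivity)
    refine le_trans (le_of_eq ?_) (hQ' Zᶜ F (Q F))
    refine Finset.expect_congr rfl fun r _ => ?_
    rw [intAccept, V.acceptProb_onChallenge]

/-! ### Fourier analysis on the cube of subsets -/

/-- The Walsh character `(-1) ^ |U ∩ u|`. -/
def walsh {J : Type*} [DecidableEq J] (U u : Finset J) : ℝ := ∏ j ∈ U, if j ∈ u then -1 else 1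

theorem walsh_symmDiff {J : Type*} [DecidableEq J] (U u v : Finset J) :
    walsh U (symmDiff u v) = walsh U u * walsh U v := by
  rw [walsh, walsh, walsh, ← Finset.prod_mul_distrib]
  refine Finset.prod_congr rfl fun j _ => ?_
  by_cases h1 : j ∈ u <;> by_cases h2 : j ∈ v <;> simp [Finset.mem_symmDiff, h1, h2]

theorem abs_walsh {J : Type*} [DecidableEq J] (U u : Finset J) : |walsh U u| = 1 := by
  rw [walsh, Finset.abs_prod]
  refine Finset.prod_eq_one fun j _ => ?_
  split_ifs <;> simp

theorem sum_walsh {J : Type*} [Fintype J] [DecidableEq J] (u : Finset J) :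
    ∑ U : Finset J, walsh U u = if u = ∅ then 2 ^ Fintype.card J else 0 := by
  have h := Finset.prod_add_one (s := (Finset.univ : Finset J))
    (f := fun j => if j ∈ u then (-1 : ℝ) else 1)
  rw [Finset.powerset_univ] at h
  unfold walsh
  rw [← h]
  split_ifs with hu
  · subst hu
    simp
    norm_num
  · obtain ⟨j, hj⟩ := Finset.nonempty_iff_ne_empty.2 hu
    exact Finset.prod_eq_zero (Finset.mem_univ j) (by simp [hj])

/-- The normalized Fourier coefficient. -/
def walshCoeff {J : Type*} [Fintype J] [DecidableEq J] (f : Finset J → ℝ) (U : Finset J) : ℝ :=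
  (∑ u, f u * walsh U u) / 2 ^ Fintype.card J

/-- The squared coefficients are the Fourier transform of the autocorrelation: expanding the square,
orthogonality leaves only the pairs at distance `v`. -/
theorem sum_walshCoeff_sq_mul_walsh {J : Type*} [Fintype J] [DecidableEq J]
    (f : Finset J → ℝ) (v : Finset J) :
    ∑ U, walshCoeff f U ^ 2 * walsh U v = Finset.expect Finset.univ
      fun u => f u * f (symmDiff u v) := by
  have h1 : ∀ U, (∑ u, f u * walsh U u) ^ 2 * walsh U v =
      ∑ u, ∑ u', f u * f u' * walsh U (symmDiff (symmDiff u v) u') := by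
    intro U
    rw [sq, Finset.sum_mul_sum, Finset.sum_mul]
    refine Finset.sum_congr rfl fun u _ => ?_
    rw [Finset.sum_mul]
    refine Finset.sum_congr rfl fun u' _ => ?_
    rw [walsh_symmDiff, walsh_symmDiff]
    ring
  have h2 : ∑ U, (∑ u, f u * walsh U u) ^ 2 * walsh U v =
      2 ^ Fintype.card J * ∑ u, f u * f (symmDiff u v) := by
    rw [Finset.sum_congr rfl fun U _ => h1 U, Finset.sum_comm, Finset.mul_sum]
    refine Finset.sum_congr rfl fun u _ => ?_
    rw [Finset.sum_comm, Finset.sum_eq_single (symmDiff u v)]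
    · rw [← Finset.mul_sum, sum_walsh, if_pos (by simp)]
      ring
    · intro u' _ hu'
      rw [← Finset.mul_sum, sum_walsh, if_neg, mul_zero]
      intro h
      exact hu' (symmDiff_eq_bot.1 h).symm
    · simp
  have h3 : ∀ U, walshCoeff f U ^ 2 * walsh U v =
      ((∑ u, f u * walsh U u) ^ 2 * walsh U v) / (2 ^ Fintype.card J) ^ 2 := by
    intro U
    rw [walshCoeff, div_pow]
    ring
  rw [Finset.sum_congr rfl fun U _ => h3 U, ← Finset.sum_div, h2, Fintype.expect_eq_sum_div_card,
    Fintype.card_finset]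
  push_cast
  field_simp

/-! ### Hypercontractivity for indicator functions -/

/-- With `x = y ^ 2` and `log y ≥ 1 - 1 / y`, the claim reduces to `(y - 1) ^ 2 * (y + 1) ^ 2 ≤ 6 *
(y - 1) ^ 2`, and `y ≤ √2` gives `(y + 1) ^ 2 ≤ 6`. This is the origin of the constant `6` in the
exponents. -/
theorem sub_one_add_sq_le_mul_log {x : ℝ} (hx : 0 < x) (hx2 : x ≤ 2) :
    (x - 1) + (x - 1) ^ 2 / 6 ≤ x * Real.log x := by
  obtain ⟨y, hy, rfl⟩ : ∃ y : ℝ, 0 < y ∧ y ^ 2 = x :=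
    ⟨Real.sqrt x, Real.sqrt_pos.2 hx, Real.sq_sqrt hx.le⟩
  have h1 : y ^ 2 * (2 * (1 - y⁻¹)) ≤ y ^ 2 * Real.log (y ^ 2) := by
    rw [Real.log_pow]
    have := Real.one_sub_inv_le_log_of_pos hy
    push_cast
    gcongr
  have h2 : y ^ 2 * (2 * (1 - y⁻¹)) = 2 * y ^ 2 - 2 * y := by
    field_simp
  have h3 : (y + 1) ^ 2 ≤ 6 := by
    nlinarith
  nlinarith [mul_nonneg (sq_nonneg (y - 1)) (sub_nonneg.2 h3)]

/-- From `x * exp (6 ρ log x) ≥ x + 6 ρ x log x` and the quadratic lower bound for `x log x`. -/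
theorem quadratic_le_rpow {ρ x : ℝ} (hρ : 0 ≤ ρ) (hx : 0 ≤ x) (hx2 : x ≤ 2) :
    1 + (1 + 6 * ρ) * (x - 1) + ρ * (x - 1) ^ 2 ≤ x ^ (1 + 6 * ρ) := by
  rcases hx.eq_or_lt with rfl | hx
  · rw [Real.zero_rpow (by positivity)]
    nlinarith
  · have h1 : x ^ (1 + 6 * ρ) = x * Real.exp (6 * ρ * Real.log x) := by
      rw [Real.rpow_add hx, Real.rpow_one, Real.rpow_def_of_pos hx, mul_comm (Real.log x)]
    have h2 := Real.add_one_le_exp (6 * ρ * Real.log x)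
    have h3 := mul_le_mul_of_nonneg_left (sub_one_add_sq_le_mul_log hx hx2)
      (show 0 ≤ 6 * ρ by positivity)
    rw [h1]
    have h4 := mul_le_mul_of_nonneg_left h2 hx.le
    nlinarith

/-- The one-coordinate hypercontractive inequality. Scale the mean to `1`, so that the values are `1
± t`; averaging the quadratic lower bound cancels the linear terms. The power `2 / p` is at least
`1` because `ρ ≤ 1 / 6`, so raising to it keeps `1 + ρ t ^ 2` as a lower bound. -/
theorem two_point_inequality {ρ A B : ℝ} (hρ : 0 ≤ ρ) (hρ6 : ρ ≤ 1 / 6) (hA : 0 ≤ A) (hB : 0 ≤ B) :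
    (A + B) ^ 2 + ρ * (A - B) ^ 2 ≤
      4 * ((A ^ (1 + 6 * ρ) + B ^ (1 + 6 * ρ)) / 2) ^ (2 / (1 + 6 * ρ)) := by
  set p := 1 + 6 * ρ with hp
  have hp0 : 0 < p := by positivity
  rcases (add_nonneg hA hB).eq_or_lt with h | h
  · have hA0 : A = 0 := by linarith
    have hB0 : B = 0 := by linarith
    subst hA0 hB0
    simp only [add_zero, sub_zero, ne_eq, OfNat.ofNat_ne_zero, not_false_eq_true, zero_pow, mul_zero]
    positivity
  · set m := (A + B) / 2 with hm
    have hm0 : 0 < m := by positivity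
    set t := (A - B) / (2 * m) with ht
    have hAm : A = m * (1 + t) := by
      rw [ht]; field_simp; rw [hm]; ring
    have hBm : B = m * (1 - t) := by
      rw [ht]; field_simp; rw [hm]; ring
    have ht1 : 0 ≤ 1 + t := by
      by_contra hc
      nlinarith
    have ht2 : 0 ≤ 1 - t := by
      by_contra hc
      nlinarith
    have e1 := quadratic_le_rpow hρ ht1 (by linarith)
    have e2 := quadratic_le_rpow hρ ht2 (by linarith)
    have e3 : m ^ p * (1 + ρ * t ^ 2) ≤ (A ^ p + B ^ p) / 2 := by
      have q1 : A ^ p = m ^ p * (1 + t) ^ p := by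
        rw [← Real.mul_rpow hm0.le ht1, ← hAm]
      have q2 : B ^ p = m ^ p * (1 - t) ^ p := by
        rw [← Real.mul_rpow hm0.le ht2, ← hBm]
      rw [q1, q2]
      have hmp : 0 ≤ m ^ p := by positivity
      nlinarith
    have e4 : m ^ 2 * (1 + ρ * t ^ 2) ≤ ((A ^ p + B ^ p) / 2) ^ (2 / p) := by
      have ht0 : 1 ≤ 1 + ρ * t ^ 2 := by nlinarith [mul_nonneg hρ (sq_nonneg t)]
      calc m ^ 2 * (1 + ρ * t ^ 2) ≤ m ^ 2 * (1 + ρ * t ^ 2) ^ (2 / p) := by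
            refine mul_le_mul_of_nonneg_left ?_ (sq_nonneg m)
            have h21 : 1 ≤ 2 / p := by
              rw [le_div_iff₀ hp0]
              linarith
            calc 1 + ρ * t ^ 2 = (1 + ρ * t ^ 2) ^ (1 : ℝ) := (Real.rpow_one _).symm
              _ ≤ _ := Real.rpow_le_rpow_of_exponent_le ht0 h21
        _ = (m ^ p * (1 + ρ * t ^ 2)) ^ (2 / p) := by
            rw [Real.mul_rpow (by positivity) (by linarith), ← Real.rpow_mul hm0.le,
              mul_div_cancel₀ _ hp0.ne', Real.rpow_two]
        _ ≤ _ := Real.rpow_le_rpow (by positivity) e3 (by positivity)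
    have e5 : (A + B) ^ 2 + ρ * (A - B) ^ 2 = 4 * (m ^ 2 * (1 + ρ * t ^ 2)) := by
      rw [hAm, hBm]
      ring
    rw [e5]
    linarith

/-- Tensorization, one coordinate at a time: `f` splits into its restrictions to `a ∉ u` and `a ∈
u`, and the two-point inequality merges the two inductive bounds. For a 0/1 function the squared
`p`-norm is the mean to the power `2 / p`, which gives the right-hand side its form. -/
theorem sum_rpow_card_mul_fourier_sq_le {J : Type*} [DecidableEq J] {ρ : ℝ} (hρ : 0 ≤ ρ)
    (hρ6 : ρ ≤ 1 / 6) (s : Finset J) :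
    ∀ f : Finset J → ℝ, (∀ u, f u = 0 ∨ f u = 1) →
      ∑ U ∈ s.powerset, ρ ^ U.card * (∑ u ∈ s.powerset, f u * walsh U u) ^ 2 ≤
        4 ^ s.card * ((∑ u ∈ s.powerset, f u) / 2 ^ s.card) ^ (2 / (1 + 6 * ρ)) := by
  set p := 1 + 6 * ρ with hp
  have hp0 : 0 < p := by positivity
  induction s using Finset.induction_on with
  | empty =>
    intro f hf
    rcases hf ∅ with h | h
    · simp [h, walsh, Real.zero_rpow (by positivity : 2 / p ≠ 0)]
    · simp [h, walsh]
  | insert a s ha ih =>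
    intro f hf
    have hmem : ∀ {U : Finset J}, U ∈ s.powerset → a ∉ U := fun hU h =>
      ha (Finset.mem_powerset.1 hU h)
    set x : Finset J → ℝ := fun U => ∑ u ∈ s.powerset, f u * walsh U u with hx
    set y : Finset J → ℝ := fun U => ∑ u ∈ s.powerset, f (insert a u) * walsh U u with hy
    have hw1 : ∀ U ∈ s.powerset, ∀ u, walsh U (insert a u) = walsh U u := by
      intro U hU u
      refine Finset.prod_congr rfl fun j hj => ?_
      have : j ≠ a := fun h => hmem hU (h ▸ hj)
      simp [this]
    have hw2 : ∀ U ∈ s.powerset, ∀ u ∈ s.powerset, walsh (insert a U) u = walsh U u := by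
      intro U hU u hu
      rw [walsh, Finset.prod_insert (hmem hU), if_neg (hmem hu), one_mul, walsh]
    have hw3 : ∀ U ∈ s.powerset, ∀ u, walsh (insert a U) (insert a u) = -walsh U u := by
      intro U hU u
      rw [walsh, Finset.prod_insert (hmem hU), if_pos (Finset.mem_insert_self a u), ← walsh,
        hw1 U hU]
      ring
    have e1 : ∀ U ∈ s.powerset,
        ∑ u ∈ (insert a s).powerset, f u * walsh U u = x U + y U := by
      intro U hU
      rw [Finset.sum_powerset_insert ha]
      congr 1
      exact Finset.sum_congr rfl fun u _ => by rw [hw1 U hU]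
    have e2 : ∀ U ∈ s.powerset,
        ∑ u ∈ (insert a s).powerset, f u * walsh (insert a U) u = x U - y U := by
      intro U hU
      rw [Finset.sum_powerset_insert ha, sub_eq_add_neg, hy, ← Finset.sum_neg_distrib]
      congr 1
      · exact Finset.sum_congr rfl fun u hu => by rw [hw2 U hU u hu]
      · exact Finset.sum_congr rfl fun u _ => by rw [hw3 U hU, mul_neg]
    set α := (∑ u ∈ s.powerset, f u) / 2 ^ s.card with hα
    set β := (∑ u ∈ s.powerset, f (insert a u)) / 2 ^ s.card with hβ
    have hf0 : ∀ u, 0 ≤ f u := fun u => by rcases hf u with h | h <;> simp [h]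
    have hα0 : 0 ≤ α := div_nonneg (Finset.sum_nonneg fun u _ => hf0 u) (by positivity)
    have hβ0 : 0 ≤ β := div_nonneg (Finset.sum_nonneg fun u _ => hf0 _) (by positivity)
    have ihx := ih f hf
    have ihy := ih (fun u => f (insert a u)) fun u => hf _
    change ∑ U ∈ s.powerset, ρ ^ U.card * x U ^ 2 ≤ 4 ^ s.card * α ^ (2 / p) at ihx
    change ∑ U ∈ s.powerset, ρ ^ U.card * y U ^ 2 ≤ 4 ^ s.card * β ^ (2 / p) at ihy
    set A := α ^ (1 / p) with hA
    set B := β ^ (1 / p) with hB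
    have hA0 : 0 ≤ A := by positivity
    have hB0 : 0 ≤ B := by positivity
    have hAA : α ^ (2 / p) = A ^ 2 := by
      rw [hA, ← Real.rpow_natCast, ← Real.rpow_mul hα0]
      congr 1
      push_cast
      ring
    have hBB : β ^ (2 / p) = B ^ 2 := by
      rw [hB, ← Real.rpow_natCast, ← Real.rpow_mul hβ0]
      congr 1
      push_cast
      ring
    have hAp : A ^ p = α := by
      rw [hA, ← Real.rpow_mul hα0, one_div_mul_cancel hp0.ne', Real.rpow_one]
    have hBp : B ^ p = β := by
      rw [hB, ← Real.rpow_mul hβ0, one_div_mul_cancel hp0.ne', Real.rpow_one]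
    rw [hAA] at ihx
    rw [hBB] at ihy
    -- Cauchy–Schwarz with weights `ρ ^ |U|`. The mixed term enters below with the coefficient `2 *
    -- (1 - ρ) ≥ 0`, so an upper bound suffices.
    have hcross : ∑ U ∈ s.powerset, ρ ^ U.card * (x U * y U) ≤ 4 ^ s.card * (A * B) := by
      refine le_of_sq_le_sq ?_ (by positivity)
      have cs := Finset.sum_mul_sq_le_sq_mul_sq s.powerset
        (fun U => Real.sqrt (ρ ^ U.card) * x U) (fun U => Real.sqrt (ρ ^ U.card) * y U)
      have hs : ∀ U : Finset J, Real.sqrt (ρ ^ U.card) * Real.sqrt (ρ ^ U.card) = ρ ^ U.card :=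
        fun U => Real.mul_self_sqrt (by positivity)
      have c1 : ∀ U : Finset J, Real.sqrt (ρ ^ U.card) * x U * (Real.sqrt (ρ ^ U.card) * y U) =
          ρ ^ U.card * (x U * y U) := fun U => by
        conv_rhs => rw [← hs U]
        ring
      have c2 : ∀ (z : Finset J → ℝ) (U : Finset J), (Real.sqrt (ρ ^ U.card) * z U) ^ 2 =
          ρ ^ U.card * z U ^ 2 := fun z U => by
        rw [mul_pow, sq (Real.sqrt _), hs]
      simp only [c1, c2] at cs
      refine cs.trans ?_
      have := mul_le_mul ihx ihy (Finset.sum_nonneg fun U _ => by positivity) (by positivity)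
      refine this.trans (le_of_eq ?_)
      ring
    rw [Finset.sum_powerset_insert ha, ← Finset.sum_add_distrib,
      Finset.sum_congr rfl (g := fun U => (1 + ρ) * (ρ ^ U.card * x U ^ 2) +
        (1 + ρ) * (ρ ^ U.card * y U ^ 2) + 2 * (1 - ρ) * (ρ ^ U.card * (x U * y U)))]
    · rw [Finset.sum_add_distrib, Finset.sum_add_distrib, ← Finset.mul_sum, ← Finset.mul_sum,
        ← Finset.mul_sum, Finset.card_insert_of_notMem ha, Finset.sum_powerset_insert ha]
      have hmean : (∑ u ∈ s.powerset, f u + ∑ u ∈ s.powerset, f (insert a u)) / 2 ^ (s.card + 1) =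
          (A ^ p + B ^ p) / 2 := by
        rw [hAp, hBp, hα, hβ, pow_succ]
        field_simp
      rw [hmean]
      have tp := two_point_inequality hρ hρ6 hA0 hB0
      rw [← hp] at tp
      have h4 : (0 : ℝ) < 4 ^ s.card := by positivity
      calc _ ≤ (1 + ρ) * (4 ^ s.card * A ^ 2) + (1 + ρ) * (4 ^ s.card * B ^ 2) +
            2 * (1 - ρ) * (4 ^ s.card * (A * B)) := by
            gcongr
            linarith
        _ = 4 ^ s.card * ((A + B) ^ 2 + ρ * (A - B) ^ 2) := by ring
        _ ≤ 4 ^ s.card * (4 * ((A ^ p + B ^ p) / 2) ^ (2 / p)) := by gcongr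
        _ = _ := by ring
    · intro U hU
      rw [e1 U hU, e2 U hU, Finset.card_insert_of_notMem (hmem hU)]
      ring

theorem sum_pow_card_mul_walshCoeff_sq_le {J : Type*} [Fintype J] [DecidableEq J] {ρ : ℝ}
    (hρ : 0 ≤ ρ) (hρ6 : ρ ≤ 1 / 6) (f : Finset J → ℝ) (hf : ∀ u, f u = 0 ∨ f u = 1) :
    ∑ U, ρ ^ U.card * walshCoeff f U ^ 2 ≤
      (Finset.expect Finset.univ f) ^ (2 / (1 + 6 * ρ)) := by
  have h := sum_rpow_card_mul_fourier_sq_le hρ hρ6 Finset.univ f hf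
  rw [Finset.powerset_univ, Finset.card_univ] at h
  have e : ∀ U, ρ ^ U.card * walshCoeff f U ^ 2 =
      ρ ^ U.card * (∑ u, f u * walsh U u) ^ 2 / 4 ^ Fintype.card J := by
    intro U
    rw [walshCoeff, div_pow, ← pow_mul, mul_comm _ 2, pow_mul]
    norm_num
    ring
  rw [Finset.sum_congr rfl fun U _ => e U, ← Finset.sum_div, div_le_iff₀ (by positivity),
    Fintype.expect_eq_sum_div_card, Fintype.card_finset]
  push_cast
  linarith

/-! ### Random placements of a half -/

theorem exists_perm_map_eq {J : Type*} [Fintype J] [DecidableEq J] {U U' : Finset J}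
    (h : U.card = U'.card) : ∃ β : Equiv.Perm J, U.map β.toEmbedding = U' := by
  let e : {x // x ∈ U} ≃ {x // x ∈ U'} := Finset.equivOfCardEq h
  refine ⟨e.extendSubtype, Finset.eq_of_subset_of_card_le ?_ (by simp [h])⟩
  intro x hx
  obtain ⟨y, hy, rfl⟩ := Finset.mem_map.1 hx
  exact e.extendSubtype_mem y hy

/-- Relabelling the source of a random bijection. -/
def relabelSource {Y B : Type*} (α : Equiv.Perm Y) : (Y ≃ B) ≃ (Y ≃ B) where
  toFun σ := α.trans σ
  invFun σ := α.symm.trans σ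
  left_inv σ := by ext; simp
  right_inv σ := by ext; simp

theorem expect_relabelSource {Y B : Type*} [Fintype Y] [DecidableEq Y] [Fintype B] [DecidableEq B]
    (α : Equiv.Perm Y) (φ : (Y ≃ B) → ℝ) :
    Finset.expect Finset.univ (fun σ => φ (α.trans σ)) = Finset.expect Finset.univ φ :=
  Fintype.expect_equiv (relabelSource α) _ _ fun _ => rfl

section Placement

variable {J B : Type*} [Fintype J] [DecidableEq J] [Fintype B] [DecidableEq B]

/-- The half of `Bool × J` that contains `(1, j)` for `j ∈ u` and `(0, j)` for `j ∉ u`. -/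
def layer (u : Finset J) : Finset (Bool × J) :=
  Finset.univ.filter fun y => (y.1 = true ↔ y.2 ∈ u)

theorem mem_layer {u : Finset J} {y : Bool × J} : y ∈ layer u ↔ (y.1 = true ↔ y.2 ∈ u) := by
  simp [layer]

/-- Exchange the two copies of the points of `s`. -/
def layerFlip (s : Finset J) : Equiv.Perm (Bool × J) where
  toFun y := (xor y.1 (decide (y.2 ∈ s)), y.2)
  invFun y := (xor y.1 (decide (y.2 ∈ s)), y.2)
  left_inv y := by simp
  right_inv y := by simp

theorem layer_map_layerFlip (u s : Finset J) :
    (layer u).map (layerFlip s).toEmbedding = layer (symmDiff u s) := by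
  ext ⟨b, j⟩
  rw [Finset.mem_map_equiv, mem_layer, mem_layer, Finset.mem_symmDiff]
  change (xor b (decide (j ∈ s)) = true ↔ j ∈ u) ↔ _
  by_cases h1 : j ∈ s <;> by_cases h2 : j ∈ u <;> cases b <;> simp [h1, h2]

theorem card_layer (u : Finset J) : (layer u).card = Fintype.card J := by
  rw [← Finset.card_univ]
  symm
  refine Finset.card_bij (fun j _ => (decide (j ∈ u), j)) ?_ ?_ ?_
  · intro j _
    simp [mem_layer]
  · intro j _ j' _ h
    exact (Prod.mk.inj h).2
  · rintro ⟨b, j⟩ h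
    rw [mem_layer] at h
    refine ⟨j, Finset.mem_univ j, ?_⟩
    simp only [Prod.mk.injEq, and_true]
    cases b <;> simp_all

/-- The average of `F(σ A) F(σ A')` over random bijections `σ`. -/
def overlap (F : Finset B → ℝ) (A A' : Finset (Bool × J)) : ℝ :=
  Finset.expect Finset.univ fun σ : (Bool × J) ≃ B =>
    F (A.map σ.toEmbedding) * F (A'.map σ.toEmbedding)

theorem overlap_map (F : Finset B → ℝ) (A A' : Finset (Bool × J))
    (α : Equiv.Perm (Bool × J)) :
    overlap F (A.map α.toEmbedding) (A'.map α.toEmbedding) = overlap F A A' := by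
  unfold overlap
  rw [← expect_relabelSource α (fun σ : (Bool × J) ≃ B =>
    F (A.map σ.toEmbedding) * F (A'.map σ.toEmbedding))]
  simp only [Finset.map_map]
  rfl

/-- The restriction of `F` to the halves `σ (layer u)`. -/
def placed (F : Finset B → ℝ) (σ : (Bool × J) ≃ B) (u : Finset J) : ℝ :=
  F ((layer u).map σ.toEmbedding)

/-- The average weight of the Walsh character `U` in `placed F σ`. -/
def levelWeight (F : Finset B → ℝ) (U : Finset J) : ℝ :=
  Finset.expect Finset.univ fun σ : (Bool × J) ≃ B => walshCoeff (placed F σ) U ^ 2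

theorem levelWeight_nonneg (F : Finset B → ℝ) (U : Finset J) : 0 ≤ levelWeight F U :=
  expect_nonneg_of fun _ _ => sq_nonneg _

theorem expect_symmDiff_right {M : Type*} [AddCommMonoid M] [Module ℚ≥0 M] (s : Finset J)
    (φ : Finset J → M) :
    Finset.expect Finset.univ (fun u => φ (symmDiff s u)) = Finset.expect Finset.univ φ :=
  Fintype.expect_equiv (Function.Involutive.toPerm (fun u => symmDiff s u)
    (symmDiff_symmDiff_cancel_left s)) _ _ fun _ => rfl

/-- Exchanging the two copies over `s` shifts both layers by `s` without changing the overlap.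
Averaging over `s` turns the overlap into an autocorrelation of `placed F σ`. -/
theorem overlap_layer (F : Finset B → ℝ) (u u' : Finset J) :
    overlap F (layer u) (layer u') =
      ∑ U, levelWeight F U * walsh U (symmDiff u u') := by
  have h1 : ∀ s : Finset J, overlap F (layer u) (layer u') =
      overlap F (layer (symmDiff u s)) (layer (symmDiff u' s)) := fun s => by
    rw [← layer_map_layerFlip, ← layer_map_layerFlip, overlap_map]
  have h2 : overlap F (layer u) (layer u') = Finset.expect Finset.univ fun s : Finset J =>
      overlap F (layer (symmDiff u s)) (layer (symmDiff u' s)) := by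
    rw [← Finset.expect_congr rfl fun s _ => h1 s, Finset.expect_const Finset.univ_nonempty]
  rw [h2]
  unfold overlap levelWeight
  rw [Finset.expect_comm]
  simp only [Finset.expect_mul]
  rw [← Finset.expect_sum_comm]
  refine Finset.expect_congr rfl fun σ _ => ?_
  rw [sum_walshCoeff_sq_mul_walsh, ← expect_symmDiff_right u
    (fun s => placed F σ s * placed F σ (symmDiff s (symmDiff u u')))]
  refine Finset.expect_congr rfl fun s _ => ?_
  have : symmDiff (symmDiff u s) (symmDiff u u') = symmDiff u' s := by
    rw [symmDiff_comm u s, symmDiff_assoc, symmDiff_symmDiff_cancel_left, symmDiff_comm]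
  rw [this]
  rfl

/-- Permuting the points of `J`. -/
def layerPerm (β : Equiv.Perm J) : Equiv.Perm (Bool × J) := Equiv.prodCongr (Equiv.refl _) β

theorem layer_map_layerPerm (β : Equiv.Perm J) (u : Finset J) :
    (layer u).map (layerPerm β).toEmbedding = layer (u.map β.toEmbedding) := by
  ext ⟨b, j⟩
  rw [Finset.mem_map_equiv, mem_layer, mem_layer, Finset.mem_map_equiv]
  rfl

theorem walsh_map (β : Equiv.Perm J) (U u : Finset J) :
    walsh (U.map β.toEmbedding) (u.map β.toEmbedding) = walsh U u := by
  simp [walsh]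

/-- A permutation of `J` that carries `U` to `U'` is absorbed by the random placement. -/
theorem levelWeight_eq_of_card_eq (F : Finset B → ℝ) {U U' : Finset J} (h : U.card = U'.card) :
    levelWeight F U = levelWeight F U' := by
  obtain ⟨β, rfl⟩ := exists_perm_map_eq h
  unfold levelWeight
  rw [← expect_relabelSource (layerPerm β)
    (fun σ : (Bool × J) ≃ B => walshCoeff (placed F σ) U ^ 2)]
  refine Finset.expect_congr rfl fun σ _ => ?_
  congr 1
  unfold walshCoeff
  congr 1
  refine Fintype.sum_equiv β.finsetCongr _ _ fun u => ?_
  rw [Equiv.finsetCongr_apply, walsh_map]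
  congr 1
  unfold placed
  rw [← layer_map_layerPerm, Finset.map_map]
  rfl

/-- A half has as many points in copy `1` as it misses in copy `0`, so permuting copy `1` alone
makes it a layer. Up to relabelling, every pair of halves is a pair of layers. -/
theorem exists_perm_fixing_layer {H : Finset (Bool × J)} (hH : H.card = Fintype.card J) :
    ∃ α : Equiv.Perm (Bool × J), (layer (∅ : Finset J)).map α.toEmbedding = layer ∅ ∧
      H.map α.toEmbedding = layer (Finset.univ.filter fun j => (false, j) ∉ H) := by
  set v : Finset J := Finset.univ.filter fun j => (false, j) ∉ H with hv
  set t : Finset J := Finset.univ.filter fun j => (true, j) ∈ H with ht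
  have hcard : t.card = v.card := by
    have e1 : H.card = t.card + vᶜ.card := by
      have : H = t.map (Function.Embedding.sectR true J) ∪
          vᶜ.map (Function.Embedding.sectR false J) := by
        ext ⟨b, j⟩
        cases b <;> simp [hv, ht, Function.Embedding.sectR_apply]
      conv_lhs => rw [this]
      rw [Finset.card_union_of_disjoint, Finset.card_map, Finset.card_map]
      rw [Finset.disjoint_left]
      intro y hy hy'
      obtain ⟨j, -, rfl⟩ := Finset.mem_map.1 hy
      obtain ⟨j', -, h⟩ := Finset.mem_map.1 hy'
      simp [Function.Embedding.sectR_apply] at h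
    have e2 := Finset.card_add_card_compl v
    omega
  obtain ⟨β, hβ⟩ := exists_perm_map_eq hcard
  refine ⟨⟨fun y => if y.1 then (true, β y.2) else y, fun y => if y.1 then (true, β.symm y.2)
    else y, ?_, ?_⟩, ?_, ?_⟩
  · rintro ⟨b, j⟩
    cases b <;> simp
  · rintro ⟨b, j⟩
    cases b <;> simp
  · ext ⟨b, j⟩
    rw [Finset.mem_map_equiv, mem_layer, mem_layer]
    cases b <;> simp
  · ext ⟨b, j⟩
    rw [Finset.mem_map_equiv, mem_layer]
    cases b
    · simp [hv]
    · simp only [Equiv.coe_fn_symm_mk, if_true, true_iff]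
      rw [← hβ, Finset.mem_map_equiv]
      simp [ht]

/-- The sign of a point: `1` on the copy `0`, `-1` on the copy `1`. -/
def copySign (y : Bool × J) : ℝ := if y.1 then -1 else 1

theorem copySign_mul_self (y : Bool × J) : copySign y * copySign y = 1 := by
  unfold copySign
  split_ifs <;> norm_num

theorem sum_copySign : ∑ y : Bool × J, copySign y = 0 := by
  rw [Fintype.sum_prod_type]
  simp [copySign]

/-- The average product of the signs of the points of `V` under a random permutation. -/
def signCorr (V : Finset (Bool × J)) : ℝ :=
  Finset.expect Finset.univ fun α : Equiv.Perm (Bool × J) => ∏ y ∈ V, copySign (α y)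

theorem signCorr_eq_of_card_eq {V V' : Finset (Bool × J)} (h : V.card = V'.card) :
    signCorr V = signCorr V' := by
  obtain ⟨β, rfl⟩ := exists_perm_map_eq h
  unfold signCorr
  rw [← expect_relabelSource β]
  simp

/-- All signs sum to zero, so the correlations of `V` with one extra sign at `y` cancel over all
`y`. Points `y ∉ V` enlarge the set; points `y ∈ V` cancel their own sign. By symmetry only sizes
matter. -/
theorem signCorr_recursion {V : Finset (Bool × J)} {a : Bool × J} (ha : a ∉ V) {b : Bool × J}
    (hb : b ∈ V) :
    (2 * Fintype.card J - V.card : ℝ) * signCorr (insert a V) +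
      V.card * signCorr (V.erase b) = 0 := by
  have h0 : ∑ y : Bool × J, Finset.expect Finset.univ
      (fun α : Equiv.Perm (Bool × J) => (∏ x ∈ V, copySign (α x)) * copySign (α y)) = 0 := by
    rw [← Finset.expect_sum_comm]
    refine Finset.expect_eq_zero fun α _ => ?_
    rw [← Finset.mul_sum, Equiv.sum_comp α, sum_copySign, mul_zero]
  rw [← Finset.sum_compl_add_sum V] at h0
  rw [Finset.sum_congr (s₁ := Vᶜ) rfl (g := fun _ => signCorr (insert a V)),
    Finset.sum_congr (s₁ := V) rfl (g := fun _ => signCorr (V.erase b))] at h0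
  · rw [Finset.sum_const, Finset.sum_const, nsmul_eq_mul, nsmul_eq_mul, Finset.card_compl,
      Nat.cast_sub (Finset.card_le_univ V), Fintype.card_prod, Fintype.card_bool] at h0
    push_cast at h0
    exact h0
  · intro y hy
    rw [signCorr_eq_of_card_eq (V := V.erase b) (V' := V.erase y)
      (by rw [Finset.card_erase_of_mem hb, Finset.card_erase_of_mem hy])]
    refine Finset.expect_congr rfl fun α _ => ?_
    rw [← Finset.mul_prod_erase V _ hy, mul_right_comm, copySign_mul_self, one_mul]
  · intro y hy
    rw [Finset.mem_compl] at hy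
    rw [signCorr_eq_of_card_eq (V := insert a V) (V' := insert y V)
      (by rw [Finset.card_insert_of_notMem ha, Finset.card_insert_of_notMem hy])]
    refine Finset.expect_congr rfl fun α _ => ?_
    rw [Finset.prod_insert hy, mul_comm]

theorem signCorr_singleton (a : Bool × J) : signCorr {a} = 0 := by
  have h0 : ∑ y : Bool × J, Finset.expect Finset.univ
      (fun α : Equiv.Perm (Bool × J) => copySign (α y)) = 0 := by
    rw [← Finset.expect_sum_comm]
    refine Finset.expect_eq_zero fun α _ => ?_
    rw [Equiv.sum_comp α, sum_copySign]
  rw [Finset.sum_congr rfl (g := fun _ => signCorr {a})] at h0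
  · rw [Finset.sum_const, nsmul_eq_mul, mul_eq_zero] at h0
    refine h0.resolve_left ?_
    have : 0 < Fintype.card (Bool × J) := Fintype.card_pos_iff.2 ⟨a⟩
    rw [Finset.card_univ]
    positivity
  · intro y _
    rw [signCorr_eq_of_card_eq (V := {a}) (V' := {y}) (by simp)]
    simp [signCorr]

/-- With `M = |J|`, the recursion passes from size `d` to `d + 2` with a factor `(d + 1) / (2 * M -
d - 1) ≤ (d + 1) / M`. This is at most `r ^ 2` while `d ≤ D` and at most `1` afterwards. -/
theorem abs_signCorr_le {r : ℝ} {D : ℕ} (hr0 : 0 ≤ r) (hr1 : r ≤ 1)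
    (hD : (D + 1 : ℝ) ≤ r ^ 2 * Fintype.card J) (d : ℕ) :
    ∀ V : Finset (Bool × J), V.card = d → d ≤ Fintype.card J →
      |signCorr V| ≤ r ^ (min d D) := by
  induction d using Nat.strong_induction_on with
  | _ d ih =>
    intro V hV hd
    rcases d with _ | _ | d
    · rw [Finset.card_eq_zero] at hV
      subst hV
      simp [signCorr]
    · obtain ⟨a, rfl⟩ := Finset.card_eq_one.1 hV
      rw [signCorr_singleton, abs_zero]
      positivity
    · obtain ⟨a, ha⟩ : V.Nonempty := Finset.card_pos.1 (by omega)
      have hcV : (V.erase a).card = d + 1 := by rw [Finset.card_erase_of_mem ha, hV]; rfl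
      obtain ⟨b, hb⟩ : (V.erase a).Nonempty := Finset.card_pos.1 (by omega)
      have hrec₀ := signCorr_recursion (Finset.notMem_erase a V) hb
      rw [Finset.insert_erase ha, hcV] at hrec₀
      have hc2 : ((V.erase a).erase b).card = d := by
        rw [Finset.card_erase_of_mem hb, hcV]; rfl
      have ih' := ih d (by omega) _ hc2 (by omega)
      set M : ℝ := (Fintype.card J : ℝ) with hM
      have hdM : (d : ℝ) + 2 ≤ M := by rw [hM]; exact_mod_cast hd
      set x := |signCorr V|
      set y := |signCorr ((V.erase a).erase b)| with hy
      have hrec : (2 * M - (d + 1)) * x = (d + 1) * y := by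
        have h1 : (2 * M - (d + 1)) * signCorr V =
            -((d + 1) * signCorr ((V.erase a).erase b)) := by
          push_cast at hrec₀
          linarith
        have h2 := congrArg abs h1
        rw [abs_neg, abs_mul, abs_mul, abs_of_nonneg (by linarith : 0 ≤ 2 * M - ((d : ℝ) + 1)),
          abs_of_nonneg (by positivity : 0 ≤ (d : ℝ) + 1)] at h2
        exact h2
      have hx0 : 0 ≤ x := abs_nonneg _
      have hy0 : 0 ≤ y := abs_nonneg _
      have hMx : M * x ≤ (d + 1) * y := by
        rw [← hrec]
        exact mul_le_mul_of_nonneg_right (by linarith) hx0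
      have hM0 : 0 < M := by linarith [(Nat.cast_nonneg d : (0 : ℝ) ≤ d)]
      rcases le_or_gt d D with h | h
      · have hdD : (d : ℝ) ≤ D := by exact_mod_cast h
        have h3 : x ≤ r ^ 2 * y := by
          have : M * x ≤ M * (r ^ 2 * y) := by nlinarith
          exact le_of_mul_le_mul_left this hM0
        rw [min_eq_left h] at ih'
        calc x ≤ r ^ 2 * r ^ d := h3.trans (by gcongr)
          _ = r ^ (d + 2) := by ring
          _ ≤ _ := pow_le_pow_of_le_one hr0 hr1 (min_le_left _ _)
      · rw [min_eq_right h.le] at ih'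
        rw [min_eq_right (by omega)]
        have h3 : x ≤ y := by
          have : M * x ≤ M * y := hMx.trans (mul_le_mul_of_nonneg_right (by linarith) hy0)
          exact le_of_mul_le_mul_left this hM0
        exact h3.trans ih'

/-- The copy `0` of a set of points. -/
def zeroCopy (U : Finset J) : Finset (Bool × J) :=
  U.map (Function.Embedding.sectR false J)

/-- The average of `F` over random halves. -/
def halfMean (J : Type*) [Fintype J] [DecidableEq J] (F : Finset B → ℝ) : ℝ :=
  Finset.expect Finset.univ fun σ : (Bool × J) ≃ B => F ((layer (∅ : Finset J)).map σ.toEmbedding)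

theorem expect_map_of_card_eq (F : Finset B → ℝ) {A : Finset (Bool × J)}
    (hA : A.card = Fintype.card J) :
    Finset.expect Finset.univ (fun σ : (Bool × J) ≃ B => F (A.map σ.toEmbedding)) =
      halfMean J F := by
  obtain ⟨β, hβ⟩ := exists_perm_map_eq (U := layer (∅ : Finset J)) (U' := A)
    (by rw [hA, card_layer])
  rw [← hβ, halfMean, ← expect_relabelSource β (fun σ : (Bool × J) ≃ B =>
    F ((layer (∅ : Finset J)).map σ.toEmbedding))]
  simp only [Finset.map_map]
  rfl

/-- The square is the average overlap of two independent random halves. Each pair is moved to `layer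
∅` and another layer, where the overlap has a Fourier expansion; averaging its characters over the
second half gives sign correlations. -/
theorem halfMean_sq_eq [Nonempty ((Bool × J) ≃ B)] (F : Finset B → ℝ) :
    halfMean J F ^ 2 = ∑ U : Finset J, levelWeight F U * signCorr (zeroCopy U) := by
  have h1 : ∀ σ : (Bool × J) ≃ B, Finset.expect Finset.univ
      (fun α : Equiv.Perm (Bool × J) =>
        F (((layer (∅ : Finset J)).map α.symm.toEmbedding).map σ.toEmbedding)) =
      halfMean J F := by
    intro σ
    refine Fintype.expect_equiv (⟨fun α => α.symm.trans σ, fun τ => σ.trans τ.symm,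
      fun α => by ext x : 1; simp, fun τ => by ext x : 1; simp⟩ :
        Equiv.Perm (Bool × J) ≃ ((Bool × J) ≃ B)) _ _ fun α => ?_
    rw [Finset.map_map]
    rfl
  have h2 : halfMean J F ^ 2 = Finset.expect Finset.univ
      (fun α : Equiv.Perm (Bool × J) =>
        overlap F (layer (∅ : Finset J)) ((layer (∅ : Finset J)).map α.symm.toEmbedding)) := by
    unfold overlap
    rw [Finset.expect_comm]
    simp only [← Finset.mul_expect, h1]
    rw [← Finset.expect_mul, sq]
    rfl
  rw [h2]
  unfold signCorr
  simp only [Finset.mul_expect]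
  rw [← Finset.expect_sum_comm]
  refine Finset.expect_congr rfl fun α _ => ?_
  obtain ⟨γ, hγ1, hγ2⟩ := exists_perm_fixing_layer
    (H := (layer (∅ : Finset J)).map α.symm.toEmbedding) (by rw [Finset.card_map, card_layer])
  rw [← overlap_map F _ _ γ, hγ1, hγ2, overlap_layer]
  refine Finset.sum_congr rfl fun U _ => ?_
  congr 1
  rw [zeroCopy, Finset.prod_map, walsh]
  refine Finset.prod_congr rfl fun j _ => ?_
  simp [copySign, Finset.mem_symmDiff, mem_layer, Function.Embedding.sectR_apply]

/-- Parseval, together with `F ^ 2 = F`. -/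
theorem sum_levelWeight {F : Finset B → ℝ} (hF : ∀ S, F S = 0 ∨ F S = 1) :
    ∑ U : Finset J, levelWeight F U = halfMean J F := by
  have h := overlap_layer F (∅ : Finset J) ∅
  rw [symmDiff_self] at h
  have e : ∀ U : Finset J, levelWeight F U * walsh U ⊥ = levelWeight F U := fun U => by
    simp [walsh]
  rw [Finset.sum_congr rfl fun U _ => e U] at h
  rw [← h, overlap, halfMean]
  refine Finset.expect_congr rfl fun σ _ => ?_
  rcases hF ((layer (∅ : Finset J)).map σ.toEmbedding) with h | h <;> simp [h]

/-- Hypercontractivity holds for each placement separately. The hypothesis `hpow` replaces the power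
of the placement's mean by a quadratic and a linear term, whose averages over placements are the
weight of `∅` and `halfMean`. -/
theorem sum_pow_card_mul_levelWeight_le {F : Finset B → ℝ} (hF : ∀ S, F S = 0 ∨ F S = 1)
    {ρ a δ : ℝ} (hρ : 0 ≤ ρ) (hρ6 : ρ ≤ 1 / 6)
    (hpow : ∀ m : ℝ, 0 ≤ m → m ≤ 1 → m ^ (2 / (1 + 6 * ρ)) ≤ (1 + a) * m ^ 2 + δ * m) :
    ∑ U : Finset J, ρ ^ U.card * levelWeight F U ≤
      (1 + a) * levelWeight F (∅ : Finset J) + δ * halfMean J F := by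
  unfold levelWeight
  simp only [Finset.mul_expect]
  rw [← Finset.expect_sum_comm]
  have hmean : Finset.expect Finset.univ (fun σ : (Bool × J) ≃ B =>
      Finset.expect Finset.univ (placed F σ)) = halfMean J F := by
    unfold placed
    rw [Finset.expect_comm, Finset.expect_congr rfl fun u _ =>
      expect_map_of_card_eq F (card_layer u), Finset.expect_const Finset.univ_nonempty]
  rw [← hmean, Finset.mul_expect, ← Finset.expect_add_distrib]
  refine expect_mono fun σ _ => ?_
  have hf : ∀ u, placed F σ u = 0 ∨ placed F σ u = 1 := fun u => hF _
  refine (sum_pow_card_mul_walshCoeff_sq_le hρ hρ6 (placed F σ) hf).trans ?_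
  have e : walshCoeff (placed F σ) (∅ : Finset J) = Finset.expect Finset.univ (placed F σ) := by
    rw [walshCoeff, Fintype.expect_eq_sum_div_card, Fintype.card_finset]
    simp [walsh]
  rw [e]
  refine hpow _ (expect_nonneg_of fun u _ => ?_) (expect_le_of zero_le_one fun u _ => ?_)
  · rcases hf u with h | h <;> simp [h]
  · rcases hf u with h | h <;> simp [h]

end Placement

/-! ### Blocks -/

theorem expect_eq_zero_of_neg {Ω : Type*} [Fintype Ω] (e : Ω ≃ Ω) {φ : Ω → ℝ}
    (h : ∀ ω, φ (e ω) = -φ ω) : Finset.expect Finset.univ φ = 0 := by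
  have h1 : Finset.expect Finset.univ (fun ω => φ (e ω)) = Finset.expect Finset.univ φ :=
    Fintype.expect_equiv e _ _ fun _ => rfl
  simp only [h, Finset.expect_neg_distrib] at h1
  linarith

/-- The successive ratios satisfy `(a - d) / (b - d) ≤ a / b`. -/
theorem choose_mul_pow_le {a b : ℕ} (hab : a ≤ b) (d : ℕ) :
    (a.choose d : ℝ) * (b : ℝ) ^ d ≤ (a : ℝ) ^ d * b.choose d := by
  induction d with
  | zero => simp
  | succ d ih =>
    rcases lt_or_ge a (d + 1) with h | h
    · rw [Nat.choose_eq_zero_of_lt h]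
      simp only [Nat.cast_zero, zero_mul]
      positivity
    · have ha := Nat.choose_succ_right_eq a d
      have hb := Nat.choose_succ_right_eq b d
      have ha' : (a.choose (d + 1) : ℝ) * (d + 1) = a.choose d * (a - d) := by
        rw [← Nat.cast_sub (by omega)]
        exact_mod_cast ha
      have hb' : (b.choose (d + 1) : ℝ) * (d + 1) = b.choose d * (b - d) := by
        rw [← Nat.cast_sub (by omega)]
        exact_mod_cast hb
      have hab' : (a : ℝ) ≤ b := by exact_mod_cast hab
      have had : (d : ℝ) ≤ a := by exact_mod_cast (by omega : d ≤ a)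
      have hd0 : (0 : ℝ) ≤ d := Nat.cast_nonneg d
      have h1 : ((a : ℝ) - d) * b ≤ (b - d) * a := by nlinarith
      have h2 : (0 : ℝ) ≤ (a - d) * b := mul_nonneg (by linarith) (Nat.cast_nonneg b)
      have h3 := mul_le_mul ih h1 h2 (by positivity)
      have hd1 : (0 : ℝ) < d + 1 := by positivity
      refine le_of_mul_le_mul_right ?_ hd1
      calc (a.choose (d + 1) : ℝ) * b ^ (d + 1) * (d + 1)
          = (a.choose (d + 1) * (d + 1)) * (b ^ d * b) := by ring
        _ = a.choose d * b ^ d * ((a - d) * b) := by rw [ha']; ring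
        _ ≤ a ^ d * b.choose d * ((b - d) * a) := h3
        _ = (b.choose d * (b - d)) * (a ^ d * a) := by ring
        _ = a ^ (d + 1) * b.choose (d + 1) * (d + 1) := by rw [← hb']; ring

section Blocks

variable {K l : ℕ}

/-- The points of the rows in `g.1`, except that position `0` of each row is governed by `g.2`. -/
def blockSet (l : ℕ) (g : Finset (Fin K) × Finset (Fin K)) : Finset (Fin K × Fin l) :=
  Finset.univ.filter fun j => (j.2.val = 0 ∧ j.1 ∈ g.2) ∨ (j.2.val ≠ 0 ∧ j.1 ∈ g.1)

theorem mem_blockSet {g : Finset (Fin K) × Finset (Fin K)} {j : Fin K × Fin l} :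
    j ∈ blockSet l g ↔ (j.2.val = 0 ∧ j.1 ∈ g.2) ∨ (j.2.val ≠ 0 ∧ j.1 ∈ g.1) := by
  simp [blockSet]

/-- No point at position `0`, and an even number of points in each row. -/
def EvenRows (U : Finset (Fin K × Fin l)) : Prop :=
  (∀ j ∈ U, j.2.val ≠ 0) ∧ ∀ i, Even (U.filter fun j => j.1 = i).card

theorem walsh_filter {J : Type*} [Fintype J] [DecidableEq J] (U : Finset J) (p : J → Prop)
    [DecidablePred p] : walsh U (Finset.univ.filter p) = (-1) ^ (U.filter p).card := by
  rw [walsh, ← Finset.prod_const, Finset.prod_filter]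
  simp

open Classical in
-- If `U` has an odd row, flipping the sign of that row negates the character; if `U` contains a
-- point at position `0`, flipping the separate sign of that point does. In both cases the mean
-- vanishes.
theorem expect_walsh_blockSet_sq_le (U : Finset (Fin K × Fin l)) :
    (Finset.expect Finset.univ fun g => walsh U (blockSet l g)) ^ 2 ≤
      if EvenRows U then 1 else 0 := by
  split_ifs with hU
  · have h : |Finset.expect Finset.univ fun g => walsh U (blockSet l g)| ≤ 1 := by
      rw [abs_le]
      constructor
      · have : Finset.expect (Finset.univ : Finset (Finset (Fin K) × Finset (Fin K)))
            (fun _ => (-1 : ℝ)) ≤ Finset.expect Finset.univ fun g => walsh U (blockSet l g) :=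
          expect_mono fun g _ => (abs_le.1 (abs_walsh U _).le).1
        rwa [Finset.expect_const Finset.univ_nonempty] at this
      · exact expect_le_of zero_le_one fun g _ => (abs_le.1 (abs_walsh U _).le).2
    exact (sq_le_one_iff_abs_le_one _).2 h
  · have hz : Finset.expect Finset.univ (fun g => walsh U (blockSet l g)) = 0 := by
      by_cases h0 : ∀ j ∈ U, j.2.val ≠ 0
      · obtain ⟨i, hi⟩ : ∃ i : Fin K, ¬ Even (U.filter fun j => j.1 = i).card := by
          by_contra hc
          push Not at hc
          exact hU ⟨h0, hc⟩
        refine expect_eq_zero_of_neg (Equiv.prodCongr (Function.Involutive.toPerm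
          (fun u : Finset (Fin K) => symmDiff {i} u) (fun b => symmDiff_symmDiff_cancel_left {i} b)) (Equiv.refl _)) fun g => ?_
        have e : blockSet l (symmDiff {i} g.1, g.2) =
            symmDiff (Finset.univ.filter fun j => j.2.val ≠ 0 ∧ j.1 = i) (blockSet l g) := by
          ext j
          simp only [mem_blockSet, Finset.mem_symmDiff, Finset.mem_filter, Finset.mem_univ,
            true_and, Finset.mem_singleton]
          tauto
        change walsh U (blockSet l (symmDiff {i} g.1, g.2)) = _
        rw [e, walsh_symmDiff, walsh_filter]
        have : U.filter (fun j => j.2.val ≠ 0 ∧ j.1 = i) = U.filter fun j => j.1 = i :=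
          Finset.filter_congr fun j hj => by simp [h0 j hj]
        rw [this, (Nat.not_even_iff_odd.1 hi).neg_one_pow]
        ring
      · push Not at h0
        obtain ⟨j₀, hj₀, h0⟩ := h0
        refine expect_eq_zero_of_neg (Equiv.prodCongr (Equiv.refl _) (Function.Involutive.toPerm
          (fun u => symmDiff {j₀.1} u) (symmDiff_symmDiff_cancel_left {j₀.1}))) fun g => ?_
        have e : blockSet l (g.1, symmDiff {j₀.1} g.2) =
            symmDiff (Finset.univ.filter fun j => j = j₀) (blockSet l g) := by
          ext j
          have : j = j₀ ↔ j.2.val = 0 ∧ j.1 = j₀.1 := by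
            rw [Prod.ext_iff, Fin.ext_iff (a := j.2), h0]
            tauto
          simp only [mem_blockSet, Finset.mem_symmDiff, Finset.mem_filter, Finset.mem_univ,
            true_and, Finset.mem_singleton, this]
          tauto
        change walsh U (blockSet l (g.1, symmDiff {j₀.1} g.2)) = _
        rw [e, walsh_symmDiff, walsh_filter]
        have : U.filter (fun j => j = j₀) = {j₀} := by
          ext j
          simp only [Finset.mem_filter, Finset.mem_singleton]
          exact ⟨fun h => h.2, fun h => ⟨h ▸ hj₀, h⟩⟩
        rw [this]
        simp
    rw [hz]
    norm_num

open Classical in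
/-- The sets of `d` points with even rows. -/
def evenRowSets (K l d : ℕ) : Finset (Finset (Fin K × Fin l)) :=
  (Finset.powersetCard d Finset.univ).filter EvenRows

theorem mem_evenRowSets {d : ℕ} {U : Finset (Fin K × Fin l)} :
    U ∈ evenRowSets K l d ↔ U.card = d ∧ EvenRows U := by
  simp [evenRowSets]

theorem EvenRows.exists_partner {U : Finset (Fin K × Fin l)} (hU : EvenRows U)
    {x : Fin K × Fin l} (hx : x ∈ U) : ∃ y ∈ U, y ≠ x ∧ y.1 = x.1 := by
  by_contra hc
  push Not at hc
  have : U.filter (fun j => j.1 = x.1) = {x} := by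
    ext j
    simp only [Finset.mem_filter, Finset.mem_singleton]
    constructor
    · rintro ⟨h1, h2⟩
      by_contra h3
      exact hc j h1 h3 h2
    · rintro rfl
      exact ⟨hx, rfl⟩
  have h2 := hU.2 x.1
  rw [this] at h2
  simp at h2

/-- Count pairs of an even set and a point `x` in it. Some other point `y` lies in the row of `x`,
and removing both leaves an even set; `x` and the position of `y` recover the pair, which gives `K *
l * l` choices. -/
theorem card_evenRowSets_recursion (d : ℕ) :
    (d + 2) * (evenRowSets K l (d + 2)).card ≤ (evenRowSets K l d).card * (K * l * l) := by
  classical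
  have h1 : ((evenRowSets K l (d + 2)).sigma fun A => A).card =
      (d + 2) * (evenRowSets K l (d + 2)).card := by
    rw [Finset.card_sigma, Finset.sum_congr rfl fun A hA => (mem_evenRowSets.1 hA).1,
      Finset.sum_const, smul_eq_mul, mul_comm]
  rw [← h1]
  have h2 : (evenRowSets K l (d + 2)).sigma (fun A => A) ⊆
      ((evenRowSets K l d) ×ˢ (Finset.univ : Finset ((Fin K × Fin l) × Fin l))).image
        (fun p => (⟨insert p.2.1 (insert (p.2.1.1, p.2.2) p.1), p.2.1⟩ :
          Σ _ : Finset (Fin K × Fin l), Fin K × Fin l)) := by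
    rintro ⟨A, x⟩ hAx
    obtain ⟨hA, hx⟩ := Finset.mem_sigma.1 hAx
    obtain ⟨hc, hE⟩ := mem_evenRowSets.1 hA
    obtain ⟨y, hy, hyx, hrow⟩ := hE.exists_partner hx
    have hy' : y ∈ A.erase x := Finset.mem_erase.2 ⟨hyx, hy⟩
    refine Finset.mem_image.2 ⟨((A.erase x).erase y, (x, y.2)), ?_, ?_⟩
    · refine Finset.mem_product.2 ⟨mem_evenRowSets.2 ⟨?_, ?_, ?_⟩, Finset.mem_univ _⟩
      · rw [Finset.card_erase_of_mem hy', Finset.card_erase_of_mem hx, hc]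
        rfl
      · intro j hj
        exact hE.1 j (Finset.mem_of_mem_erase (Finset.mem_of_mem_erase hj))
      · intro i
        have he := hE.2 i
        rw [Finset.filter_erase, Finset.filter_erase]
        by_cases hi : x.1 = i
        · have hyi : y.1 = i := hrow.trans hi
          rw [Finset.card_erase_of_mem, Finset.card_erase_of_mem]
          · have hpos : 2 ≤ (A.filter fun j => j.1 = i).card := by
              rw [← Finset.card_pair hyx]
              refine Finset.card_le_card fun j hj => ?_
              rcases Finset.mem_insert.1 hj with rfl | hj
              · exact Finset.mem_filter.2 ⟨hy, hyi⟩
              · rw [Finset.mem_singleton.1 hj]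
                exact Finset.mem_filter.2 ⟨hx, hi⟩
            rw [Nat.sub_sub]
            exact (Nat.even_sub hpos).2 (iff_of_true he even_two)
          · exact Finset.mem_filter.2 ⟨hx, hi⟩
          · exact Finset.mem_erase.2 ⟨hyx, Finset.mem_filter.2 ⟨hy, hyi⟩⟩
        · rw [Finset.erase_eq_of_notMem (a := x), Finset.erase_eq_of_notMem (a := y)]
          · exact he
          · simp [hrow, hi]
          · simp [hi]
    · have e : (x.1, y.2) = y := Prod.ext hrow.symm rfl
      simp only [e]
      rw [Finset.insert_erase hy', Finset.insert_erase hx]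
  refine (Finset.card_le_card h2).trans (Finset.card_image_le.trans (le_of_eq ?_))
  rw [Finset.card_product, Finset.card_univ]
  simp

/-- With `M = K * l`, two more points multiply the count by at most `M * l / (d + 2)` and the
binomial coefficient by `(M - d) * (M - d - 1) / ((d + 1) * (d + 2))`. For `d + 2 ≤ D` the quotient
of these factors is at most `r ^ 2`. -/
theorem card_evenRowSets_le_pow {r : ℝ} {D : ℕ} (hr0 : 0 ≤ r)
    (hD2 : 2 * (D : ℝ) ≤ K * l) (hDr : 4 * (D : ℝ) * l ≤ r ^ 2 * (K * l)) (d : ℕ) (hd : d ≤ D) :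
    ((evenRowSets K l d).card : ℝ) ≤ r ^ d * (K * l).choose d := by
  induction d using Nat.strong_induction_on with
  | _ d ih =>
    rcases d with _ | _ | d
    · have : (evenRowSets K l 0).card ≤ 1 := by
        refine Finset.card_le_one.2 fun A hA A' hA' => ?_
        rw [Finset.card_eq_zero.1 (mem_evenRowSets.1 hA).1,
          Finset.card_eq_zero.1 (mem_evenRowSets.1 hA').1]
      simpa using this
    · have : evenRowSets K l 1 = ∅ := by
        refine Finset.eq_empty_of_forall_notMem fun A hA => ?_
        obtain ⟨hc, hE⟩ := mem_evenRowSets.1 hA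
        obtain ⟨x, rfl⟩ := Finset.card_eq_one.1 hc
        obtain ⟨y, hy, hyx, -⟩ := hE.exists_partner (Finset.mem_singleton_self x)
        exact hyx (Finset.mem_singleton.1 hy)
      rw [this]
      simp only [Finset.card_empty, Nat.cast_zero]
      positivity
    · have ih' := ih d (by omega) (by omega)
      have hrec : ((d : ℝ) + 2) * (evenRowSets K l (d + 2)).card ≤
          (evenRowSets K l d).card * (K * l * l) := by
        exact_mod_cast card_evenRowSets_recursion (K := K) (l := l) d
      set M : ℝ := (K : ℝ) * l with hM
      have hdD : (d : ℝ) + 2 ≤ D := by exact_mod_cast hd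
      have hd0 : (0 : ℝ) ≤ d := Nat.cast_nonneg d
      have hl0 : (0 : ℝ) ≤ l := Nat.cast_nonneg l
      have hle : d + 1 ≤ K * l := by
        have h1 : (d : ℝ) + 1 ≤ (K * l : ℕ) := by push_cast; linarith
        exact_mod_cast h1
      have c1 : ((K * l).choose (d + 1) : ℝ) * (d + 1) = (K * l).choose d * (M - d) := by
        have h := Nat.choose_succ_right_eq (K * l) d
        rw [hM, ← Nat.cast_mul, ← Nat.cast_sub (by omega)]
        exact_mod_cast h
      have c2 : ((K * l).choose (d + 2) : ℝ) * (d + 2) =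
          (K * l).choose (d + 1) * (M - (d + 1)) := by
        have h := Nat.choose_succ_right_eq (K * l) (d + 1)
        rw [hM, ← Nat.cast_mul, show (d : ℝ) + 1 = ((d + 1 : ℕ) : ℝ) by push_cast; ring,
          ← Nat.cast_sub hle]
        exact_mod_cast h
      set C := ((K * l).choose d : ℝ) with hC
      have hC0 : 0 ≤ C := Nat.cast_nonneg _
      set C2 := ((K * l).choose (d + 2) : ℝ) with hC2
      set G := ((evenRowSets K l (d + 2)).card : ℝ) with hG
      have c3 : C2 * (d + 2) * (d + 1) = C * ((M - d) * (M - (d + 1))) := by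
        rw [c2]
        linear_combination (M - (d + 1)) * c1
      have h4 : M * l * (d + 1) ≤ r ^ 2 * ((M - d) * (M - (d + 1))) := by
        have q1 : M / 2 ≤ M - d := by linarith
        have q2 : M / 2 ≤ M - (d + 1) := by linarith
        have hM0 : 0 ≤ M := by positivity
        have q3 : M / 2 * (M / 2) ≤ (M - d) * (M - (d + 1)) :=
          mul_le_mul q1 q2 (by linarith) (by linarith)
        have q4 := mul_le_mul_of_nonneg_left q3 (sq_nonneg r)
        have q5 : M * (4 * D * l) ≤ M * (r ^ 2 * M) := mul_le_mul_of_nonneg_left hDr hM0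
        have q6 : M * l * (d + 1) ≤ M * l * D :=
          mul_le_mul_of_nonneg_left (by linarith) (by positivity)
        nlinarith
      have h5 : (d + 2) * (d + 1) * G ≤ (d + 2) * (d + 1) * (r ^ (d + 2) * C2) := by
        calc (d + 2) * (d + 1) * G = (d + 1) * ((d + 2) * G) := by ring
          _ ≤ (d + 1) * ((r ^ d * C) * (M * l)) := by
              refine mul_le_mul_of_nonneg_left (hrec.trans ?_) (by positivity)
              exact mul_le_mul_of_nonneg_right ih' (by positivity)
          _ = r ^ d * C * (M * l * (d + 1)) := by ring
          _ ≤ r ^ d * C * (r ^ 2 * ((M - d) * (M - (d + 1)))) :=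
              mul_le_mul_of_nonneg_left h4 (by positivity)
          _ = r ^ (d + 2) * (C * ((M - d) * (M - (d + 1)))) := by ring
          _ = _ := by rw [← c3]; ring
      exact le_of_mul_le_mul_left h5 (by positivity)

/-- Sets in `evenRowSets` avoid position `0`, a fraction `1 / l` of the points. This is the purpose
of the separate signs there: evenness alone does not thin out the top levels, since for even `l` the
full set has even rows. -/
theorem card_evenRowSets_le_of_singles (hl : 1 ≤ l) (d : ℕ) :
    ((evenRowSets K l d).card : ℝ) ≤ (1 - 1 / (l : ℝ)) ^ d * (K * l).choose d := by
  rcases Nat.eq_zero_or_pos K with rfl | hK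
  · have h1 : (evenRowSets 0 l d).card ≤ (Nat.choose (0 * l) d) := by
      refine (Finset.card_le_card (t := Finset.powersetCard d Finset.univ) fun U hU =>
        Finset.mem_powersetCard.2 ⟨Finset.subset_univ U, (mem_evenRowSets.1 hU).1⟩).trans ?_
      simp
    rcases d with _ | d
    · have h2 : ((evenRowSets 0 l 0).card : ℝ) ≤ (Nat.choose (0 * l) 0 : ℕ) := by exact_mod_cast h1
      simpa using h2
    · rw [zero_mul, Nat.choose_zero_succ] at h1 ⊢
      simp [Nat.le_zero.1 h1]
  have h1 : (evenRowSets K l d).card ≤ (K * (l - 1)).choose d := by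
    have hsub : evenRowSets K l d ⊆ Finset.powersetCard d
        (Finset.univ.filter fun j : Fin K × Fin l => j.2.val ≠ 0) := by
      intro U hU
      obtain ⟨hc, hE⟩ := mem_evenRowSets.1 hU
      exact Finset.mem_powersetCard.2 ⟨fun j hj => Finset.mem_filter.2 ⟨Finset.mem_univ j,
        hE.1 j hj⟩, hc⟩
    have hcard : (Finset.univ.filter fun j : Fin K × Fin l => j.2.val ≠ 0).card = K * (l - 1) := by
      have e : (Finset.univ.filter fun j : Fin K × Fin l => j.2.val ≠ 0) =
          Finset.univ ×ˢ (Finset.univ.filter fun t : Fin l => t.val ≠ 0) := by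
        ext j
        simp
      have e2 : (Finset.univ.filter fun t : Fin l => t.val ≠ 0) =
          Finset.univ.erase (⟨0, hl⟩ : Fin l) := by
        ext t
        simp [Fin.ext_iff]
      rw [e, Finset.card_product, e2, Finset.card_erase_of_mem (Finset.mem_univ _)]
      simp
    have := Finset.card_le_card hsub
    rwa [Finset.card_powersetCard, hcard] at this
  have h2 := choose_mul_pow_le (a := K * (l - 1)) (b := K * l)
    (Nat.mul_le_mul_left K (Nat.sub_le l 1)) d
  have hK0 : (0 : ℝ) < K := by exact_mod_cast hK
  have hl0 : (0 : ℝ) < l := by exact_mod_cast hl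
  have e : ((K * (l - 1) : ℕ) : ℝ) = (1 - 1 / (l : ℝ)) * (K * l : ℕ) := by
    push_cast [Nat.cast_sub hl]
    field_simp
  rw [e, mul_pow, mul_right_comm] at h2
  have hpos : (0 : ℝ) < ((K * l : ℕ) : ℝ) ^ d := by
    push_cast
    positivity
  exact (Nat.cast_le.2 h1).trans (le_of_mul_le_mul_right h2 hpos)

variable {B : Type*} [Fintype B] [DecidableEq B]

open Classical in
-- The weight is constant on each level, so restricting to even sets multiplies the level by the
-- fraction of even sets in it.
theorem sum_levelWeight_evenRows_le (F : Finset B → ℝ) {r ε : ℝ}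
    (hb : ∀ d, ((evenRowSets K l d).card : ℝ) ≤ (r ^ d + ε) * (K * l).choose d) :
    ∑ U : Finset (Fin K × Fin l), levelWeight F U * (if EvenRows U then 1 else 0) ≤
      levelWeight F (∅ : Finset (Fin K × Fin l)) +
        ∑ U ∈ Finset.univ.erase (∅ : Finset (Fin K × Fin l)),
          levelWeight F U * (r ^ U.card + ε) := by
  rw [← Finset.add_sum_erase _ _ (Finset.mem_univ (∅ : Finset (Fin K × Fin l)))]
  have h0 : ∀ U : Finset (Fin K × Fin l), levelWeight F U * (if EvenRows U then 1 else 0) ≤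
      levelWeight F U := fun U => by
    have := levelWeight_nonneg F U
    split_ifs <;> linarith
  refine add_le_add (h0 ∅) ?_
  rw [← Finset.sum_fiberwise_of_maps_to
      (s := Finset.univ.erase (∅ : Finset (Fin K × Fin l))) (t := Finset.Icc 1 (K * l))
      (g := Finset.card),
    ← Finset.sum_fiberwise_of_maps_to
      (s := Finset.univ.erase (∅ : Finset (Fin K × Fin l))) (t := Finset.Icc 1 (K * l))
      (g := Finset.card) (f := fun U => levelWeight F U * (r ^ U.card + ε))]
  · refine Finset.sum_le_sum fun d hd => ?_
    obtain ⟨hd1, hd2⟩ := Finset.mem_Icc.1 hd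
    have hset : (Finset.univ.erase (∅ : Finset (Fin K × Fin l))).filter (fun U => U.card = d) =
        Finset.powersetCard d Finset.univ := by
      ext U
      simp only [Finset.mem_filter, Finset.mem_erase, Finset.mem_univ, and_true,
        Finset.mem_powersetCard, Finset.subset_univ, true_and]
      constructor
      · exact fun h => h.2
      · intro h
        refine ⟨?_, h⟩
        rintro rfl
        simp at h
        omega
    rw [hset]
    obtain ⟨U₀, hU₀⟩ : (Finset.powersetCard d
        (Finset.univ : Finset (Fin K × Fin l))).Nonempty :=
      Finset.powersetCard_nonempty.2 (by simpa using hd2)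
    have hw : ∀ U ∈ Finset.powersetCard d (Finset.univ : Finset (Fin K × Fin l)),
        levelWeight F U = levelWeight F U₀ := fun U hU =>
      levelWeight_eq_of_card_eq F (by
        rw [(Finset.mem_powersetCard.1 hU).2, (Finset.mem_powersetCard.1 hU₀).2])
    have e1 : ∑ U ∈ Finset.powersetCard d (Finset.univ : Finset (Fin K × Fin l)),
        levelWeight F U * (if EvenRows U then (1 : ℝ) else 0) = levelWeight F U₀ *
          ∑ U ∈ Finset.powersetCard d (Finset.univ : Finset (Fin K × Fin l)),
            if EvenRows U then (1 : ℝ) else 0 := by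
      rw [Finset.mul_sum]
      exact Finset.sum_congr rfl fun U hU => by rw [hw U hU]
    have e2 : ∑ U ∈ Finset.powersetCard d (Finset.univ : Finset (Fin K × Fin l)),
        levelWeight F U * (r ^ U.card + ε) = levelWeight F U₀ *
          ∑ U ∈ Finset.powersetCard d (Finset.univ : Finset (Fin K × Fin l)), (r ^ d + ε) := by
      rw [Finset.mul_sum]
      exact Finset.sum_congr rfl fun U hU => by
        rw [hw U hU, (Finset.mem_powersetCard.1 hU).2]
    rw [e1, e2]
    refine mul_le_mul_of_nonneg_left ?_ (levelWeight_nonneg F U₀)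
    rw [Finset.sum_boole, Finset.sum_const, Finset.card_powersetCard, nsmul_eq_mul]
    have := hb d
    rw [evenRowSets] at this
    simpa [mul_comm] using this
  · intro U hU
    refine Finset.mem_Icc.2 ⟨Finset.card_pos.2
      (Finset.nonempty_iff_ne_empty.2 (Finset.mem_erase.1 hU).1), ?_⟩
    simpa using Finset.card_le_univ U
  · intro U hU
    refine Finset.mem_Icc.2 ⟨Finset.card_pos.2
      (Finset.nonempty_iff_ne_empty.2 (Finset.mem_erase.1 hU).1), ?_⟩
    simpa using Finset.card_le_univ U

/-- The average of `F` over the halves that a random placement and random block signs give. -/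
def blockMean (l : ℕ) (F : Finset B → ℝ) (σ : (Bool × Fin K × Fin l) ≃ B) : ℝ :=
  Finset.expect Finset.univ fun g => placed F σ (blockSet l g)

theorem expect_blockMean (F : Finset B → ℝ) :
    Finset.expect Finset.univ (blockMean (K := K) l F) = halfMean (Fin K × Fin l) F := by
  unfold blockMean placed
  rw [Finset.expect_comm, Finset.expect_congr rfl fun u _ =>
    expect_map_of_card_eq F (card_layer _), Finset.expect_const Finset.univ_nonempty]

theorem expect_blockMean_sq (F : Finset B → ℝ) :
    Finset.expect Finset.univ (fun σ => blockMean (K := K) l F σ ^ 2) =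
      ∑ U : Finset (Fin K × Fin l), levelWeight F U *
        (Finset.expect Finset.univ fun g => walsh U (blockSet l g)) ^ 2 := by
  have e1 : ∀ σ : (Bool × Fin K × Fin l) ≃ B, blockMean l F σ ^ 2 =
      Finset.expect Finset.univ fun g => Finset.expect Finset.univ fun g' =>
        placed F σ (blockSet l g) * placed F σ (blockSet l g') := fun σ => by
    rw [sq, blockMean, Finset.expect_mul_expect]
  have e2 : ∀ U : Finset (Fin K × Fin l),
      (Finset.expect Finset.univ fun g => walsh U (blockSet l g)) ^ 2 =
      Finset.expect Finset.univ fun g => Finset.expect Finset.univ fun g' =>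
        walsh U (blockSet l g) * walsh U (blockSet l g') := fun U => by
    rw [sq, Finset.expect_mul_expect]
  simp only [e1, e2, Finset.mul_expect]
  rw [Finset.expect_comm, ← Finset.expect_sum_comm]
  refine Finset.expect_congr rfl fun g _ => ?_
  rw [Finset.expect_comm, ← Finset.expect_sum_comm]
  refine Finset.expect_congr rfl fun g' _ => ?_
  have := overlap_layer F (blockSet l g) (blockSet l g')
  simp only [walsh_symmDiff] at this
  exact this

/-- Let `Q` be the damped weight of the nonempty characters. The second moment is at most `ω₀ + Q`,
and `ω₀ - Q ≤ μ ^ 2`, so it is at most `μ ^ 2 + 2 * Q`. Hypercontractivity bounds `Q` by a small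
multiple of `ω₀ + μ ^ 2`, hence of `μ ^ 2`. -/
theorem expect_blockMean_sq_le [Nonempty ((Bool × Fin K × Fin l) ≃ B)] {F : Finset B → ℝ}
    (hF : ∀ S, F S = 0 ∨ F S = 1) {r ε a δ : ℝ} {D : ℕ} (hl : 1 ≤ l) (hr0 : 0 ≤ r)
    (hr6 : r ≤ 1 / 6) (ha0 : 0 ≤ a) (ha : a ≤ 1 / 3)
    (hD2 : 2 * (D : ℝ) + 2 ≤ K * l) (hDr : 4 * ((D : ℝ) + 1) * l ≤ r ^ 2 * (K * l))
    (hrε : r ^ D ≤ ε) (hlε : (1 - 1 / (l : ℝ)) ^ D ≤ ε)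
    (hpow : ∀ m : ℝ, 0 ≤ m → m ≤ 1 → m ^ (2 / (1 + 6 * r)) ≤ (1 + a) * m ^ 2 + δ * m)
    (hsmall : δ + ε ≤ a * halfMean (Fin K × Fin l) F) :
    Finset.expect Finset.univ (fun σ => blockMean (K := K) l F σ ^ 2) ≤
      (1 + 6 * a) * halfMean (Fin K × Fin l) F ^ 2 := by
  classical
  have hl1 : (1 : ℝ) ≤ l := by exact_mod_cast hl
  have hε : 0 ≤ ε := (pow_nonneg hr0 D).trans hrε
  have hl0 : (0 : ℝ) ≤ 1 - 1 / (l : ℝ) := by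
    rw [sub_nonneg, div_le_one (by linarith)]
    exact hl1
  have hD0 : (0 : ℝ) ≤ D := Nat.cast_nonneg D
  set μ := halfMean (Fin K × Fin l) F with hμ
  set ω₀ := levelWeight F (∅ : Finset (Fin K × Fin l)) with hω₀
  set Q := ∑ U ∈ Finset.univ.erase (∅ : Finset (Fin K × Fin l)),
    levelWeight F U * (r ^ U.card + ε) with hQ
  have hμ0 : 0 ≤ μ := expect_nonneg_of fun σ _ => by
    rcases hF ((layer (∅ : Finset (Fin K × Fin l))).map σ.toEmbedding) with h | h
    · rw [h]
    · rw [h]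
      exact zero_le_one
  have hω0 : 0 ≤ ω₀ := levelWeight_nonneg _ _
  -- Levels up to `D` use the pairing count, higher levels the avoidance of position `0`.
  have hb : ∀ d, ((evenRowSets K l d).card : ℝ) ≤ (r ^ d + ε) * (K * l).choose d := by
    intro d
    rcases le_or_gt d D with h | h
    · refine (card_evenRowSets_le_pow hr0 (by linarith) (by nlinarith) d h).trans ?_
      exact mul_le_mul_of_nonneg_right (by linarith) (Nat.cast_nonneg _)
    · refine (card_evenRowSets_le_of_singles hl d).trans ?_
      refine mul_le_mul_of_nonneg_right ?_ (Nat.cast_nonneg _)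
      have h1 : (1 - 1 / (l : ℝ)) ^ d ≤ (1 - 1 / (l : ℝ)) ^ D :=
        pow_le_pow_of_le_one hl0 (by simp) h.le
      have h2 : 0 ≤ r ^ d := by positivity
      linarith
  have hup : Finset.expect Finset.univ (fun σ => blockMean (K := K) l F σ ^ 2) ≤ ω₀ + Q := by
    rw [expect_blockMean_sq]
    refine le_trans (Finset.sum_le_sum fun U _ => ?_) (sum_levelWeight_evenRows_le F hb)
    exact mul_le_mul_of_nonneg_left (expect_walsh_blockSet_sq_le U) (levelWeight_nonneg F U)
  have hlow : ω₀ - Q ≤ μ ^ 2 := by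
    rw [hμ, halfMean_sq_eq, ← Finset.add_sum_erase _ _ (Finset.mem_univ ∅)]
    have e0 : signCorr (zeroCopy (∅ : Finset (Fin K × Fin l))) = 1 := by
      simp [signCorr, zeroCopy]
    rw [e0, mul_one, sub_eq_add_neg, hQ, ← Finset.sum_neg_distrib]
    refine add_le_add le_rfl (Finset.sum_le_sum fun U _ => ?_)
    rw [← mul_neg]
    refine mul_le_mul_of_nonneg_left ?_ (levelWeight_nonneg F U)
    have hUc : U.card ≤ Fintype.card (Fin K × Fin l) := Finset.card_le_univ U
    have h1 := abs_signCorr_le (J := Fin K × Fin l) (r := r) (D := D) hr0 (by linarith) (by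
      simp only [Fintype.card_prod, Fintype.card_fin]
      push_cast
      nlinarith) U.card (zeroCopy U) (by simp [zeroCopy]) hUc
    have h2 : r ^ (min U.card D) ≤ r ^ U.card + ε := by
      rcases le_total U.card D with h | h
      · rw [min_eq_left h]
        linarith
      · rw [min_eq_right h]
        have : 0 ≤ r ^ U.card := by positivity
        linarith
    linarith [(abs_le.1 h1).1]
  have hQle : Q ≤ a * ω₀ + (δ + ε) * μ := by
    have h1 := sum_pow_card_mul_levelWeight_le (J := Fin K × Fin l) hF hr0 hr6 hpow
    rw [← Finset.add_sum_erase _ _ (Finset.mem_univ (∅ : Finset (Fin K × Fin l)))] at h1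
    simp only [Finset.card_empty, pow_zero, one_mul] at h1
    have h2 : ∑ U ∈ Finset.univ.erase (∅ : Finset (Fin K × Fin l)), levelWeight F U ≤ μ := by
      rw [hμ, ← sum_levelWeight hF]
      exact Finset.sum_le_sum_of_subset_of_nonneg (Finset.erase_subset _ _)
        fun U _ _ => levelWeight_nonneg F U
    have h3 : Q = ∑ U ∈ Finset.univ.erase (∅ : Finset (Fin K × Fin l)),
        r ^ U.card * levelWeight F U + ε * ∑ U ∈ Finset.univ.erase
          (∅ : Finset (Fin K × Fin l)), levelWeight F U := by
      rw [hQ, Finset.mul_sum, ← Finset.sum_add_distrib]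
      exact Finset.sum_congr rfl fun U _ => by ring
    have h4 := mul_le_mul_of_nonneg_left h2 hε
    rw [h3]
    linarith
  have hQ2 : Q ≤ a * ω₀ + a * μ ^ 2 := by
    have := mul_le_mul_of_nonneg_right hsmall hμ0
    nlinarith
  -- From `(1 - a) * ω₀ ≤ (1 + a) * μ ^ 2` and `a ≤ 1 / 3`. Then `Q ≤ 3 * a * μ ^ 2`, which gives
  -- the factor `1 + 6 * a`.
  have hω : ω₀ ≤ 2 * μ ^ 2 := by nlinarith [sq_nonneg μ]
  nlinarith [sq_nonneg μ]

end Blocks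

/-! ### Cycles that run through a grid row by row -/

section Cycles

theorem formPerm_apply_of_eq_append {α : Type*} [DecidableEq α] {L l₁ l₂ : List α} {x y : α}
    (hL : L.Nodup) (h : L = l₁ ++ x :: y :: l₂) : L.formPerm x = y := by
  have h1 : l₁.length + 1 < L.length := by simp [h]
  have := List.formPerm_apply_lt_getElem L hL l₁.length h1
  have e1 : L[l₁.length] = x := by simp [h]
  have e2 : L[l₁.length + 1] = y := by
    subst h
    rw [List.getElem_append_right (by simp)]
    simp
  rwa [e1, e2] at this

/-- The two cycles that run through a set and its complement in the order of a list. -/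
theorem exists_twoCycles_of_list {α : Type*} [Fintype α] [DecidableEq α] {L : List α}
    (hL : L.Nodup) (hmem : ∀ x, x ∈ L) (p : α → Prop) :
    ∃ τ : Equiv.Perm α, τ.IsCycleOn {x | p x} ∧ τ.IsCycleOn {x | p x}ᶜ ∧
      ∀ l₁ l₂ x y, L = l₁ ++ x :: y :: l₂ → (p x ↔ p y) → τ x = y := by
  classical
  -- Neighbours in `L` that both survive the filter remain neighbours, so the smaller cycle makes
  -- the same step.
  have key : ∀ q : α → Prop, ∀ l₁ l₂ x y, L = l₁ ++ x :: y :: l₂ → q x → q y →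
      (L.filter fun z => decide (q z)).formPerm x = y := fun q l₁ l₂ x y h hx hy => by
    refine formPerm_apply_of_eq_append (l₁ := l₁.filter fun z => decide (q z))
      (l₂ := l₂.filter fun z => decide (q z)) (hL.filter _) ?_
    rw [h, List.filter_append, List.filter_cons_of_pos (by simpa using hx),
      List.filter_cons_of_pos (by simpa using hy)]
  have hc : ∀ q : α → Prop, (L.filter fun z => decide (q z)).formPerm.IsCycleOn {x | q x} :=
    fun q => by
    have := (hL.filter fun z => decide (q z)).isCycleOn_formPerm
    have e : {a | a ∈ L.filter fun z => decide (q z)} = {x | q x} := by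
      ext x
      simp [hmem]
    rwa [e] at this
  obtain ⟨τ, h1, h2, h3, h4⟩ := exists_glued_cycles (hc p) (hc fun x => ¬ p x)
  refine ⟨τ, h1, h2, fun l₁ l₂ x y h hxy => ?_⟩
  by_cases hx : p x
  · rw [h3 x hx, key p l₁ l₂ x y h hx (hxy.1 hx)]
  · rw [h4 x hx, key (fun z => ¬ p z) l₁ l₂ x y h hx (fun hy => hx (hxy.2 hy))]

theorem exists_finRange_eq_append {l : ℕ} (t : Fin l) (ht : t.val + 1 < l) :
    ∃ l₁ l₂, List.finRange l = l₁ ++ t :: ⟨t.val + 1, ht⟩ :: l₂ := by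
  refine ⟨(List.finRange l).take t.val, (List.finRange l).drop (t.val + 2), ?_⟩
  conv_lhs => rw [← List.take_append_drop t.val (List.finRange l)]
  rw [List.drop_eq_getElem_cons (by simp), List.drop_eq_getElem_cons (by simpa using ht)]
  simp

/-- A cycle on everything and, for each choice of block signs, a pair of cycles on the layer and
its complement that differs from it at block ends only. -/
theorem exists_block_cycles (K l : ℕ) : ∃ (c : Equiv.Perm (Bool × Fin K × Fin l))
    (τ : Finset (Fin K) × Finset (Fin K) → Equiv.Perm (Bool × Fin K × Fin l)),
    c.IsCycleOn Set.univ ∧ ∀ g, (τ g).IsCycleOn (layer (blockSet l g) : Set _) ∧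
      (τ g).IsCycleOn (layer (blockSet l g) : Set (Bool × Fin K × Fin l))ᶜ ∧
      ∀ y, y.2.2.val ≠ 0 → y.2.2.val + 1 ≠ l → τ g y = c y := by
  classical
  set L : List (Bool × Fin K × Fin l) :=
    ((Finset.univ : Finset (Bool × Fin K)).toList ×ˢ List.finRange l).map fun z =>
      (z.1.1, z.1.2, z.2) with hLdef
  have hinj : Function.Injective fun z : (Bool × Fin K) × Fin l => (z.1.1, z.1.2, z.2) := by
    rintro ⟨⟨a, b⟩, t⟩ ⟨⟨a', b'⟩, t'⟩ h
    simpa [and_assoc] using h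
  have hL : L.Nodup := ((Finset.nodup_toList _).product (List.nodup_finRange l)).map hinj
  have hmem : ∀ x, x ∈ L := fun x => List.mem_map.2 ⟨((x.1, x.2.1), x.2.2), by
    rw [List.mem_product]
    simp, rfl⟩
  have hnext : ∀ y : Bool × Fin K × Fin l, ∀ h : y.2.2.val + 1 < l, ∃ l₁ l₂,
      L = l₁ ++ y :: (y.1, y.2.1, (⟨y.2.2.val + 1, h⟩ : Fin l)) :: l₂ := by
    intro y h
    obtain ⟨a, b, hab⟩ := List.append_of_mem
      (show (y.1, y.2.1) ∈ (Finset.univ : Finset (Bool × Fin K)).toList by simp)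
    obtain ⟨a', b', hab'⟩ := exists_finRange_eq_append y.2.2 h
    refine ⟨(a ×ˢ List.finRange l).map (fun z => (z.1.1, z.1.2, z.2)) ++
      a'.map (fun t => (y.1, y.2.1, t)), b'.map (fun t => (y.1, y.2.1, t)) ++
      (b ×ˢ List.finRange l).map (fun z => (z.1.1, z.1.2, z.2)), ?_⟩
    rw [hLdef, hab]
    change List.map _ (List.flatMap _ _) = _
    have e : List.map (fun z : (Bool × Fin K) × Fin l => (z.1.1, z.1.2, z.2))
        (List.map (Prod.mk (y.1, y.2.1)) (List.finRange l)) =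
        a'.map (fun t => (y.1, y.2.1, t)) ++ y :: (y.1, y.2.1, (⟨y.2.2.val + 1, h⟩ : Fin l)) ::
          b'.map (fun t => (y.1, y.2.1, t)) := by
      rw [hab', List.map_map, List.map_append]
      rfl
    rw [List.flatMap_append, List.flatMap_cons, List.map_append, List.map_append, e]
    simp only [List.append_assoc, List.cons_append]
    rfl
  have hcyc := hL.isCycleOn_formPerm
  have e : {a | a ∈ L} = Set.univ := by
    ext x
    simp [hmem]
  rw [e] at hcyc
  choose τ hτ1 hτ2 hτ3 using fun g : Finset (Fin K) × Finset (Fin K) =>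
    exists_twoCycles_of_list hL hmem fun y => y ∈ layer (blockSet l g)
  refine ⟨L.formPerm, τ, hcyc, fun g => ⟨hτ1 g, hτ2 g, fun y h0 h1 => ?_⟩⟩
  have h : y.2.2.val + 1 < l := lt_of_le_of_ne y.2.2.isLt h1
  obtain ⟨l₁, l₂, hl⟩ := hnext y h
  rw [formPerm_apply_of_eq_append hL hl, hτ3 g l₁ l₂ _ _ hl]
  -- The point and its successor lie in the same copy and row, both away from position `0`, so the
  -- same row sign puts them on the same side.
  simp [mem_layer, mem_blockSet, h0]

end Cycles

/-! ### Query weight on a few points of a randomly labelled cycle -/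

section Queries

variable {n W T : ℕ} {Y : Type*} [Fintype Y] [DecidableEq Y]

/-- Rotating the labels along `c` leaves the relabelled cycle unchanged, so the mean query weight at
the label of `y` is the same for all `y`. The total weight is at most one. -/
theorem expect_queryWeight_le [Nonempty (Y ≃ Bits n)] {ι : Type*} [Fintype ι]
    {c : Equiv.Perm Y} (hc : c.IsCycleOn Set.univ) (p : ι → ZMod 2 × Bits n)
    (φ : Equiv.Perm (Bits n) → ι → ℝ) (h0 : ∀ π q, 0 ≤ φ π q) (h1 : ∀ π, ∑ q, φ π q ≤ 1)
    (b : ZMod 2) (y : Y) :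
    Finset.expect Finset.univ (fun σ : Y ≃ Bits n =>
      ∑ q, if p q = (b, σ y) then φ (σ.permCongr c) q else 0) ≤ 1 / (Fintype.card Y : ℝ) := by
  set h : Y → ℝ := fun y => Finset.expect Finset.univ (fun σ : Y ≃ Bits n =>
      ∑ q, if p q = (b, σ y) then φ (σ.permCongr c) q else 0) with hh
  have hinv : ∀ y, h (c y) = h y := by
    intro y
    rw [hh]
    refine (Finset.expect_equiv (Equiv.equivCongr c.symm (Equiv.refl (Bits n))) (by simp)
      fun σ _ => ?_)
    have e : (Equiv.equivCongr c.symm (Equiv.refl (Bits n)) σ).permCongr c = σ.permCongr c := by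
      ext x
      simp [Equiv.equivCongr, Equiv.permCongr_apply]
    rw [e]
    simp [Equiv.equivCongr]
  have hconst : ∀ z, h z = h y := by
    intro z
    obtain ⟨k, hk⟩ := hc.exists_pow_eq' Set.finite_univ (Set.mem_univ y) (Set.mem_univ z)
    rw [← hk]
    clear hk
    induction k with
    | zero => simp
    | succ k ih => rw [pow_succ', Equiv.Perm.mul_apply, hinv, ih]
  have hsum : ∑ z, h z ≤ 1 := by
    rw [hh, ← Finset.expect_sum_comm]
    refine expect_le_of zero_le_one fun σ _ => ?_
    rw [Finset.sum_comm]
    refine (Finset.sum_le_sum fun q _ => ?_).trans (h1 (σ.permCongr c))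
    calc ∑ z, (if p q = (b, σ z) then φ (σ.permCongr c) q else 0)
        ≤ ∑ z, if z = σ.symm (p q).2 then φ (σ.permCongr c) q else 0 := by
          refine Finset.sum_le_sum fun z _ => ?_
          split_ifs with h2 h3 h3
          · exact le_rfl
          · exact absurd (by rw [h2]; simp) h3
          · exact h0 _ _
          · exact le_rfl
      _ = φ (σ.permCongr c) q := by simp
  have hcard : (0 : ℝ) < Fintype.card Y := by
    have : 0 < Fintype.card Y := Fintype.card_pos_iff.2 ⟨y⟩
    exact_mod_cast this
  rw [Finset.sum_congr rfl fun z _ => hconst z, Finset.sum_const, Finset.card_univ,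
    nsmul_eq_mul] at hsum
  rw [le_div_iff₀ hcard]
  linarith

/-- Replacing a cycle by a permutation that differs from it only on `E` changes the acceptance
probability little, on average over the relabelings. -/
theorem exists_queryError [Nonempty (Y ≃ Bits n)] {c : Equiv.Perm Y}
    (hc : c.IsCycleOn Set.univ) (E : Finset Y) (V : DistVerifier n W T) (ψ : QState (Bits W)) :
    ∃ err : (Y ≃ Bits n) → ℝ,
      (∀ σ τ, (∀ y, y ∉ E → τ y = c y) → V.acceptProb (permOracle (σ.permCongr τ)) ψ ≤
        V.acceptProb (permOracle (σ.permCongr c)) ψ + err σ) ∧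
      ∀ d > 0, Finset.expect Finset.univ err ≤
        2 * T * (d + 2 * E.card / Fintype.card Y / d) := by
  classical
  -- Forward queries can differ on the labels of `E`, inverse queries on the labels of `c E`: a
  -- permutation equal to `c` off `E` has the same inverse off `c E`.
  let D : (Y ≃ Bits n) → Finset (ZMod 2 × Bits n) := fun σ =>
    E.image (fun e => (0, σ e)) ∪ E.image (fun e => (1, σ (c e)))
  let Φ : Equiv.Perm (Bits n) → ℕ → QIndex (ZMod 2 × Bits n) n (Bits W) V.ancillas → ℂ :=
    fun π s => V.state (permOracle π) ψ s
  refine ⟨fun σ => 4 * ∑ s ∈ Finset.range T, l2norm (queryPart (D σ) (Φ (σ.permCongr c) s)),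
    fun σ τ hτ => ?_, fun d hd => ?_⟩
  · refine V.acceptProb_le_add _ _ (D σ) ?_ ψ
    rintro ⟨b, x⟩ hx
    have hx' : (∀ e ∈ E, ¬ (0 = b ∧ σ e = x)) ∧ ∀ e ∈ E, ¬ (1 = b ∧ σ (c e) = x) := by
      simpa [D, not_or, Prod.ext_iff] using hx
    have hb : b = 0 ∨ b = 1 := by
      fin_cases b
      · exact Or.inl rfl
      · exact Or.inr rfl
    rcases hb with rfl | rfl
    · have h1 : σ.symm x ∉ E := fun h => hx'.1 _ h ⟨rfl, by simp⟩
      simp [permOracle, Equiv.permCongr_apply, hτ _ h1]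
    · have h1 : c.symm (σ.symm x) ∉ E := fun h => hx'.2 _ h ⟨rfl, by simp⟩
      have h2 : τ.symm (σ.symm x) = c.symm (σ.symm x) := by
        rw [Equiv.symm_apply_eq, hτ _ h1, Equiv.apply_symm_apply]
      have h3 : ∀ ρ : Equiv.Perm Y, (σ.permCongr ρ)⁻¹ x = σ (ρ.symm (σ.symm x)) := fun ρ => rfl
      simp [permOracle, h3, h2]
  · have hsq : ∀ s, Finset.expect Finset.univ
        (fun σ : Y ≃ Bits n => l2norm (queryPart (D σ) (Φ (σ.permCongr c) s)) ^ 2) ≤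
        2 * E.card / Fintype.card Y := by
      intro s
      have hw := fun b y => expect_queryWeight_le hc (fun q : QIndex (ZMod 2 × Bits n) n (Bits W)
        V.ancillas => q.2.1) (fun π q => ‖Φ π s q‖ ^ 2) (fun _ _ => sq_nonneg _)
        (fun π => by rw [← l2norm_sq, V.l2norm_state, one_pow]) b y
      have hle : ∀ σ : Y ≃ Bits n, l2norm (queryPart (D σ) (Φ (σ.permCongr c) s)) ^ 2 ≤
          (∑ e ∈ E, ∑ q, if q.2.1 = (0, σ e) then ‖Φ (σ.permCongr c) s q‖ ^ 2 else 0) +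
          ∑ e ∈ E, ∑ q, if q.2.1 = (1, σ (c e)) then ‖Φ (σ.permCongr c) s q‖ ^ 2 else 0 := by
        intro σ
        rw [l2norm_queryPart_sq, Finset.sum_comm, Finset.sum_comm (s := E),
          ← Finset.sum_add_distrib]
        refine Finset.sum_le_sum fun q _ => ?_
        have hnn : ∀ f : Y → ZMod 2 × Bits n, ∀ e ∈ E,
            0 ≤ if q.2.1 = f e then ‖Φ (σ.permCongr c) s q‖ ^ 2 else 0 := fun f e _ => by
          split_ifs
          · exact sq_nonneg _
          · exact le_rfl
        have h1 := Finset.sum_nonneg (hnn fun e => (0, σ e))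
        have h2 := Finset.sum_nonneg (hnn fun e => (1, σ (c e)))
        split_ifs with h
        · rcases Finset.mem_union.1 h with h | h
          · obtain ⟨e, he, heq⟩ := Finset.mem_image.1 h
            have := Finset.single_le_sum (hnn fun e => (0, σ e)) he
            rw [if_pos heq.symm] at this
            linarith
          · obtain ⟨e, he, heq⟩ := Finset.mem_image.1 h
            have := Finset.single_le_sum (hnn fun e => (1, σ (c e))) he
            rw [if_pos heq.symm] at this
            linarith
        · linarith
      refine (expect_mono fun σ _ => hle σ).trans ?_
      rw [Finset.expect_add_distrib, Finset.expect_sum_comm, Finset.expect_sum_comm]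
      have h1 := Finset.sum_le_sum fun e (_ : e ∈ E) => hw 0 e
      have h2 := Finset.sum_le_sum fun e (_ : e ∈ E) => hw 1 (c e)
      rw [Finset.sum_const, nsmul_eq_mul] at h1 h2
      refine (add_le_add h1 h2).trans (le_of_eq ?_)
      ring
    have hlin : ∀ s, Finset.expect Finset.univ
        (fun σ : Y ≃ Bits n => l2norm (queryPart (D σ) (Φ (σ.permCongr c) s))) ≤
        (d + 2 * E.card / Fintype.card Y / d) / 2 := by
      intro s
      -- The inequality of arithmetic and geometric means passes from the mean square to the mean;
      -- `d` remains free and is chosen at the end.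
      have h1 : ∀ x : ℝ, x ≤ d / 2 + x ^ 2 * (1 / (2 * d)) := fun x => by
        have : 0 ≤ (x - d) ^ 2 / (2 * d) := by positivity
        have e : (x - d) ^ 2 / (2 * d) = d / 2 + x ^ 2 * (1 / (2 * d)) - x := by
          field_simp
          ring
        linarith
      refine (expect_mono fun σ _ => h1 _).trans ?_
      rw [Finset.expect_add_distrib, Finset.expect_const Finset.univ_nonempty,
        ← Finset.expect_mul]
      have h2 := mul_le_mul_of_nonneg_right (hsq s) (show 0 ≤ 1 / (2 * d) by positivity)
      refine (add_le_add le_rfl h2).trans (le_of_eq ?_)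
      field_simp
    rw [← Finset.mul_expect, Finset.expect_sum_comm]
    have h3 := Finset.sum_le_sum fun s (_ : s ∈ Finset.range T) => hlin s
    rw [Finset.sum_const, Finset.card_range, nsmul_eq_mul] at h3
    linarith

end Queries

/-! ### A fixed witness works for few partitions -/

section Thresholds

variable {n W T : ℕ}

/-- Acceptance probability on a random product of two cycles for the partition `(S, Sᶜ)`. -/
def yesMean (V : DistVerifier n W T) (ψ : QState (Bits W)) (S : Finset (Bits n)) : ℝ :=
  Finset.expect (twoCycles S) fun π => V.acceptProb (permOracle π) ψ

/-- Acceptance probability on a random full cycle. -/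
def noMean (V : DistVerifier n W T) (ψ : QState (Bits W)) : ℝ :=
  Finset.expect (fullCycles n) fun π => V.acceptProb (permOracle π) ψ

theorem yesMean_nonneg (V : DistVerifier n W T) (ψ : QState (Bits W)) (S : Finset (Bits n)) :
    0 ≤ yesMean V ψ S := expect_nonneg_of fun _ _ => V.acceptProb_nonneg _ _

theorem yesMean_le_one (V : DistVerifier n W T) (ψ : QState (Bits W)) (S : Finset (Bits n)) :
    yesMean V ψ S ≤ 1 := expect_le_of zero_le_one fun _ _ => V.acceptProb_le_one _ _

theorem card_blockEnds_le (K l : ℕ) (hl : 1 ≤ l) :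
    (Finset.univ.filter fun y : Bool × Fin K × Fin l =>
      y.2.2.val = 0 ∨ y.2.2.val + 1 = l).card ≤ 4 * K := by
  have h : (Finset.univ.filter fun y : Bool × Fin K × Fin l =>
      y.2.2.val = 0 ∨ y.2.2.val + 1 = l) ⊆ (Finset.univ : Finset Bool) ×ˢ
        (Finset.univ : Finset (Fin K)) ×ˢ ({⟨0, hl⟩, ⟨l - 1, by omega⟩} : Finset (Fin l)) := by
    intro y hy
    have hy' : y.2.2.val = 0 ∨ y.2.2.val + 1 = l := by simpa using hy
    simp only [Finset.mem_product, Finset.mem_univ, true_and, Finset.mem_insert,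
      Finset.mem_singleton, Fin.ext_iff]
    omega
  refine (Finset.card_le_card h).trans ?_
  rw [Finset.card_product, Finset.card_product]
  have := Finset.card_le_two (a := (⟨0, hl⟩ : Fin l)) (b := ⟨l - 1, by omega⟩)
  simp only [Finset.card_univ, Fintype.card_bool, Fintype.card_fin]
  nlinarith [Nat.zero_le K]

theorem nonempty_equiv_bits {K l : ℕ} (hn : 1 ≤ n) (hKl : K * l = 2 ^ (n - 1)) :
    Nonempty ((Bool × Fin K × Fin l) ≃ Bits n) := by
  refine ⟨Fintype.equivOfCardEq ?_⟩
  rw [card_bits]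
  simp only [Fintype.card_prod, Fintype.card_bool, Fintype.card_fin]
  rw [hKl, ← pow_succ', Nat.sub_add_cancel hn]

theorem expect_halves_eq_halfMean {K l : ℕ} (hn : 1 ≤ n) (hKl : K * l = 2 ^ (n - 1))
    (F : Finset (Bits n) → ℝ) :
    Finset.expect (halves n) F = halfMean (Fin K × Fin l) F := by
  have := nonempty_equiv_bits hn hKl
  obtain ⟨_, τ, _, hτ⟩ := exists_block_cycles K l
  obtain ⟨h1, h2, -⟩ := hτ (∅, ∅)
  have hc : (layer (blockSet l ((∅, ∅) : Finset (Fin K) × Finset (Fin K)))).card =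
      2 ^ (n - 1) := by
    rw [card_layer, ← hKl]
    simp
  have h3 := expect_twoCycles_eq hn hc h1 h2 fun S _ => F S
  rw [expect_map_of_card_eq F (card_layer _)] at h3
  rw [← h3]
  exact Finset.expect_congr rfl fun S _ => (Finset.expect_const (twoCycles_nonempty S) _).symm

/-- Each `g` with a random placement `σ` yields a uniform two-cycle permutation and its half, whose
acceptance is within `err σ` above that of the full cycle at `σ`. Averaged over `g`, `F` contributes
`blockMean`; replacing it by its mean `μ` costs its mean absolute deviation. Dividing by `μ` leaves
the full-cycle acceptance and the errors. -/
theorem halfMean_mul_le {K l : ℕ} (hn : 1 ≤ n) (hl : 1 ≤ l) (hKl : K * l = 2 ^ (n - 1))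
    (V : DistVerifier n W T) (ψ : QState (Bits W)) {F : Finset (Bits n) → ℝ}
    (hF : ∀ S, F S = 0 ∨ F S = 1) {θ a η d : ℝ}
    (hFq : ∀ S ∈ halves n, F S = 1 → θ ≤ yesMean V ψ S) (hd : 0 < d)
    (hη : 0 < η) (hμ : 0 < halfMean (Fin K × Fin l) F)
    (hvar : Finset.expect Finset.univ (fun σ => blockMean (K := K) l F σ ^ 2) ≤
      (1 + a) * halfMean (Fin K × Fin l) F ^ 2) :
    θ ≤ noMean V ψ + 2 * T * (d + 4 / l / d) + (η + a / η) / 2 := by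
  have := nonempty_equiv_bits hn hKl
  set μ := halfMean (Fin K × Fin l) F with hμdef
  obtain ⟨c, τ, hc, hτ⟩ := exists_block_cycles K l
  obtain ⟨err, herr, hexp⟩ := exists_queryError hc (Finset.univ.filter
    fun y : Bool × Fin K × Fin l => y.2.2.val = 0 ∨ y.2.2.val + 1 = l) V ψ
  have hl0 : (0 : ℝ) < l := by exact_mod_cast hl
  have hKpos : (0 : ℝ) < K := by
    have : 0 < K * l := by rw [hKl]; positivity
    exact_mod_cast Nat.pos_of_mul_pos_right this
  have hexp' : Finset.expect Finset.univ err ≤ 2 * T * (d + 4 / l / d) := by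
    refine (hexp d hd).trans ?_
    have h1 : (((Finset.univ.filter fun y : Bool × Fin K × Fin l =>
      y.2.2.val = 0 ∨ y.2.2.val + 1 = l).card : ℕ) : ℝ) ≤ 4 * K := by
      exact_mod_cast card_blockEnds_le K l hl
    have h2 : ((Fintype.card (Bool × Fin K × Fin l) : ℕ) : ℝ) = 2 * (K * l) := by
      simp
    rw [h2]
    have h3 : 2 * (((Finset.univ.filter fun y : Bool × Fin K × Fin l =>
      y.2.2.val = 0 ∨ y.2.2.val + 1 = l).card : ℕ) : ℝ) / (2 * (K * l)) ≤ 4 / l := by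
      rw [div_le_div_iff₀ (by positivity) hl0]
      nlinarith
    gcongr
  -- This bound is the same for all `g`, so the average over `g` acts on `F` alone. The cap at `1`
  -- bounds the cost of replacing `blockMean` by `μ`.
  set m : ((Bool × Fin K × Fin l) ≃ Bits n) → ℝ := fun σ =>
    min 1 (V.acceptProb (permOracle (σ.permCongr c)) ψ + err σ) with hm
  have hF0 : ∀ S, 0 ≤ F S := fun S => by rcases hF S with h | h <;> rw [h]; norm_num
  have hm0 : ∀ σ, 0 ≤ m σ := fun σ => by
    have h1 := herr σ c fun _ _ => rfl
    exact le_min zero_le_one ((V.acceptProb_nonneg _ _).trans h1)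
  have hg : ∀ g, θ * μ ≤ Finset.expect Finset.univ fun σ => placed F σ (blockSet l g) * m σ := by
    intro g
    obtain ⟨h1, h2, h3⟩ := hτ g
    have hcard : (layer (blockSet l g)).card = 2 ^ (n - 1) := by
      rw [card_layer, ← hKl]
      simp
    have h4 := expect_twoCycles_eq hn hcard h1 h2
      fun S π => F S * V.acceptProb (permOracle π) ψ
    have h5 : θ * μ ≤ Finset.expect (halves n) fun S => Finset.expect (twoCycles S)
        fun π => F S * V.acceptProb (permOracle π) ψ := by
      rw [hμdef, ← expect_halves_eq_halfMean hn hKl, Finset.mul_expect]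
      refine expect_mono fun S hS => ?_
      rw [← Finset.mul_expect]
      rcases hF S with h | h
      · simp [h]
      · rw [h, mul_one, one_mul]
        exact hFq S hS h
    refine h5.trans (h4.le.trans (expect_mono fun σ _ => ?_))
    refine mul_le_mul_of_nonneg_left (le_min (V.acceptProb_le_one _ _) (herr σ _ fun y hy => ?_))
      (hF0 _)
    have hy' : ¬ (y.2.2.val = 0 ∨ y.2.2.val + 1 = l) := by simpa using hy
    exact h3 y (fun h => hy' (Or.inl h)) fun h => hy' (Or.inr h)
  have h1 : θ * μ ≤ Finset.expect Finset.univ fun σ => blockMean (K := K) l F σ * m σ := by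
    have h2 : θ * μ ≤ Finset.expect Finset.univ fun g => Finset.expect Finset.univ fun σ =>
        placed F σ (blockSet (K := K) l g) * m σ := by
      have := expect_mono (s := Finset.univ) fun g (_ : g ∈ Finset.univ) => hg g
      rwa [Finset.expect_const Finset.univ_nonempty] at this
    rw [Finset.expect_comm] at h2
    simpa only [blockMean, Finset.expect_mul] using h2
  have h2 : ∀ σ, blockMean (K := K) l F σ * m σ ≤
      μ * (V.acceptProb (permOracle (σ.permCongr c)) ψ + err σ) +
        (η * μ / 2 + (blockMean l F σ ^ 2 - 2 * μ * blockMean l F σ + μ ^ 2) *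
          (1 / (2 * η * μ))) := by
    intro σ
    set x := blockMean l F σ
    have e1 : m σ ≤ 1 := min_le_left _ _
    have e2 : m σ ≤ V.acceptProb (permOracle (σ.permCongr c)) ψ + err σ := min_le_right _ _
    have e3 : |x - μ| ≤ η * μ / 2 + (x ^ 2 - 2 * μ * x + μ ^ 2) * (1 / (2 * η * μ)) := by
      have e4 : 0 ≤ (|x - μ| - η * μ) ^ 2 * (1 / (2 * η * μ)) := by positivity
      have e5 : (|x - μ| - η * μ) ^ 2 * (1 / (2 * η * μ)) =
          η * μ / 2 + |x - μ| ^ 2 * (1 / (2 * η * μ)) - |x - μ| := by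
        field_simp
        ring
      rw [sq_abs] at e5
      have e6 : (x - μ) ^ 2 = x ^ 2 - 2 * μ * x + μ ^ 2 := by ring
      rw [e6] at e5
      linarith
    have e7 : (x - μ) * m σ ≤ |x - μ| := by
      refine (mul_le_mul_of_nonneg_right (le_abs_self _) (hm0 σ)).trans ?_
      exact mul_le_of_le_one_right (abs_nonneg _) e1
    have e8 := mul_le_mul_of_nonneg_left e2 hμ.le
    linarith
  have h3 := h1.trans (expect_mono fun σ _ => h2 σ)
  rw [Finset.expect_add_distrib, ← Finset.mul_expect, Finset.expect_add_distrib,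
    Finset.expect_add_distrib, Finset.expect_const Finset.univ_nonempty, ← Finset.expect_mul,
    Finset.expect_add_distrib, Finset.expect_sub_distrib, Finset.expect_const
    Finset.univ_nonempty, ← Finset.mul_expect, expect_blockMean, ← hμdef,
    ← expect_fullCycles_eq hc (fun π => V.acceptProb (permOracle π) ψ)] at h3
  change θ * μ ≤ μ * (noMean V ψ + _) + _ at h3
  have h4 : (Finset.expect Finset.univ (fun σ => blockMean (K := K) l F σ ^ 2) - 2 * μ * μ +
      μ ^ 2) * (1 / (2 * η * μ)) ≤ a / η / 2 * μ := by
    have : Finset.expect Finset.univ (fun σ => blockMean (K := K) l F σ ^ 2) - 2 * μ * μ +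
      μ ^ 2 ≤ a * μ ^ 2 := by linarith
    refine (mul_le_mul_of_nonneg_right this (by positivity)).trans (le_of_eq ?_)
    field_simp
  have h5 := mul_le_mul_of_nonneg_left hexp' hμ.le
  refine le_of_mul_le_mul_right ?_ hμ
  linarith

/-- For `m ≥ 2 ^ (-L)` the exponent falls short of `2` by at most `12 * r`, which costs a factor `2
^ (12 * r * L) ≤ 1 + a`. For smaller `m` the exponent is at least `3 / 2`, as `r ≤ 1 / 18`, and `m ^
(1 / 2)` is at most `2 ^ (-(L / 2))`. -/
theorem rpow_two_div_le {r L : ℝ} (hr0 : 0 ≤ r) (hr : r ≤ 1 / 18) (hL : 0 ≤ L) {a : ℝ}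
    (ha : 12 * r * L ≤ a) (ha1 : a ≤ 1) (m : ℝ) (hm0 : 0 ≤ m) (hm1 : m ≤ 1) :
    m ^ (2 / (1 + 6 * r)) ≤ (1 + a) * m ^ 2 + (2 : ℝ) ^ (-(L / 2)) * m := by
  have h6 : 0 < 1 + 6 * r := by linarith
  have ha0 : 0 ≤ a := le_trans (by positivity) ha
  have hpos : 0 ≤ (2 : ℝ) ^ (-(L / 2)) * m := by positivity
  rcases hm0.eq_or_lt with rfl | hm0
  · rw [Real.zero_rpow (by positivity)]
    simp
  rcases le_or_gt ((2 : ℝ) ^ (-L)) m with h | h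
  · have e : m ^ (2 / (1 + 6 * r)) = m ^ 2 * m ^ (-(12 * r / (1 + 6 * r))) := by
      rw [← Real.rpow_natCast m 2, ← Real.rpow_add hm0]
      congr 1
      push_cast
      field_simp
      ring
    have h1 : m ^ (-(12 * r / (1 + 6 * r))) ≤ ((2 : ℝ) ^ (-L)) ^ (-(12 * r / (1 + 6 * r))) := by
      refine Real.rpow_le_rpow_of_nonpos (by positivity) h ?_
      have : 0 ≤ 12 * r / (1 + 6 * r) := by positivity
      linarith
    have h2 : ((2 : ℝ) ^ (-L)) ^ (-(12 * r / (1 + 6 * r))) ≤ (2 : ℝ) ^ a := by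
      rw [← Real.rpow_mul (by norm_num)]
      refine Real.rpow_le_rpow_of_exponent_le (by norm_num) (le_trans ?_ ha)
      have : 12 * r / (1 + 6 * r) ≤ 12 * r := div_le_self (by positivity) (by linarith)
      nlinarith
    have h3 : (2 : ℝ) ^ a ≤ 1 + a := by
      have := rpow_one_add_le_one_add_mul_self (s := 1) (p := a) (by norm_num) ha0 ha1
      norm_num at this
      exact this
    rw [e]
    have := mul_le_mul_of_nonneg_left (h1.trans (h2.trans h3)) (sq_nonneg m)
    linarith
  · have h1 : m ^ (2 / (1 + 6 * r)) ≤ m ^ (3 / 2 : ℝ) := by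
      refine Real.rpow_le_rpow_of_exponent_ge hm0 hm1 ?_
      rw [div_le_div_iff₀ (by norm_num) h6]
      linarith
    have h2 : m ^ (3 / 2 : ℝ) = m ^ (1 / 2 : ℝ) * m := by
      rw [← Real.rpow_add_one hm0.ne']
      norm_num
    have h3 : m ^ (1 / 2 : ℝ) ≤ (2 : ℝ) ^ (-(L / 2)) := by
      refine (Real.rpow_le_rpow hm0.le h.le (by norm_num)).trans (le_of_eq ?_)
      rw [← Real.rpow_mul (by norm_num)]
      congr 1
      ring
    have h4 := mul_le_mul_of_nonneg_right h3 hm0.le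
    have : 0 ≤ (1 + a) * m ^ 2 := by positivity
    linarith

/-- A verifier that rarely accepts full cycles can accept often for few partitions only. -/
theorem expect_halves_lt {K l : ℕ} (hn : 1 ≤ n) (hl : 1 ≤ l) (hKl : K * l = 2 ^ (n - 1))
    (hK : 200000000000 * ((W : ℝ) + 21) ^ 3 * l ≤ K) (hT : 25600 * ((T : ℝ) + 1) ^ 2 ≤ l)
    (V : DistVerifier n W T) (ψ : QState (Bits W)) (hV : noMean V ψ ≤ 1 / 3)
    {F : Finset (Bits n) → ℝ} (hF : ∀ S, F S = 0 ∨ F S = 1)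
    (hFq : ∀ S ∈ halves n, F S = 1 → 1 / 2 ≤ yesMean V ψ S) :
    Finset.expect (halves n) F ≤ (1 / 2) ^ (W + 7) := by
  have := nonempty_equiv_bits hn hKl
  rw [expect_halves_eq_halfMean hn hKl]
  by_contra! hcon
  set μ := halfMean (Fin K × Fin l) F with hμdef
  have hl1 : (1 : ℝ) ≤ l := by exact_mod_cast hl
  set w : ℝ := (W : ℝ) + 21 with hw
  have hw21 : 21 ≤ w := by
    have : (0 : ℝ) ≤ W := Nat.cast_nonneg W
    linarith
  have hT0 : (0 : ℝ) ≤ T := Nat.cast_nonneg T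
  have hrε : (1 / 2 : ℝ) ^ (W + 21) = (2 : ℝ) ^ (-(2 * w / 2)) := by
    rw [Real.rpow_neg (by norm_num), one_div, inv_pow, ← Real.rpow_natCast]
    congr 2
    push_cast
    ring
  have hrw : 1 / (144000 * w) ≤ 1 / 18 := by
    rw [div_le_div_iff₀ (by positivity) (by norm_num)]
    nlinarith
  have hKl' : (l : ℝ) ≤ K * l := by
    have : (1 : ℝ) ≤ K := by
      refine le_trans ?_ hK
      have : (1 : ℝ) ≤ w ^ 3 := one_le_pow₀ (by linarith)
      nlinarith
    nlinarith
  -- With `L = 2 * w` this `r` gives `12 * r * L = 1 / 6000 = a`. Both `δ` and `ε` equal `2 ^ (-w)`,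
  -- and their sum is `2 ^ (-(W + 7)) / 8192 ≤ a * μ`. The choice `D = l * w` gives `(1 - 1 / l) ^ D
  -- ≤ exp (-w) ≤ ε`.
  have hmain := expect_blockMean_sq_le (K := K) (l := l) hF (r := 1 / (144000 * w))
    (ε := (1 / 2) ^ (W + 21)) (a := 1 / 6000) (δ := (2 : ℝ) ^ (-(2 * w / 2))) (D := l * (W + 21))
    hl (by positivity) (by linarith) (by norm_num) (by norm_num) ?_ ?_ ?_ ?_ ?_ ?_
  · have h1 := halfMean_mul_le hn hl hKl V ψ hF hFq (a := 1 / 1000) (η := 1 / 10)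
      (d := 1 / (80 * ((T : ℝ) + 1))) (by positivity) (by norm_num)
      (lt_trans (by positivity) hcon) (by
        refine hmain.trans (le_of_eq ?_)
        norm_num)
    have h2 : 2 * T * (1 / (80 * ((T : ℝ) + 1)) + 4 / l / (1 / (80 * ((T : ℝ) + 1)))) ≤
        1 / 20 := by
      have e1 : 2 * T * (1 / (80 * ((T : ℝ) + 1))) ≤ 1 / 40 := by
        rw [mul_one_div, div_le_div_iff₀ (by positivity) (by norm_num)]
        linarith
      have e2 : 2 * T * (4 / l / (1 / (80 * ((T : ℝ) + 1)))) ≤ 1 / 40 := by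
        have : 2 * T * (4 / l / (1 / (80 * ((T : ℝ) + 1)))) = 640 * (T * (T + 1)) / l := by
          field_simp
          ring
        rw [this, div_le_div_iff₀ (by linarith) (by norm_num)]
        nlinarith
      linarith
    -- The contradiction is `1 / 3 + 1 / 20 + 11 / 200 < 1 / 2`.
    have h3 : ((1 / 10 : ℝ) + 1 / 1000 / (1 / 10)) / 2 = 11 / 200 := by norm_num
    linarith
  · push_cast
    rw [← hw]
    have h1 : (1 : ℝ) ≤ w ^ 2 := one_le_pow₀ (by linarith)
    have h2 : 4 * w ≤ K := by
      refine le_trans ?_ hK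
      have : w ≤ w ^ 3 := by nlinarith
      nlinarith
    nlinarith
  · push_cast
    rw [← hw]
    have h2 : 4 * (l * w + 1) ≤ (1 / (144000 * w)) ^ 2 * K := by
      rw [div_pow, one_pow, div_mul_eq_mul_div, one_mul, le_div_iff₀ (by positivity)]
      refine le_trans ?_ hK
      have : (l : ℝ) * w + 1 ≤ 2 * (l * w) := by nlinarith
      have h3 : 4 * ((l : ℝ) * w + 1) * (144000 * w) ^ 2 ≤
          4 * (2 * (l * w)) * (144000 * w) ^ 2 := by gcongr
      refine h3.trans ?_
      have : 0 ≤ (l : ℝ) * w ^ 3 := by positivity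
      nlinarith
    have := mul_le_mul_of_nonneg_right h2 (by linarith : (0 : ℝ) ≤ l)
    linarith
  · have h1 : 1 / (144000 * w) ≤ 1 / 2 := by linarith
    refine (pow_le_pow_left₀ (by positivity) h1 _).trans ?_
    exact pow_le_pow_of_le_one (by norm_num) (by norm_num) (Nat.le_mul_of_pos_left _ hl)
  · have h0 : (0 : ℝ) ≤ 1 - 1 / l := by
      rw [sub_nonneg, div_le_one (by linarith)]
      exact hl1
    rw [pow_mul]
    refine pow_le_pow_left₀ (pow_nonneg h0 _) ?_ _
    have h1 : (1 - 1 / (l : ℝ)) ^ l ≤ Real.exp (-1) := by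
      have := Real.one_sub_div_pow_le_exp_neg (n := l) (t := 1) hl1
      exact this
    refine h1.trans ?_
    rw [Real.exp_neg, inv_le_comm₀ (Real.exp_pos _) (by norm_num)]
    have := Real.exp_one_gt_d9
    norm_num
    linarith
  · intro m hm0 hm1
    refine rpow_two_div_le (by positivity) hrw (by positivity) ?_ (by norm_num) m hm0 hm1
    rw [le_div_iff₀ (by norm_num)]
    field_simp
    norm_num
  · rw [← hrε]
    have h1 : (1 / 2 : ℝ) ^ (W + 21) = (1 / 2) ^ (W + 7) / 16384 := by
      rw [show W + 21 = W + 7 + 14 by ring, pow_add]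
      norm_num
      ring
    have h2 : (0 : ℝ) < (1 / 2) ^ (W + 7) := by positivity
    rw [h1]
    linarith

end Thresholds

/-! ### Classical witnesses that depend on all rows -/

section NoClassicalWitness

variable {n W T : ℕ}

theorem expect_families_expect (S Z A : Finset (Bits n)) (B : Finset (Equiv.Perm (Bits n)))
    (hA : A.Nonempty) (hAB : ∀ r ∈ A, (if r ∈ Z then twoCycles S else fullCycles n) = B)
    (g : Equiv.Perm (Bits n) → ℝ) :
    Finset.expect (families S Z) (fun F => Finset.expect A fun r => g (F r)) =
      Finset.expect B g := by
  rw [Finset.expect_comm, Finset.expect_congr rfl fun r hr => by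
    rw [expect_families_apply, hAB r hr], Finset.expect_const hA]

theorem distNoAccept_const (V : DistVerifier n W T) (ψ : QState (Bits W)) :
    distNoAccept V (fun _ => ψ) = noMean V ψ := by
  have hne : (Finset.univ.filter fun Z : Finset (Bits n) => Zᶜ ≠ ∅).Nonempty :=
    ⟨∅, by
      rw [Finset.mem_filter, Finset.compl_empty]
      exact ⟨Finset.mem_univ _, Finset.univ_nonempty.ne_empty⟩⟩
  rw [distNoAccept, sampleExp_eq]
  rw [Finset.expect_congr rfl (g := fun _ => noMean V ψ), Finset.expect_const hne]
  intro Z hZ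
  rw [Finset.expect_congr rfl (g := fun _ => noMean V ψ), Finset.expect_const (halves_nonempty n)]
  intro S _
  refine expect_families_expect S Z Zᶜ (fullCycles n) (Finset.nonempty_iff_ne_empty.2
    (Finset.mem_filter.1 hZ).2) (fun r hr => if_neg (Finset.mem_compl.1 hr))
    fun π => V.acceptProb (permOracle π) ψ

theorem exp_le_one_add_add_sq {x : ℝ} (hx : |x| ≤ 1) : Real.exp x ≤ 1 + x + x ^ 2 := by
  have h := Real.abs_exp_sub_one_sub_id_le hx
  linarith [(abs_le.1 h).2]

/-- The moment generating function of a sum over independent rows. -/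
theorem expect_exp_sum_le (S Z : Finset (Bits n)) {f : Equiv.Perm (Bits n) → ℝ}
    (hf0 : Finset.expect (twoCycles S) f = 0) (hf1 : ∀ π, |f π| ≤ 1) {x : ℝ} (hx0 : 0 ≤ x)
    (hx1 : x ≤ 1) :
    Finset.expect (families S Z) (fun F => Real.exp (x * ∑ r ∈ Z, f (F r))) ≤
      Real.exp (x ^ 2 * Z.card) := by
  have h1 : ∀ F : Bits n → Equiv.Perm (Bits n), Real.exp (x * ∑ r ∈ Z, f (F r)) =
      ∏ r, if r ∈ Z then Real.exp (x * f (F r)) else 1 := fun F => by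
    rw [Finset.mul_sum, Real.exp_sum, Finset.prod_ite_mem, Finset.univ_inter]
  simp only [h1]
  rw [families, expect_piFinset_prod _ fun r π => if r ∈ Z then Real.exp (x * f π) else 1]
  have h2 : Finset.expect (twoCycles S) (fun π => Real.exp (x * f π)) ≤ Real.exp (x ^ 2) := by
    -- The linear term has mean zero on `twoCycles S`, so each row of `Z` contributes at most `1 + x
    -- ^ 2 ≤ exp (x ^ 2)`.
    have h3 : ∀ π, Real.exp (x * f π) ≤ 1 + x * f π + x ^ 2 := fun π => by
      have h4 : |x * f π| ≤ 1 := by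
        rw [abs_mul, abs_of_nonneg hx0]
        exact mul_le_one₀ hx1 (abs_nonneg _) (hf1 π)
      have h5 : (f π) ^ 2 ≤ 1 := (sq_le_one_iff_abs_le_one _).2 (hf1 π)
      have h6 := exp_le_one_add_add_sq h4
      nlinarith [sq_nonneg x]
    refine (expect_mono fun π _ => h3 π).trans ?_
    rw [Finset.expect_add_distrib, Finset.expect_add_distrib, ← Finset.mul_expect, hf0,
      Finset.expect_const (twoCycles_nonempty S), Finset.expect_const (twoCycles_nonempty S)]
    linarith [Real.add_one_le_exp (x ^ 2)]
  have h3 : ∀ r, Finset.expect (if r ∈ Z then twoCycles S else fullCycles n)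
      (fun π => if r ∈ Z then Real.exp (x * f π) else 1) ≤
      if r ∈ Z then Real.exp (x ^ 2) else 1 := fun r => by
    split_ifs
    · exact h2
    · rw [Finset.expect_const (fullCycles_nonempty n)]
  refine (Finset.prod_le_prod (fun r _ => expect_nonneg_of fun π _ => ?_) fun r _ =>
    h3 r).trans (le_of_eq ?_)
  · split_ifs
    · exact (Real.exp_pos _).le
    · exact zero_le_one
  · rw [Finset.prod_ite_mem, Finset.univ_inter, Finset.prod_const, ← Real.exp_nat_mul, mul_comm]

/-- Even a witness that depends on the family hardly raises the acceptance probability of a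
random row. -/
theorem expect_families_accept_le (V : DistVerifier n W T) (S Z : Finset (Bits n))
    (hZ : Z.Nonempty) (w : (Bits n → Equiv.Perm (Bits n)) → Bits W) {Q x : ℝ}
    (hQ : ∀ v, yesMean V (QState.basis v) S ≤ Q) (hx0 : 0 < x) (hx1 : x ≤ 1) :
    Finset.expect (families S Z) (fun F => Finset.expect Z fun r =>
      V.acceptProb (permOracle (F r)) (QState.basis (w F))) ≤
      Q + x + (W + 1) / (x * Z.card) := by
  set f : Bits W → Equiv.Perm (Bits n) → ℝ := fun v π =>
    V.acceptProb (permOracle π) (QState.basis v) - yesMean V (QState.basis v) S with hf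
  have hZ0 : (0 : ℝ) < Z.card := by exact_mod_cast Finset.card_pos.2 hZ
  have hf0 : ∀ v, Finset.expect (twoCycles S) (f v) = 0 := fun v => by
    rw [hf, Finset.expect_sub_distrib, Finset.expect_const (twoCycles_nonempty S)]
    exact sub_self _
  have hf1 : ∀ v π, |f v π| ≤ 1 := fun v π => by
    rw [abs_le]
    have h1 := V.acceptProb_nonneg (permOracle π) (QState.basis v)
    have h2 := V.acceptProb_le_one (permOracle π) (QState.basis v)
    have h3 := yesMean_nonneg V (QState.basis v) S
    have h4 := yesMean_le_one V (QState.basis v) S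
    constructor <;> simp only [hf] <;> linarith
  -- Chosen so that the `2 ^ W` exponential moments, each at most `exp (x ^ 2 * |Z|)`, sum to at
  -- most `1` after the factor `exp (-C)`.
  set C : ℝ := W + x ^ 2 * Z.card with hC
  have hpt : ∀ F : Bits n → Equiv.Perm (Bits n), Finset.expect Z (fun r =>
      V.acceptProb (permOracle (F r)) (QState.basis (w F))) ≤ Q +
      (C + ∑ v, Real.exp (x * ∑ r ∈ Z, f v (F r)) * Real.exp (-C)) / (x * Z.card) := by
    intro F
    -- From `s ≤ C + exp (s - C)`. Summing the exponential over all witnesses is a union bound that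
    -- removes the dependence of the witness on `F`.
    have h1 : x * ∑ r ∈ Z, f (w F) (F r) ≤
        C + ∑ v, Real.exp (x * ∑ r ∈ Z, f v (F r)) * Real.exp (-C) := by
      have h2 := Real.add_one_le_exp (x * ∑ r ∈ Z, f (w F) (F r) + -C)
      rw [Real.exp_add] at h2
      have h3 := Finset.single_le_sum (s := Finset.univ)
        (f := fun v => Real.exp (x * ∑ r ∈ Z, f v (F r)) * Real.exp (-C))
        (fun v _ => by positivity) (Finset.mem_univ (w F))
      linarith
    have h2 : ∑ r ∈ Z, f (w F) (F r) = ∑ r ∈ Z, V.acceptProb (permOracle (F r))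
        (QState.basis (w F)) - Z.card * yesMean V (QState.basis (w F)) S := by
      rw [hf, Finset.sum_sub_distrib, Finset.sum_const, nsmul_eq_mul]
    rw [Finset.expect_eq_sum_div_card, div_le_iff₀ hZ0]
    have h3 := hQ (w F)
    have h4 : (Q + (C + ∑ v, Real.exp (x * ∑ r ∈ Z, f v (F r)) * Real.exp (-C)) /
        (x * Z.card)) * Z.card = Q * Z.card +
        (C + ∑ v, Real.exp (x * ∑ r ∈ Z, f v (F r)) * Real.exp (-C)) / x := by
      generalize C + ∑ v, Real.exp (x * ∑ r ∈ Z, f v (F r)) * Real.exp (-C) = y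
      field_simp
    have h5 : ∑ r ∈ Z, f (w F) (F r) ≤
        (C + ∑ v, Real.exp (x * ∑ r ∈ Z, f v (F r)) * Real.exp (-C)) / x := by
      rw [le_div_iff₀ hx0]
      linarith
    rw [h4]
    nlinarith
  refine (expect_mono fun F _ => hpt F).trans ?_
  rw [Finset.expect_add_distrib, Finset.expect_const (families_nonempty S Z),
    ← Finset.expect_div, Finset.expect_add_distrib,
    Finset.expect_const (families_nonempty S Z), Finset.expect_sum_comm]
  have h1 : ∑ v, Finset.expect (families S Z) (fun F =>
      Real.exp (x * ∑ r ∈ Z, f v (F r)) * Real.exp (-C)) ≤ 1 := by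
    have h2 : ∀ v, Finset.expect (families S Z) (fun F =>
        Real.exp (x * ∑ r ∈ Z, f v (F r)) * Real.exp (-C)) ≤ Real.exp (-(W : ℝ)) := fun v => by
      rw [← Finset.expect_mul]
      refine (mul_le_mul_of_nonneg_right (expect_exp_sum_le S Z (hf0 v) (hf1 v) hx0.le hx1)
        (Real.exp_pos _).le).trans (le_of_eq ?_)
      rw [← Real.exp_add, hC]
      congr 1
      ring
    refine (Finset.sum_le_sum fun v _ => h2 v).trans ?_
    rw [Finset.sum_const, Finset.card_univ, card_bits, nsmul_eq_mul, Real.exp_neg,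
      ← div_eq_mul_inv, div_le_one (Real.exp_pos _)]
    push_cast
    rw [← Real.exp_one_pow]
    exact pow_le_pow_left₀ (by norm_num) (by linarith [Real.add_one_le_exp (1 : ℝ)]) _
  have h2 : Q + x + (W + 1) / (x * Z.card) = Q + (C + 1) / (x * Z.card) := by
    rw [hC]
    field_simp
    ring
  rw [h2]
  gcongr

theorem distYesAccept_le (V : DistVerifier n W T) (P : ClassicalProver n W)
    {Q : Finset (Bits n) → ℝ} (hQ : ∀ S ∈ halves n, ∀ v, yesMean V (QState.basis v) S ≤ Q S)
    {x : ℝ} (hx0 : 0 < x) (hx1 : x ≤ 1) :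
    distYesAccept V P.toQuantum ≤
      Finset.expect (halves n) Q + x + 16 * (W + 1) / (x * 2 ^ n) := by
  have hne : (Finset.univ.filter fun Z : Finset (Bits n) => Z ≠ ∅).Nonempty :=
    ⟨Finset.univ, Finset.mem_filter.2 ⟨Finset.mem_univ _, Finset.univ_nonempty.ne_empty⟩⟩
  rw [distYesAccept, sampleExp_eq]
  have h1 : ∀ Z ∈ Finset.univ.filter (fun Z : Finset (Bits n) => Z ≠ ∅),
      Finset.expect (halves n) (fun S => Finset.expect (families S Z) fun F =>
        Finset.expect Z fun r => V.acceptProb (permOracle (F r)) (P.toQuantum (oracleLaw Z F))) ≤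
      Finset.expect (halves n) Q + x +
        (Fintype.card (Bits n) : ℝ) / Z.card * ((W + 1) / (x * 2 ^ n)) := by
    intro Z hZ
    have hZ' := Finset.nonempty_iff_ne_empty.2 (Finset.mem_filter.1 hZ).2
    have hZ0 : (0 : ℝ) < Z.card := by exact_mod_cast Finset.card_pos.2 hZ'
    have h2 : (Fintype.card (Bits n) : ℝ) / Z.card * ((W + 1) / (x * 2 ^ n)) =
        (W + 1) / (x * Z.card) := by
      rw [card_bits]
      push_cast
      field_simp
    refine (expect_mono fun S hS => expect_families_accept_le V S Z hZ'
      (fun F => P (oracleLaw Z F)) (hQ S hS) hx0 hx1).trans (le_of_eq ?_)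
    rw [h2, Finset.expect_add_distrib, Finset.expect_add_distrib,
      Finset.expect_const (halves_nonempty n), Finset.expect_const (halves_nonempty n)]
  refine (expect_mono h1).trans ?_
  rw [Finset.expect_add_distrib, Finset.expect_const hne, ← Finset.expect_mul]
  have h3 := mul_le_mul_of_nonneg_right (expect_inv_card_le (Bits n))
    (show (0 : ℝ) ≤ (W + 1) / (x * 2 ^ n) by positivity)
  refine (add_le_add le_rfl h3).trans (le_of_eq ?_)
  ring

open Classical in
-- Soundness against constant provers bounds the acceptance of full cycles for each string. Outside
-- a `1 / 128` fraction of halves no string then exceeds `1 / 2` on two-cycle permutations, and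
-- adaptivity adds at most `1 / 10`: the Yes acceptance is at most `1 / 2 + 1 / 128 + 1 / 10 < 2 /
-- 3`.
theorem not_isDistQCMA {K l : ℕ} (hn : 1 ≤ n) (hl : 1 ≤ l) (hKl : K * l = 2 ^ (n - 1))
    (hK : 200000000000 * ((W : ℝ) + 21) ^ 3 * l ≤ K) (hT : 25600 * ((T : ℝ) + 1) ^ 2 ≤ l)
    (hW : 6400 * ((W : ℝ) + 1) ≤ 2 ^ n) (V : DistVerifier n W T) (P : ClassicalProver n W) :
    ¬ IsDistQCMA V P (2 / 3) (1 / 3) := by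
  rintro ⟨hc, hs⟩
  have hno : ∀ v : Bits W, noMean V (QState.basis v) ≤ 1 / 3 := fun v => by
    rw [← distNoAccept_const]
    exact hs fun _ => v
  let F : Bits W → Finset (Bits n) → ℝ := fun v S =>
    if 1 / 2 ≤ yesMean V (QState.basis v) S then 1 else 0
  have hF : ∀ v, Finset.expect (halves n) (F v) ≤ (1 / 2) ^ (W + 7) := fun v =>
    expect_halves_lt hn hl hKl hK hT V (QState.basis v) (hno v)
      (fun S => by simp only [F]; split_ifs <;> simp)
      (fun S _ h => by
        by_contra h'
        exact zero_ne_one ((if_neg h').symm.trans h))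
  have hF0 : ∀ v S, 0 ≤ F v S := fun v S => by
    simp only [F]
    split_ifs <;> norm_num
  have h1 := distYesAccept_le V P (Q := fun S => 1 / 2 + ∑ v, F v S) (fun S _ v => by
    have h2 := Finset.single_le_sum (fun v _ => hF0 v S) (Finset.mem_univ v)
    by_cases h : 1 / 2 ≤ yesMean V (QState.basis v) S
    · have h3 := yesMean_le_one V (QState.basis v) S
      have h4 : F v S = 1 := if_pos h
      linarith
    · have h4 := Finset.sum_nonneg fun v (_ : v ∈ (Finset.univ : Finset (Bits W))) => hF0 v S
      linarith) (x := 1 / 20) (by norm_num) (by norm_num)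
  rw [Finset.expect_add_distrib, Finset.expect_const (halves_nonempty n),
    Finset.expect_sum_comm] at h1
  have h2 : ∑ v, Finset.expect (halves n) (F v) ≤ 1 / 128 := by
    refine (Finset.sum_le_sum fun v _ => hF v).trans (le_of_eq ?_)
    rw [Finset.sum_const, Finset.card_univ, card_bits, nsmul_eq_mul, pow_add]
    push_cast
    rw [← mul_assoc, ← mul_pow]
    norm_num
  have h3 : 16 * ((W : ℝ) + 1) / (1 / 20 * 2 ^ n) ≤ 1 / 20 := by
    rw [div_le_div_iff₀ (by positivity) (by norm_num)]
    linarith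
  linarith

theorem eventually_not_isDistQCMA (k : ℕ) : ∀ᶠ n : ℕ in Filter.atTop,
    ∀ W T : ℕ, W ≤ n ^ k → T ≤ n ^ k →
      ∀ (V : DistVerifier n W T) (P : ClassicalProver n W), ¬ IsDistQCMA V P (2 / 3) (1 / 3) := by
  set C : ℝ := 200000000000 * (22 * 16 ^ k) ^ 3 with hC
  have hC0 : 0 < C := by positivity
  have h1 : ∀ᶠ q : ℕ in Filter.atTop, (q : ℝ) ^ (3 * k) / 2 ^ q ≤ 1 / C :=
    ((tendsto_pow_const_div_const_pow_of_one_lt (3 * k) (one_lt_two : (1 : ℝ) < 2)).eventually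
      (gt_mem_nhds (by positivity : (0 : ℝ) < 1 / C))).mono fun q hq => hq.le
  have h2 : Filter.Tendsto (fun n : ℕ => n / 8) Filter.atTop Filter.atTop :=
    Filter.tendsto_atTop_atTop.2 fun b => ⟨8 * b, fun n hn => by omega⟩
  filter_upwards [h2.eventually h1, Filter.eventually_ge_atTop 8] with n hq hn8 W T hW hT V P
  -- Rows of length `2 ^ q` outgrow the polynomial in `T`, and the ratio `K / l = 2 ^ (n - 1 - 2 *
  -- q) ≥ 2 ^ q` outgrows the polynomial in `W`.
  set q := n / 8 with hqdef
  have hq1 : 1 ≤ q := by omega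
  have hn16 : n ≤ 16 * q := by omega
  have hq1' : (1 : ℝ) ≤ q := by exact_mod_cast hq1
  have hbound : ∀ X : ℕ, X ≤ n ^ k → (X : ℝ) + 21 ≤ 22 * 16 ^ k * (q : ℝ) ^ k := by
    intro X hX
    have h3 : X ≤ (16 * q) ^ k := hX.trans (Nat.pow_le_pow_left hn16 k)
    have h4 : (X : ℝ) ≤ (16 * (q : ℝ)) ^ k := by exact_mod_cast h3
    have h5 : (1 : ℝ) ≤ (16 * (q : ℝ)) ^ k := one_le_pow₀ (by linarith)
    rw [mul_assoc, ← mul_pow]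
    linarith
  have hgrow : ∀ X : ℕ, X ≤ n ^ k → 200000000000 * ((X : ℝ) + 21) ^ 3 ≤ 2 ^ q := by
    intro X hX
    have h3 : ((X : ℝ) + 21) ^ 3 ≤ (22 * 16 ^ k * (q : ℝ) ^ k) ^ 3 :=
      pow_le_pow_left₀ (by positivity) (hbound X hX) 3
    rw [div_le_div_iff₀ (by positivity) hC0] at hq
    have h4 : 200000000000 * (22 * 16 ^ k * (q : ℝ) ^ k) ^ 3 = (q : ℝ) ^ (3 * k) * C := by
      rw [hC]
      ring
    linarith
  have hpow : (2 : ℝ) ^ q * ((2 ^ q : ℕ) : ℝ) ≤ ((2 ^ (n - 1 - q) : ℕ) : ℝ) := by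
    push_cast
    rw [← pow_add]
    exact pow_le_pow_right₀ (by norm_num) (by omega)
  refine not_isDistQCMA (K := 2 ^ (n - 1 - q)) (l := 2 ^ q) (by omega) Nat.one_le_two_pow ?_ ?_
    ?_ ?_ V P
  · rw [← pow_add]
    congr 1
    omega
  · refine le_trans ?_ hpow
    exact mul_le_mul_of_nonneg_right (hgrow W hW) (Nat.cast_nonneg _)
  · push_cast
    refine le_trans ?_ (hgrow T hT)
    have h3 : (0 : ℝ) ≤ T := Nat.cast_nonneg T
    have h4 : ((T : ℝ) + 1) ^ 2 ≤ ((T : ℝ) + 21) ^ 2 := by gcongr; norm_num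
    have h5 : ((T : ℝ) + 21) ^ 2 ≤ ((T : ℝ) + 21) ^ 3 := by
      refine pow_le_pow_right₀ (by linarith) (by norm_num)
    have h6 : 0 ≤ ((T : ℝ) + 21) ^ 3 := by positivity
    linarith
  · have h7 : (2 : ℝ) ^ q ≤ 2 ^ n := pow_le_pow_right₀ (by norm_num) (by omega)
    refine le_trans ?_ ((hgrow W hW).trans h7)
    have h3 : (0 : ℝ) ≤ W := Nat.cast_nonneg W
    have h5 : (W : ℝ) + 21 ≤ ((W : ℝ) + 21) ^ 3 := by
      refine le_self_pow₀ (by linarith) (by norm_num)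
    linarith

end NoClassicalWitness

/-! ### The walk circuit and its acceptance probability -/

section Circuit

variable {n A : ℕ}

theorem Bits.add_self {m : ℕ} (x : Bits m) : x + x = 0 := by
  funext i
  exact CharTwo.add_self_eq_zero (x i)

theorem Bits.add_eq_zero_iff {m : ℕ} (x y : Bits m) : x + y = 0 ↔ x = y := by
  constructor
  · intro h
    rw [← add_right_cancel_iff (a := y), h, Bits.add_self]
  · rintro rfl
    exact Bits.add_self x

/-- Basis labels of the verifier that receives an `n`-qubit witness. -/
abbrev WalkIndex (n A : ℕ) : Type := QIndex (ZMod 2 × Bits n) n (Bits n) A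

/-- Exchange the query input with the witness register. -/
def loadWitness : Equiv.Perm (WalkIndex n A) where
  toFun q := (q.1, (q.2.1.1, q.2.2.2.1), q.2.2.1, q.2.1.2, q.2.2.2.2)
  invFun q := (q.1, (q.2.1.1, q.2.2.2.1), q.2.2.1, q.2.1.2, q.2.2.2.2)
  left_inv _ := rfl
  right_inv _ := rfl

/-- Flip the control bit when the ancillas satisfy `f`. -/
def flipControl (f : Bits A → Bool) : Equiv.Perm (WalkIndex n A) where
  toFun q := (xor q.1 (f q.2.2.2.2), q.2)
  invFun q := (xor q.1 (f q.2.2.2.2), q.2)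
  left_inv q := by simp
  right_inv q := by simp

/-- Exchange query input and target and reverse the direction, when the control bit is set. -/
def reverseQuery : Equiv.Perm (WalkIndex n A) where
  toFun q := if q.1 then (q.1, (q.2.1.1 + 1, q.2.2.1), q.2.1.2, q.2.2.2) else q
  invFun q := if q.1 then (q.1, (q.2.1.1 + 1, q.2.2.1), q.2.1.2, q.2.2.2) else q
  left_inv := by
    rintro ⟨b, ⟨d, x⟩, y, i, a⟩
    cases b <;> simp [add_assoc, CharTwo.add_self_eq_zero]
  right_inv := by
    rintro ⟨b, ⟨d, x⟩, y, i, a⟩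
    cases b <;> simp [add_assoc, CharTwo.add_self_eq_zero]

/-- Reverse the direction when the control bit is set. -/
def reverseDirection : Equiv.Perm (WalkIndex n A) where
  toFun q := (q.1, (q.2.1.1 + (if q.1 then 1 else 0), q.2.1.2), q.2.2)
  invFun q := (q.1, (q.2.1.1 + (if q.1 then 1 else 0), q.2.1.2), q.2.2)
  left_inv := by
    rintro ⟨b, ⟨d, x⟩, y, i, a⟩
    cases b <;> simp [add_assoc, CharTwo.add_self_eq_zero]
  right_inv := by
    rintro ⟨b, ⟨d, x⟩, y, i, a⟩
    cases b <;> simp [add_assoc, CharTwo.add_self_eq_zero]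

/-- The state in which a walker with ancillas `a` has made `min (v a) t` of its `v a` steps. -/
def walkState (v : Bits A → ℕ) (κ : ℂ) (π : Equiv.Perm (Bits n)) (ψ : Bits n → ℂ) (t : ℕ) :
    WalkIndex n A → ℂ :=
  fun q => if q.1 = decide (t < v q.2.2.2.2) ∧ q.2.1.1 = 0 ∧ q.2.2.1 = 0 ∧ q.2.2.2.1 = 0 then
    κ * ψ ((π⁻¹ ^ min (v q.2.2.2.2) t) q.2.1.2) else 0

/-- The unitary that ends step `t` of the walk. -/
def endStep (v : Bits A → ℕ) (t : ℕ) : Equiv.Perm (WalkIndex n A) :=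
  reverseDirection * flipControl fun a => xor (decide (t < v a)) (decide (t + 1 < v a))

/-- A step takes two queries: the first writes `π x` into the target, the registers are exchanged,
and an inverse query erases `x`. Walkers with no steps left have control bit `0` and are untouched;
the final flip updates the control bit for the next step. -/
theorem walkState_succ (v : Bits A → ℕ) (κ : ℂ) (π : Equiv.Perm (Bits n)) (ψ : Bits n → ℂ)
    (t : ℕ) :
    applyQuery (permOracle π) (applyQuery (permOracle π) (walkState v κ π ψ t) ∘ reverseQuery) ∘
      endStep v t = walkState v κ π ψ (t + 1) := by
  funext q
  obtain ⟨b, ⟨d, x⟩, y, i, a⟩ := q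
  have hd : d = 0 ∨ d = 1 := by
    fin_cases d
    · exact Or.inl rfl
    · exact Or.inr rfl
  have h11 : (1 : ZMod 2) + 1 = 0 := rfl
  obtain ⟨ρ, hρ⟩ : ∃ ρ, ρ = π⁻¹ := ⟨_, rfl⟩
  have hw : ∀ s b d x y i a, walkState v κ π ψ s (b, (d, x), y, i, a) =
      if b = decide (s < v a) ∧ d = 0 ∧ y = 0 ∧ i = 0 then κ * ψ ((ρ ^ min (v a) s) x) else 0 :=
    fun _ _ _ _ _ _ _ => by rw [hρ]; rfl
  have hO0 : ∀ z, permOracle π (0, z) = π z := fun _ => rfl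
  have hO1 : ∀ z, permOracle π (1, z) = ρ z := fun _ => by rw [hρ]; rfl
  have hz : ∀ x, x + π (ρ x) = 0 := fun x => by
    rw [hρ, show π (π⁻¹ x) = x from π.apply_symm_apply x, Bits.add_self]
  simp only [Function.comp_apply, endStep, Equiv.Perm.mul_apply]
  by_cases h1 : t < v a
  · have hm : min (v a) t = t := min_eq_right h1.le
    have key : (x + π (y + ρ x) = 0) ↔ y = 0 := by
      rw [Bits.add_eq_zero_iff, ← Equiv.Perm.inv_eq_iff_eq, hρ]
      constructor
      · intro h
        have := congrArg (· + π⁻¹ x) h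
        simp only [add_assoc, Bits.add_self, add_zero] at this
        exact this.symm
      · rintro rfl
        rw [zero_add]
    by_cases h2 : t + 1 < v a <;> cases b <;> rcases hd with rfl | rfl <;>
      by_cases hy : y = 0 <;>
      simp [applyQuery, reverseQuery, reverseDirection, flipControl, pow_succ, h1, h2, hm,
        h11, key, hy, hw, hO0, hO1, hz]
  · have h2 : ¬ t + 1 < v a := by omega
    have hm : min (v a) t = v a := min_eq_left (by omega)
    have hm' : min (v a) (t + 1) = v a := min_eq_left (by omega)
    cases b <;> rcases hd with rfl | rfl <;>
      simp [applyQuery, reverseQuery, reverseDirection, flipControl, h1, h2, hm, hm', h11, hw,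
        hO0, hO1]

/-- The ancillas as one factor of the register. -/
def ancillaFactor : WalkIndex n A ≃ Bits A × (Bool × (ZMod 2 × Bits n) × Bits n × Bits n) where
  toFun q := (q.2.2.2.2, q.1, q.2.1, q.2.2.1, q.2.2.2.1)
  invFun q := (q.2.1, q.2.2.1, q.2.2.2.1, q.2.2.2.2, q.1)
  left_inv _ := rfl
  right_inv _ := rfl

/-- The query input as one factor of the register. -/
def inputFactor : WalkIndex n A ≃ Bits n × (Bool × ZMod 2 × Bits n × Bits n × Bits A) where
  toFun q := (q.2.1.2, q.1, q.2.1.1, q.2.2)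
  invFun q := (q.2.1, (q.2.2.1, q.1), q.2.2.2)
  left_inv _ := rfl
  right_inv _ := rfl

/-- The unitaries of the walk. -/
def walkUnitary (v : Bits A → ℕ) (R : Matrix.unitaryGroup (Bits A) ℂ)
    (B : Matrix.unitaryGroup (Bits n) ℂ) (J t : ℕ) : Matrix.unitaryGroup (WalkIndex n A) ℂ :=
  if t = 0 then permUnitary (flipControl fun a => decide (0 < v a)) *
      (liftUnitary ancillaFactor R * permUnitary loadWitness)
    else if t % 2 = 1 then permUnitary reverseQuery
    else if t = 2 * J then liftUnitary inputFactor B⁻¹ *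
      (liftUnitary ancillaFactor R⁻¹ * permUnitary (endStep v (t / 2 - 1)))
    else permUnitary (endStep v (t / 2 - 1))

/-- The outcomes in which the number of steps is found uniform and the position is not. -/
def walkAccept (n A : ℕ) : Finset (WalkIndex n A) :=
  Finset.univ.filter fun q => q.2.2.2.2 = 0 ∧ q.2.1.2 ≠ 0

/-- The verifier that walks along the permutation a random number of steps in superposition, and
tests that the number of steps is still uniform and that the position is orthogonal to the
uniform superposition. -/
def walkVerifier (v : Bits A → ℕ) (R : Matrix.unitaryGroup (Bits A) ℂ)
    (B : Matrix.unitaryGroup (Bits n) ℂ) (J : ℕ) : DistVerifier n n (2 * J) where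
  ancillas := A
  U := walkUnitary v R B J
  accept := walkAccept n A

/-- The initial state of the walk. -/
def walkInit (A : ℕ) (ψ : QState (Bits n)) : WalkIndex n A → ℂ :=
  fun q => if q.1 = false ∧ q.2.1 = 0 ∧ q.2.2.1 = 0 ∧ q.2.2.2.2 = 0 then ψ.1 q.2.2.2.1 else 0

variable (v : Bits A → ℕ) (R : Matrix.unitaryGroup (Bits A) ℂ)
  (B : Matrix.unitaryGroup (Bits n) ℂ) (J : ℕ)

/-- The states of the walk verifier. -/
def walkRun (O : ZMod 2 × Bits n → Bits n) (ψ : QState (Bits n)) : ℕ → WalkIndex n A → ℂ :=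
  (walkVerifier v R B J).state O ψ

theorem walkRun_zero (O : ZMod 2 × Bits n → Bits n) (ψ : QState (Bits n)) :
    walkRun v R B J O ψ 0 = Matrix.mulVec (walkUnitary v R B J 0).1 (walkInit A ψ) := rfl

theorem walkRun_succ (O : ZMod 2 × Bits n → Bits n) (ψ : QState (Bits n)) (t : ℕ) :
    walkRun v R B J O ψ (t + 1) =
      Matrix.mulVec (walkUnitary v R B J (t + 1)).1 (applyQuery O (walkRun v R B J O ψ t)) := rfl

theorem walkVerifier_acceptProb (O : ZMod 2 × Bits n → Bits n) (ψ : QState (Bits n)) :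
    (walkVerifier v R B J).acceptProb O ψ =
      ∑ q ∈ walkAccept n A, ‖walkRun v R B J O ψ (2 * J) q‖ ^ 2 := rfl

theorem walkUnitary_odd (t : ℕ) : walkUnitary v R B J (2 * t + 1) = permUnitary reverseQuery := by
  rw [walkUnitary, if_neg (by omega), if_pos (by omega)]

theorem walkRun_eq {κ : ℂ} (hR : ∀ a, R.1 a 0 = κ) (π : Equiv.Perm (Bits n))
    (ψ : QState (Bits n)) (t : ℕ) (ht : t < J) :
    walkRun v R B J (permOracle π) ψ (2 * t) = walkState v κ π ψ.1 t := by
  induction t with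
  | zero =>
    rw [mul_zero, walkRun_zero, walkUnitary, if_pos rfl, Matrix.UnitaryGroup.mul_val,
      Matrix.UnitaryGroup.mul_val, ← Matrix.mulVec_mulVec, ← Matrix.mulVec_mulVec,
      permUnitary_mulVec, permUnitary_mulVec]
    funext q
    obtain ⟨b, ⟨d, x⟩, y, i, a⟩ := q
    rw [Function.comp_apply, liftUnitary_mulVec, Finset.sum_eq_single 0]
    · change R.1 a 0 * _ = _
      rw [hR]
      by_cases h : 0 < v a <;> cases b <;>
        simp [walkInit, loadWitness, ancillaFactor, flipControl, walkState, h, Prod.ext_iff,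
          and_left_comm, and_comm]
    · intro a' _ ha'
      simp [walkInit, loadWitness, ancillaFactor, ha']
    · simp
  | succ t ih =>
    rw [show 2 * (t + 1) = 2 * t + 1 + 1 by ring, walkRun_succ, walkRun_succ, ih (by omega),
      ← walkState_succ, walkUnitary_odd, permUnitary_mulVec, walkUnitary, if_neg (by omega),
      if_neg (by omega), if_neg (by omega), show (2 * t + 1 + 1) / 2 - 1 = t by omega,
      permUnitary_mulVec]

theorem walkRun_final (hJ : 0 < J) {κ : ℂ} (hR : ∀ a, R.1 a 0 = κ) (π : Equiv.Perm (Bits n))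
    (ψ : QState (Bits n)) :
    walkRun v R B J (permOracle π) ψ (2 * J) =
      Matrix.mulVec (liftUnitary inputFactor B⁻¹).1
        (Matrix.mulVec (liftUnitary ancillaFactor R⁻¹).1 (walkState v κ π ψ.1 J)) := by
  obtain ⟨t, rfl⟩ := Nat.exists_eq_succ_of_ne_zero hJ.ne'
  rw [show 2 * t.succ = 2 * t + 1 + 1 by omega, walkRun_succ, walkRun_succ,
    walkRun_eq v R B _ hR π ψ t (by omega), ← walkState_succ, walkUnitary_odd,
    permUnitary_mulVec, walkUnitary, if_neg (by omega), if_neg (by omega), if_pos (by omega),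
    show (2 * t + 1 + 1) / 2 - 1 = t by omega, Matrix.UnitaryGroup.mul_val,
    Matrix.UnitaryGroup.mul_val, ← Matrix.mulVec_mulVec, ← Matrix.mulVec_mulVec,
    permUnitary_mulVec]

/-- The acceptance probability of the walk verifier. -/
theorem exists_walk_verifier (n A : ℕ) : ∃ V : DistVerifier n n (2 * 2 ^ A),
    ∀ (π : Equiv.Perm (Bits n)) (ψ : QState (Bits n)), V.acceptProb (permOracle π) ψ =
      ∑ x, ‖(1 / 2 ^ A : ℂ) * ∑ j : Fin (2 ^ A), ψ.1 ((π⁻¹ ^ j.val) x)‖ ^ 2 -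
        ‖∑ x, ψ.1 x‖ ^ 2 / 2 ^ n := by
  have hunif : ∀ m : ℕ, ∃ U : Matrix.unitaryGroup (Bits m) ℂ,
      ∀ i, U.1 i 0 = ((1 / Real.sqrt (2 ^ m) : ℝ) : ℂ) := fun m => by
    refine exists_unitary_column 0 (fun _ => ((1 / Real.sqrt (2 ^ m) : ℝ) : ℂ)) ?_
    rw [Finset.sum_const, Finset.card_univ, card_bits, nsmul_eq_mul, Complex.norm_real,
      Real.norm_eq_abs, sq_abs, div_pow, Real.sq_sqrt (by positivity)]
    push_cast
    field_simp
  obtain ⟨R, hR⟩ := hunif A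
  obtain ⟨B, hB⟩ := hunif n
  let e : Bits A ≃ Fin (2 ^ A) := Fintype.equivFinOfCardEq (card_bits A)
  let v : Bits A → ℕ := fun a => (e a).val
  refine ⟨walkVerifier v R B (2 ^ A), fun π ψ => ?_⟩
  set κ : ℂ := ((1 / Real.sqrt (2 ^ A) : ℝ) : ℂ) with hκ
  set h : Bits n → ℂ := fun x => (1 / 2 ^ A : ℂ) * ∑ j : Fin (2 ^ A), ψ.1 ((π⁻¹ ^ j.val) x) with hh
  have hκκ : star κ * κ = 1 / 2 ^ A := by
    rw [hκ, Complex.star_def, Complex.conj_ofReal, ← Complex.ofReal_mul, ← sq, div_pow,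
      Real.sq_sqrt (by positivity)]
    push_cast
    ring
  -- Finding the ancillas at `0` after `R⁻¹` projects them onto the uniform superposition, which
  -- leaves the average `h` of the shifted states in the position register.
  have hstate : ∀ q : WalkIndex n A, q.2.2.2.2 = 0 →
      walkRun v R B (2 ^ A) (permOracle π) ψ (2 * 2 ^ A) q =
      if q.1 = false ∧ q.2.1.1 = 0 ∧ q.2.2.1 = 0 ∧ q.2.2.2.1 = 0 then
        Matrix.mulVec (B⁻¹).1 h q.2.1.2 else 0 := by
    rintro ⟨b, ⟨d, x⟩, y, i, a⟩ (rfl : a = 0)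
    rw [walkRun_final v R B _ (by positivity) hR π ψ, liftUnitary_mulVec]
    have h1 : ∀ x', Matrix.mulVec (liftUnitary ancillaFactor R⁻¹).1 (walkState v κ π ψ.1 (2 ^ A))
        (b, (d, x'), y, i, 0) = if b = false ∧ d = 0 ∧ y = 0 ∧ i = 0 then h x' else 0 := by
      intro x'
      rw [liftUnitary_mulVec]
      have h2 : ∀ a, (R⁻¹).1 0 a = star κ := fun a => by
        rw [← hR a]
        rfl
      have h3 : ∀ a, walkState v κ π ψ.1 (2 ^ A) (b, (d, x'), y, i, a) =
          if b = false ∧ d = 0 ∧ y = 0 ∧ i = 0 then κ * ψ.1 ((π⁻¹ ^ (e a).val) x') else 0 := by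
        intro a
        have h4 : v a < 2 ^ A := (e a).isLt
        simp [walkState, v, not_lt.2 h4.le]
      change ∑ a, (R⁻¹).1 0 a * walkState v κ π ψ.1 (2 ^ A) (b, (d, x'), y, i, a) = _
      simp only [h2, h3]
      split_ifs
      · rw [hh]
        simp only [← mul_assoc, hκκ]
        rw [← Finset.mul_sum, e.sum_comp fun j : Fin (2 ^ A) => ψ.1 ((π⁻¹ ^ j.val) x')]
      · simp
    change ∑ x', (B⁻¹).1 x x' * Matrix.mulVec (liftUnitary ancillaFactor R⁻¹).1
      (walkState v κ π ψ.1 (2 ^ A)) (b, (d, x'), y, i, 0) = _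
    simp only [h1]
    split_ifs
    · rfl
    · simp
  have hsum : (walkVerifier v R B (2 ^ A)).acceptProb (permOracle π) ψ =
      ∑ x ∈ Finset.univ.erase (0 : Bits n), ‖Matrix.mulVec (B⁻¹).1 h x‖ ^ 2 := by
    rw [walkVerifier_acceptProb]
    symm
    refine Finset.sum_of_injOn (fun x => ((false, (0, x), 0, 0, 0) : WalkIndex n A)) ?_ ?_ ?_ ?_
    · intro x _ x' _ hxx
      exact congrArg (fun q : WalkIndex n A => q.2.1.2) hxx
    · intro x hx
      have hx' : x ≠ 0 := by simpa using hx
      exact Finset.mem_coe.2 (Finset.mem_filter.2 ⟨Finset.mem_univ _, rfl, hx'⟩)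
    · rintro ⟨b, ⟨d, x⟩, y, i, a⟩ hq hq'
      obtain ⟨ha, hx⟩ : a = 0 ∧ x ≠ 0 := (Finset.mem_filter.1 hq).2
      rw [hstate _ ha, if_neg]
      · simp
      · rintro ⟨h1, h2, h3, h4⟩
        refine hq' ⟨x, by simpa using hx, ?_⟩
        simp only at h1 h2 h3 h4
        rw [h1, h2, h3, h4, ha]
    · intro x _
      rw [hstate _ rfl, if_pos ⟨rfl, rfl, rfl, rfl⟩]
  -- The rejected position `0` measures the overlap with the uniform state. Shifts by `π` do not
  -- change this overlap, so the subtracted term does not depend on `π`.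
  have h0 : ‖Matrix.mulVec (B⁻¹).1 h 0‖ ^ 2 = ‖∑ x, ψ.1 x‖ ^ 2 / 2 ^ n := by
    have h1 : Matrix.mulVec (B⁻¹).1 h 0 = ((1 / Real.sqrt (2 ^ n) : ℝ) : ℂ) * ∑ x, h x := by
      rw [Finset.mul_sum]
      refine Finset.sum_congr rfl fun x _ => ?_
      have h3 : (B⁻¹).1 0 x = star (B.1 x 0) := rfl
      change (B⁻¹).1 0 x * h x = _
      rw [h3, hB, Complex.star_def, Complex.conj_ofReal]
    have h2 : ∑ x, h x = ∑ x, ψ.1 x := by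
      rw [hh, ← Finset.mul_sum, Finset.sum_comm]
      have : ∀ j : Fin (2 ^ A), ∑ x, ψ.1 ((π⁻¹ ^ j.val) x) = ∑ x, ψ.1 x := fun j =>
        Equiv.sum_comp (π⁻¹ ^ j.val) ψ.1
      rw [Finset.sum_congr rfl fun j _ => this j, Finset.sum_const, Finset.card_univ,
        Fintype.card_fin, nsmul_eq_mul]
      push_cast
      field_simp
    rw [h1, h2, norm_mul, mul_pow, Complex.norm_real, Real.norm_eq_abs, sq_abs, div_pow,
      Real.sq_sqrt (by positivity)]
    ring
  rw [hsum, ← h0, eq_sub_iff_add_eq, Finset.sum_erase_add _ _ (Finset.mem_univ _),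
    sum_norm_sq_mulVec]

end Circuit

/-! ### The collision matrix of a random full cycle -/

section Collisions

variable {n J : ℕ}

/-- The probability that random numbers of steps below `J` lead from `u` and `v` to the same
point. -/
def collision (J : ℕ) (π : Equiv.Perm (Bits n)) (u v : Bits n) : ℝ :=
  (∑ j : Fin J, ∑ j' : Fin J, if (π ^ j.val) u = (π ^ j'.val) v then (1 : ℝ) else 0) / (J : ℝ) ^ 2

theorem collision_nonneg (π : Equiv.Perm (Bits n)) (u v : Bits n) : 0 ≤ collision J π u v := by
  refine div_nonneg (Finset.sum_nonneg fun j _ => Finset.sum_nonneg fun j' _ => ?_) (sq_nonneg _)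
  split_ifs <;> norm_num

theorem sum_ite_pow_apply_eq (π : Equiv.Perm (Bits n)) (j : ℕ) (x : Bits n) (f : Bits n → ℝ) :
    ∑ v, (if x = (π ^ j) v then f v else 0) = f ((π⁻¹ ^ j) x) := by
  rw [Finset.sum_eq_single ((π⁻¹ ^ j) x)]
  · rw [if_pos]
    rw [inv_pow]
    exact ((π ^ j).apply_symm_apply x).symm
  · intro v _ hv
    refine if_neg fun h => hv ?_
    rw [h, inv_pow]
    exact ((π ^ j).symm_apply_apply v).symm
  · simp

theorem sum_collision (hJ : 0 < J) (π : Equiv.Perm (Bits n)) (u : Bits n) :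
    ∑ v, collision J π u v = 1 := by
  have hJ0 : (J : ℝ) ≠ 0 := by positivity
  unfold collision
  rw [← Finset.sum_div, Finset.sum_comm, Finset.sum_congr rfl fun j _ => Finset.sum_comm]
  simp only [sum_ite_pow_apply_eq π _ _ fun _ => (1 : ℝ)]
  simp only [Finset.sum_const, Finset.card_univ, Fintype.card_fin, nsmul_eq_mul, mul_one]
  rw [← sq, div_self (pow_ne_zero 2 hJ0)]

theorem pow_apply_injective {π : Equiv.Perm (Bits n)} (hπ : π ∈ fullCycles n) (hJN : J ≤ 2 ^ n)
    (u : Bits n) {j j' : Fin J} (h : (π ^ j.val) u = (π ^ j'.val) u) : j = j' := by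
  have h1 : π.IsCycleOn ((Finset.univ : Finset (Bits n)) : Set (Bits n)) := by
    rw [Finset.coe_univ]
    exact mem_fullCycles.1 hπ
  have h2 := (h1.pow_apply_eq_pow_apply (Finset.mem_univ u)).1 h
  rw [Finset.card_univ, card_bits] at h2
  exact Fin.ext (Nat.ModEq.eq_of_lt_of_lt h2 (j.isLt.trans_le hJN) (j'.isLt.trans_le hJN))

/-- On a cycle of length at least `J` the first `J` points from `u` are distinct, so each `j'`
collides with at most one `j`. -/
theorem collision_le (hJ : 0 < J) (hJN : J ≤ 2 ^ n) {π : Equiv.Perm (Bits n)}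
    (hπ : π ∈ fullCycles n) (u v : Bits n) : collision J π u v ≤ 1 / J := by
  have hJ0 : (0 : ℝ) < J := by exact_mod_cast hJ
  rw [collision, Finset.sum_comm, div_le_div_iff₀ (by positivity) hJ0]
  have h : ∀ j' : Fin J, ∑ j : Fin J, (if (π ^ j.val) u = (π ^ j'.val) v then (1 : ℝ) else 0) ≤
      1 := by
    intro j'
    rw [Finset.sum_boole]
    have : (Finset.univ.filter fun j : Fin J => (π ^ j.val) u = (π ^ j'.val) v).card ≤ 1 := by
      refine Finset.card_le_one.2 fun a ha b hb => pow_apply_injective hπ hJN u ?_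
      rw [(Finset.mem_filter.1 ha).2, (Finset.mem_filter.1 hb).2]
    exact_mod_cast this
  have h2 := Finset.sum_le_sum fun j' (_ : j' ∈ (Finset.univ : Finset (Fin J))) => h j'
  rw [Finset.sum_const, Finset.card_univ, Fintype.card_fin, nsmul_eq_mul, mul_one] at h2
  nlinarith

theorem collision_self (hJ : 0 < J) (hJN : J ≤ 2 ^ n) {π : Equiv.Perm (Bits n)}
    (hπ : π ∈ fullCycles n) (u : Bits n) : collision J π u u = 1 / J := by
  have hJ0 : (J : ℝ) ≠ 0 := by positivity
  have h : ∀ j j' : Fin J, (if (π ^ j.val) u = (π ^ j'.val) u then (1 : ℝ) else 0) =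
      if j = j' then 1 else 0 := fun j j' => by
    refine if_congr ⟨pow_apply_injective hπ hJN u, ?_⟩ rfl rfl
    rintro rfl
    rfl
  simp only [collision, h]
  simp only [Finset.sum_ite_eq, Finset.mem_univ, if_true, Finset.sum_const, Finset.card_univ,
    Fintype.card_fin, nsmul_eq_mul, mul_one]
  field_simp

/-- Every entry is at most `1 / J` and every row sums to `1`. This is the squared Hilbert–Schmidt
norm. -/
theorem sum_collision_sq_le (hJ : 0 < J) (hJN : J ≤ 2 ^ n) {π : Equiv.Perm (Bits n)}
    (hπ : π ∈ fullCycles n) : ∑ u, ∑ v, collision J π u v ^ 2 ≤ 2 ^ n / J := by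
  have h : ∀ u v, collision J π u v ^ 2 ≤ 1 / J * collision J π u v := fun u v => by
    rw [sq]
    exact mul_le_mul_of_nonneg_right (collision_le hJ hJN hπ u v) (collision_nonneg π u v)
  refine (Finset.sum_le_sum fun u _ => Finset.sum_le_sum fun v _ => h u v).trans (le_of_eq ?_)
  simp only [← Finset.mul_sum, sum_collision hJ]
  rw [Finset.sum_const, Finset.card_univ, card_bits, nsmul_eq_mul]
  push_cast
  ring

/-- The mean of `collision` over all full cycles. -/
def meanCollision (J : ℕ) (u v : Bits n) : ℝ :=
  Finset.expect (fullCycles n) fun π => collision J π u v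

theorem collision_conj (s π : Equiv.Perm (Bits n)) (u v : Bits n) :
    collision J (s * π * s⁻¹) (s u) (s v) = collision J π u v := by
  have h : ∀ (j : ℕ) x, ((s * π * s⁻¹) ^ j) (s x) = s ((π ^ j) x) := fun j x => by
    rw [conj_pow]
    simp
  simp only [collision, h, s.injective.eq_iff]

theorem meanCollision_conj (s : Equiv.Perm (Bits n)) (u v : Bits n) :
    meanCollision J (s u) (s v) = meanCollision J u v := by
  symm
  have hmem : ∀ (t : Equiv.Perm (Bits n)), ∀ π ∈ fullCycles n, t * π * t⁻¹ ∈ fullCycles n := by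
    intro t π hπ
    have := (mem_fullCycles.1 hπ).conj (g := t)
    rw [Set.image_univ, t.range_eq_univ] at this
    exact mem_fullCycles.2 this
  refine Finset.expect_equiv (MulAut.conj s).toEquiv (fun π => ⟨hmem s π, fun h => ?_⟩)
    fun π _ => (collision_conj s π u v).symm
  have := hmem s⁻¹ _ h
  simpa [mul_assoc] using this

/-- Conjugation permutes the full cycles, so the mean matrix is constant off the diagonal. The
diagonal is `1 / J`, and the row sum `1` determines the rest. -/
theorem meanCollision_eq (hn : 1 ≤ n) (hJ : 0 < J) (hJN : J ≤ 2 ^ n) (u v : Bits n) :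
    meanCollision J u v = (1 - 1 / J) / (2 ^ n - 1) +
      if u = v then 1 / J - (1 - 1 / J) / ((2 : ℝ) ^ n - 1) else 0 := by
  have hself : meanCollision J u u = 1 / J := by
    rw [meanCollision, Finset.expect_congr rfl fun π hπ => collision_self hJ hJN hπ u,
      Finset.expect_const (fullCycles_nonempty n)]
  split_ifs with huv
  · rw [← huv, hself]
    ring
  have hN : (2 : ℝ) ≤ 2 ^ n := by
    calc (2 : ℝ) = 2 ^ 1 := by norm_num
      _ ≤ 2 ^ n := pow_le_pow_right₀ (by norm_num) hn
  have hsum : ∑ w, meanCollision J u w = 1 := by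
    unfold meanCollision
    rw [← Finset.expect_sum_comm, Finset.expect_congr rfl fun π _ => sum_collision hJ π u,
      Finset.expect_const (fullCycles_nonempty n)]
  have hconst : ∀ w ∈ Finset.univ.erase u, meanCollision J u w = meanCollision J u v := by
    intro w hw
    have h := meanCollision_conj (J := J) (Equiv.swap v w) u v
    rwa [Equiv.swap_apply_left, Equiv.swap_apply_of_ne_of_ne huv (Finset.ne_of_mem_erase hw).symm]
      at h
  rw [← Finset.add_sum_erase _ _ (Finset.mem_univ u), hself, Finset.sum_congr rfl hconst,
    Finset.sum_const, Finset.card_erase_of_mem (Finset.mem_univ u), Finset.card_univ, card_bits,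
    nsmul_eq_mul, Nat.cast_sub Nat.one_le_two_pow] at hsum
  push_cast at hsum
  rw [add_zero, eq_div_iff (by linarith)]
  linarith

/-- The fluctuation of an average over independent rows. -/
theorem expect_families_sq_le (S Z : Finset (Bits n)) (hZ : Zᶜ.Nonempty)
    (f : Equiv.Perm (Bits n) → ℝ) :
    Finset.expect (families S Z) (fun F =>
      (Finset.expect Zᶜ (fun r => f (F r)) - Finset.expect (fullCycles n) f) ^ 2) ≤
      Finset.expect (fullCycles n) (fun π => f π ^ 2) / Zᶜ.card := by
  set m := Finset.expect (fullCycles n) f with hm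
  set g : Equiv.Perm (Bits n) → ℝ := fun π => f π - m with hg
  have hZ0 : (0 : ℝ) < Zᶜ.card := by exact_mod_cast Finset.card_pos.2 hZ
  have hg0 : Finset.expect (fullCycles n) g = 0 := by
    rw [hg, Finset.expect_sub_distrib, Finset.expect_const (fullCycles_nonempty n), ← hm, sub_self]
  have hgsq : Finset.expect (fullCycles n) (fun π => g π ^ 2) ≤
      Finset.expect (fullCycles n) fun π => f π ^ 2 := by
    have e : ∀ π, g π ^ 2 = f π ^ 2 - 2 * m * f π + m ^ 2 := fun π => by
      rw [hg]
      ring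
    simp only [e]
    rw [Finset.expect_add_distrib, Finset.expect_sub_distrib, ← Finset.mul_expect, ← hm,
      Finset.expect_const (fullCycles_nonempty n)]
    nlinarith [sq_nonneg m]
  have hrow : ∀ r ∈ Zᶜ, (if r ∈ Z then twoCycles S else fullCycles n) = fullCycles n :=
    fun r hr => if_neg (Finset.mem_compl.1 hr)
  have e1 : ∀ F : Bits n → Equiv.Perm (Bits n),
      (Finset.expect Zᶜ (fun r => f (F r)) - m) ^ 2 =
        (∑ r ∈ Zᶜ, ∑ r' ∈ Zᶜ, g (F r) * g (F r')) / (Zᶜ.card : ℝ) ^ 2 := by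
    intro F
    have : Finset.expect Zᶜ (fun r => f (F r)) - m = (∑ r ∈ Zᶜ, g (F r)) / Zᶜ.card := by
      rw [← Finset.expect_eq_sum_div_card, hg, Finset.expect_sub_distrib,
        Finset.expect_const hZ]
    rw [this, div_pow, sq (∑ r ∈ Zᶜ, g (F r)), Finset.sum_mul_sum]
  -- Distinct rows are independent and `g` is centred, so only the diagonal terms survive.
  have e2 : ∀ r ∈ Zᶜ, ∀ r' ∈ Zᶜ, Finset.expect (families S Z) (fun F => g (F r) * g (F r')) =
      if r = r' then Finset.expect (fullCycles n) (fun π => g π ^ 2) else 0 := by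
    intro r hr r' hr'
    split_ifs with h
    · subst h
      have := expect_families_apply S Z r fun π => g π ^ 2
      rw [hrow r hr] at this
      rw [← this]
      exact Finset.expect_congr rfl fun F _ => (sq _).symm
    · rw [families, expect_piFinset_apply_mul_apply _ (families_nonempty_rows S Z) h, hrow r hr,
        hg0, zero_mul]
  simp only [e1]
  rw [← Finset.expect_div, Finset.expect_sum_comm, Finset.sum_congr rfl fun r hr => by
    rw [Finset.expect_sum_comm, Finset.sum_congr rfl (e2 r hr), Finset.sum_ite_eq, if_pos hr],
    Finset.sum_const, nsmul_eq_mul, div_le_div_iff₀ (by positivity) hZ0]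
  have h3 := mul_le_mul_of_nonneg_right hgsq (show 0 ≤ (Zᶜ.card : ℝ) ^ 2 by positivity)
  linarith

end Collisions

/-! ### Soundness of the walk test against quantum witnesses -/

section Soundness

variable {n J : ℕ}

/-- Real part of the matrix of a pure state. -/
def reDensity (ψ : Bits n → ℂ) (u v : Bits n) : ℝ := (ψ u * star (ψ v)).re

theorem norm_sum_sq {ι : Type*} (s : Finset ι) (f : ι → ℂ) :
    ‖∑ i ∈ s, f i‖ ^ 2 = ∑ i ∈ s, ∑ j ∈ s, (f i * star (f j)).re := by
  have h : ∀ z : ℂ, ‖z‖ ^ 2 = (z * star z).re := fun z => by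
    rw [Complex.star_def, Complex.mul_conj, Complex.ofReal_re, Complex.normSq_eq_norm_sq]
  rw [h, star_sum, Finset.sum_mul_sum, Complex.re_sum]
  exact Finset.sum_congr rfl fun i _ => Complex.re_sum _ _

theorem sum_reDensity_self (ψ : QState (Bits n)) : ∑ u, reDensity ψ.1 u u = 1 := by
  refine Eq.trans (Finset.sum_congr rfl fun u _ => ?_) ψ.2
  rw [reDensity, Complex.star_def, Complex.mul_conj, Complex.ofReal_re, Complex.normSq_eq_norm_sq]

theorem sum_reDensity_sq_le (ψ : QState (Bits n)) : ∑ u, ∑ v, reDensity ψ.1 u v ^ 2 ≤ 1 := by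
  have h : ∀ u v, reDensity ψ.1 u v ^ 2 ≤ ‖ψ.1 u‖ ^ 2 * ‖ψ.1 v‖ ^ 2 := fun u v => by
    rw [← mul_pow, ← norm_star (ψ.1 v), ← norm_mul, reDensity]
    exact sq_le_sq' (neg_le_of_abs_le (Complex.abs_re_le_norm _)) (Complex.re_le_norm _)
  refine (Finset.sum_le_sum fun u _ => Finset.sum_le_sum fun v _ => h u v).trans (le_of_eq ?_)
  rw [← Finset.sum_mul_sum, ψ.2, one_mul]

/-- Expand the square over pairs of step numbers and substitute `u = π ^ (-j) x`: a pair `u, v`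
appears once for each collision of its trajectories. -/
theorem sum_norm_walk_sq (π : Equiv.Perm (Bits n)) (ψ : Bits n → ℂ) :
    ∑ x, ‖(1 / (J : ℂ)) * ∑ j : Fin J, ψ ((π⁻¹ ^ j.val) x)‖ ^ 2 =
      ∑ u, ∑ v, collision J π u v * reDensity ψ u v := by
  have h1 : ∀ x, ‖(1 / (J : ℂ)) * ∑ j : Fin J, ψ ((π⁻¹ ^ j.val) x)‖ ^ 2 =
      (∑ j : Fin J, ∑ j' : Fin J, reDensity ψ ((π⁻¹ ^ j.val) x) ((π⁻¹ ^ j'.val) x)) /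
        (J : ℝ) ^ 2 := fun x => by
    rw [norm_mul, mul_pow, norm_sum_sq, norm_div, norm_one, Complex.norm_natCast, div_pow, one_pow,
      div_mul_eq_mul_div, one_mul]
    rfl
  simp only [h1, collision]
  rw [← Finset.sum_div, Finset.sum_comm]
  have h2 : ∀ j j' : Fin J, ∑ x, reDensity ψ ((π⁻¹ ^ j.val) x) ((π⁻¹ ^ j'.val) x) =
      ∑ u, ∑ v, if (π ^ j.val) u = (π ^ j'.val) v then reDensity ψ u v else 0 := by
    intro j j'
    rw [← Equiv.sum_comp (π ^ j.val)]
    refine Finset.sum_congr rfl fun u _ => ?_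
    rw [sum_ite_pow_apply_eq π j'.val _ fun v => reDensity ψ u v, inv_pow]
    congr 1
    exact (π ^ j.val).symm_apply_apply u
  rw [Finset.sum_congr rfl fun j _ => Finset.sum_comm]
  simp only [h2, div_mul_eq_mul_div, Finset.sum_mul, ite_mul, one_mul, zero_mul]
  simp only [← Finset.sum_div]
  congr 1
  rw [Finset.sum_congr rfl fun j _ => Finset.sum_comm, Finset.sum_comm]
  refine Finset.sum_congr rfl fun u _ => ?_
  rw [Finset.sum_congr rfl fun j _ => Finset.sum_comm, Finset.sum_comm]

/-- The mean form is `β` times the all-ones form plus `1 / J - β` times the identity. Since `J ≤ 2 ^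
n`, `β ≤ 1 / 2 ^ n`, so the test against the uniform state absorbs the first part. -/
theorem sum_meanCollision_mul_le (hn : 1 ≤ n) (hJ : 0 < J) (hJN : J ≤ 2 ^ n)
    (ψ : QState (Bits n)) :
    ∑ u, ∑ v, meanCollision J u v * reDensity ψ.1 u v - ‖∑ x, ψ.1 x‖ ^ 2 / 2 ^ n ≤ 1 / J := by
  have hN : (2 : ℝ) ≤ 2 ^ n := by
    calc (2 : ℝ) = 2 ^ 1 := by norm_num
      _ ≤ 2 ^ n := pow_le_pow_right₀ (by norm_num) hn
  have hJ1 : (1 : ℝ) ≤ J := by exact_mod_cast hJ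
  have hJN' : (J : ℝ) ≤ 2 ^ n := by exact_mod_cast hJN
  set β : ℝ := (1 - 1 / J) / (2 ^ n - 1) with hβ
  have hJinv : 1 / (J : ℝ) ≤ 1 := by rw [div_le_one (by linarith)]; exact hJ1
  have hβ0 : 0 ≤ β := div_nonneg (by linarith) (by linarith)
  have hβN : β ≤ 1 / 2 ^ n := by
    rw [hβ, div_le_div_iff₀ (by linarith) (by linarith)]
    have : 1 ≤ 1 / (J : ℝ) * 2 ^ n := by
      rw [div_mul_eq_mul_div, one_mul, le_div_iff₀ (by linarith)]
      linarith
    linarith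
  have e : ∑ u, ∑ v, meanCollision J u v * reDensity ψ.1 u v =
      β * ‖∑ x, ψ.1 x‖ ^ 2 + (1 / J - β) := by
    simp only [meanCollision_eq hn hJ hJN, add_mul, Finset.sum_add_distrib, ite_mul, zero_mul,
      Finset.sum_ite_eq, Finset.mem_univ, if_true, ← Finset.mul_sum, sum_reDensity_self]
    rw [norm_sum_sq, mul_one]
    rfl
  rw [e]
  have h := mul_le_mul_of_nonneg_right hβN (sq_nonneg ‖∑ x, ψ.1 x‖)
  rw [one_div_mul_eq_div] at h
  linarith

/-- The witness may depend on `F`, so the deviation of the averaged collision matrix from its mean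
is controlled in Hilbert–Schmidt norm, which bounds its value on all states at once. Independence of
the rows makes the expected squared norm at most `2 ^ n / (J * |Zᶜ|)`. -/
theorem expect_families_walk_le (hn : 1 ≤ n) (hJ : 0 < J) (hJN : J ≤ 2 ^ n)
    {V : Equiv.Perm (Bits n) → QState (Bits n) → ℝ}
    (hV : ∀ π ψ, V π ψ = ∑ u, ∑ v, collision J π u v * reDensity ψ.1 u v -
      ‖∑ x, ψ.1 x‖ ^ 2 / 2 ^ n) (S Z : Finset (Bits n)) (hZ : Zᶜ.Nonempty)
    (Q : (Bits n → Equiv.Perm (Bits n)) → QState (Bits n)) {δ : ℝ} (hδ : 0 < δ) :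
    Finset.expect (families S Z) (fun F => Finset.expect Zᶜ fun r => V (F r) (Q F)) ≤
      1 / J + δ / 2 + 2 ^ n / Zᶜ.card * (1 / (2 * δ * J)) := by
  have hJ0 : (0 : ℝ) < J := by exact_mod_cast hJ
  have hZ0 : (0 : ℝ) < Zᶜ.card := by exact_mod_cast Finset.card_pos.2 hZ
  set D : (Bits n → Equiv.Perm (Bits n)) → Bits n → Bits n → ℝ := fun F u v =>
    Finset.expect Zᶜ (fun r => collision J (F r) u v) - meanCollision J u v with hD
  have hpt : ∀ F, Finset.expect Zᶜ (fun r => V (F r) (Q F)) ≤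
      1 / J + δ / 2 + (∑ u, ∑ v, D F u v ^ 2) * (1 / (2 * δ)) := by
    intro F
    have e1 : Finset.expect Zᶜ (fun r => V (F r) (Q F)) =
        (∑ u, ∑ v, meanCollision J u v * reDensity (Q F).1 u v -
          ‖∑ x, (Q F).1 x‖ ^ 2 / 2 ^ n) + ∑ u, ∑ v, D F u v * reDensity (Q F).1 u v := by
      simp only [hV]
      rw [Finset.expect_sub_distrib, Finset.expect_const hZ, Finset.expect_sum_comm,
        Finset.sum_congr rfl fun u _ => by
          rw [Finset.expect_sum_comm, Finset.sum_congr rfl fun v _ => by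
            rw [← Finset.expect_mul]]]
      simp only [hD, sub_mul, Finset.sum_sub_distrib]
      ring
    -- Entrywise arithmetic–geometric mean in place of Cauchy–Schwarz, so that the bound is linear
    -- in the squared norm and can be averaged over `F`.
    have h2 : ∀ u v, D F u v * reDensity (Q F).1 u v ≤
        reDensity (Q F).1 u v ^ 2 * (δ / 2) + D F u v ^ 2 * (1 / (2 * δ)) := by
      intro u v
      have h3 : 0 ≤ (D F u v - δ * reDensity (Q F).1 u v) ^ 2 * (1 / (2 * δ)) := by positivity
      have e3 : (D F u v - δ * reDensity (Q F).1 u v) ^ 2 * (1 / (2 * δ)) =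
          reDensity (Q F).1 u v ^ 2 * (δ / 2) + D F u v ^ 2 * (1 / (2 * δ)) -
            D F u v * reDensity (Q F).1 u v := by
        field_simp
        ring
      linarith
    have h4 := Finset.sum_le_sum fun u (_ : u ∈ (Finset.univ : Finset (Bits n))) =>
      Finset.sum_le_sum fun v (_ : v ∈ (Finset.univ : Finset (Bits n))) => h2 u v
    simp only [Finset.sum_add_distrib, ← Finset.sum_mul] at h4
    have h5 := mul_le_mul_of_nonneg_right (sum_reDensity_sq_le (Q F))
      (show 0 ≤ δ / 2 by positivity)
    rw [e1]
    linarith [sum_meanCollision_mul_le hn hJ hJN (Q F)]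
  refine (expect_mono fun F _ => hpt F).trans ?_
  rw [Finset.expect_add_distrib, Finset.expect_const (families_nonempty S Z), ← Finset.expect_mul]
  have h6 : Finset.expect (families S Z) (fun F => ∑ u, ∑ v, D F u v ^ 2) ≤
      2 ^ n / J / Zᶜ.card := by
    rw [Finset.expect_sum_comm, Finset.sum_congr rfl fun u _ => Finset.expect_sum_comm _ _ _]
    have h7 : ∀ u v, Finset.expect (families S Z) (fun F => D F u v ^ 2) ≤
        Finset.expect (fullCycles n) (fun π => collision J π u v ^ 2) / Zᶜ.card := fun u v =>
      expect_families_sq_le S Z hZ fun π => collision J π u v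
    refine (Finset.sum_le_sum fun u _ => Finset.sum_le_sum fun v _ => h7 u v).trans ?_
    simp only [← Finset.sum_div]
    refine div_le_div_of_nonneg_right ?_ hZ0.le
    rw [Finset.sum_congr rfl fun u _ => (Finset.expect_sum_comm _ _ _).symm,
      ← Finset.expect_sum_comm]
    exact expect_le_of (by positivity) fun π hπ => sum_collision_sq_le hJ hJN hπ
  have h8 := mul_le_mul_of_nonneg_right h6 (show 0 ≤ 1 / (2 * δ) by positivity)
  have e : (2 : ℝ) ^ n / Zᶜ.card * (1 / (2 * δ * J)) = 2 ^ n / J / Zᶜ.card * (1 / (2 * δ)) := by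
    field_simp
  rw [e]
  linarith

end Soundness

/-! ### The sign state as a quantum witness -/

section QuantumWitness

variable {n : ℕ}

/-- The state with amplitude `1` on `S` and `-1` off `S`, normalized. -/
def signState (S : Finset (Bits n)) : QState (Bits n) :=
  ⟨fun x => (((if x ∈ S then 1 else -1) / Real.sqrt (2 ^ n) : ℝ) : ℂ), by
    have h : ∀ x : Bits n, ‖(((if x ∈ S then 1 else -1) / Real.sqrt (2 ^ n) : ℝ) : ℂ)‖ ^ 2 =
        1 / 2 ^ n := fun x => by
      rw [Complex.norm_real, Real.norm_eq_abs, sq_abs, div_pow, Real.sq_sqrt (by positivity)]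
      split_ifs <;> norm_num
    simp only [h]
    rw [Finset.sum_const, Finset.card_univ, card_bits, nsmul_eq_mul]
    push_cast
    field_simp⟩

theorem sum_signState (hn : 1 ≤ n) {S : Finset (Bits n)} (hS : S ∈ halves n) :
    ∑ x, (signState S).1 x = 0 := by
  have h : ∑ x : Bits n, (if x ∈ S then (1 : ℝ) else -1) = 0 := by
    rw [Finset.sum_ite, Finset.sum_const, Finset.sum_const, Finset.filter_mem_eq_inter,
      Finset.univ_inter]
    have e : (Finset.univ.filter fun x => x ∉ S) = Sᶜ := by
      ext x
      simp
    rw [e, card_compl_of_mem_halves hn hS, (mem_halves hn).1 hS]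
    simp
  change ∑ x, (((if x ∈ S then 1 else -1) / Real.sqrt (2 ^ n) : ℝ) : ℂ) = 0
  rw [← Complex.ofReal_sum, ← Finset.sum_div, h]
  simp

/-- A partition into halves that every permutation in the support of the law preserves. -/
def Preserved (D : Equiv.Perm (Bits n) → ℝ) (S : Finset (Bits n)) : Prop :=
  S ∈ halves n ∧ ∀ π, D π ≠ 0 → ∀ x, π x ∈ S ↔ x ∈ S

open Classical in
/-- The prover that sends the sign state of a preserved partition. -/
def signProver (n : ℕ) : QuantumProver n n :=
  fun D => if h : ∃ S, Preserved D S then signState h.choose else signState ∅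

theorem exists_signProver_eq {D : Equiv.Perm (Bits n) → ℝ} (h : ∃ S, Preserved D S) :
    ∃ S, Preserved D S ∧ signProver n D = signState S :=
  ⟨h.choose, h.choose_spec, dif_pos h⟩

theorem oracleLaw_ne_zero {A : Finset (Bits n)} {F : Bits n → Equiv.Perm (Bits n)}
    {π : Equiv.Perm (Bits n)} : oracleLaw A F π ≠ 0 ↔ ∃ r ∈ A, F r = π := by
  classical
  constructor
  · intro h
    by_contra! hc
    refine h ?_
    rw [oracleLaw, Finset.expect_congr rfl fun r hr => if_neg (hc r hr)]
    simp
  · rintro ⟨r, hr, rfl⟩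
    have h0 : (0 : ℝ) < A.card := by exact_mod_cast Finset.card_pos.2 ⟨r, hr⟩
    have h1 := Finset.single_le_sum (s := A) (f := fun s => if F s = F r then (1 : ℝ) else 0)
      (fun s _ => by split_ifs <;> norm_num) hr
    simp only [if_true] at h1
    rw [oracleLaw, Finset.expect_eq_sum_div_card]
    refine ne_of_gt (div_pos (lt_of_lt_of_le zero_lt_one (h1.trans (le_of_eq ?_))) h0)
    exact Finset.sum_congr rfl fun s _ => by congr

theorem preserved_oracleLaw {S Z : Finset (Bits n)} (hS : S ∈ halves n)
    {F : Bits n → Equiv.Perm (Bits n)} (hF : F ∈ families S Z) : Preserved (oracleLaw Z F) S := by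
  refine ⟨hS, fun π hπ x => ?_⟩
  obtain ⟨r, hr, rfl⟩ := oracleLaw_ne_zero.1 hπ
  have h := Fintype.mem_piFinset.1 hF r
  rw [if_pos hr] at h
  obtain ⟨h1, h2⟩ := mem_twoCycles.1 h
  constructor
  · intro hx
    by_contra hc
    exact h2.1.mapsTo (show x ∈ (S : Set (Bits n))ᶜ from hc) hx
  · exact fun hx => h1.1.mapsTo hx

/-- A permutation preserving `S` fixes the sign state, so averaging over steps does nothing; and the
signs of a half sum to zero. -/
theorem walk_signState {J : ℕ} (hJ : 0 < J) (hn : 1 ≤ n) {S : Finset (Bits n)} (hS : S ∈ halves n)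
    {π : Equiv.Perm (Bits n)} (hπ : ∀ x, π x ∈ S ↔ x ∈ S) :
    ∑ x, ‖(1 / (J : ℂ)) * ∑ j : Fin J, (signState S).1 ((π⁻¹ ^ j.val) x)‖ ^ 2 -
        ‖∑ x, (signState S).1 x‖ ^ 2 / 2 ^ n = 1 := by
  have hinv : ∀ x, π⁻¹ x ∈ S ↔ x ∈ S := fun x => by
    rw [← hπ, show π (π⁻¹ x) = x from π.apply_symm_apply x]
  have hpow : ∀ (j : ℕ) x, (π⁻¹ ^ j) x ∈ S ↔ x ∈ S := by
    intro j
    induction j with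
    | zero => simp
    | succ j ih =>
      intro x
      rw [pow_succ, Equiv.Perm.mul_apply, ih, hinv]
  have hJ0 : (J : ℂ) ≠ 0 := by exact_mod_cast hJ.ne'
  have h : ∀ x, (1 / (J : ℂ)) * ∑ j : Fin J, (signState S).1 ((π⁻¹ ^ j.val) x) =
      (signState S).1 x := by
    intro x
    have : ∀ j : Fin J, (signState S).1 ((π⁻¹ ^ j.val) x) = (signState S).1 x := fun j => by
      simp only [signState, hpow]
    rw [Finset.sum_congr rfl fun j _ => this j, Finset.sum_const, Finset.card_univ,
      Fintype.card_fin, nsmul_eq_mul, ← mul_assoc, one_div_mul_cancel hJ0, one_mul]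
  rw [sum_signState hn hS, Finset.sum_congr rfl fun x _ => by rw [h x], (signState S).2]
  simp

theorem exists_isDistQMA (hn : 1 ≤ n) {A : ℕ} (hA : A ≤ n) {δ : ℝ} (hδ : 0 < δ) :
    ∃ (V : DistVerifier n n (2 * 2 ^ A)) (P : QuantumProver n n),
      IsDistQMA V P 1 (1 / 2 ^ A + δ / 2 + 8 / (δ * 2 ^ A)) := by
  obtain ⟨V, hV⟩ := exists_walk_verifier n A
  have hJ : 0 < 2 ^ A := by positivity
  have hJN : 2 ^ A ≤ 2 ^ n := Nat.pow_le_pow_right (by norm_num) hA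
  have hJc : ((2 ^ A : ℕ) : ℂ) = 2 ^ A := by push_cast; rfl
  have hJr : ((2 ^ A : ℕ) : ℝ) = 2 ^ A := by push_cast; rfl
  have hne : (Finset.univ.filter fun Z : Finset (Bits n) => Z ≠ ∅).Nonempty :=
    ⟨Finset.univ, Finset.mem_filter.2 ⟨Finset.mem_univ _, Finset.univ_nonempty.ne_empty⟩⟩
  have hne' : (Finset.univ.filter fun Z : Finset (Bits n) => Zᶜ ≠ ∅).Nonempty :=
    ⟨∅, by
      rw [Finset.mem_filter, Finset.compl_empty]
      exact ⟨Finset.mem_univ _, Finset.univ_nonempty.ne_empty⟩⟩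
  refine ⟨V, signProver n, ?_, fun Q => ?_⟩
  · have h : ∀ S ∈ halves n, ∀ Z ∈ Finset.univ.filter (fun Z : Finset (Bits n) => Z ≠ ∅),
        ∀ F ∈ families S Z, Finset.expect Z (fun r =>
          V.acceptProb (permOracle (F r)) (signProver n (oracleLaw Z F))) = 1 := by
      intro S hS Z hZ F hF
      -- The half found by the prover need not be the sampled `S`; it is enough that all rows in `Z`
      -- preserve it.
      obtain ⟨S', hS', hP⟩ := exists_signProver_eq ⟨S, preserved_oracleLaw hS hF⟩
      have h1 : ∀ r ∈ Z, V.acceptProb (permOracle (F r)) (signProver n (oracleLaw Z F)) = 1 := by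
        intro r hr
        rw [hP, hV, ← hJc]
        exact walk_signState hJ hn hS'.1 (hS'.2 _ (oracleLaw_ne_zero.2 ⟨r, hr, rfl⟩))
      rw [Finset.expect_congr rfl h1,
        Finset.expect_const (Finset.nonempty_iff_ne_empty.2 (Finset.mem_filter.1 hZ).2)]
    rw [distYesAccept, sampleExp_congr h, sampleExp, Finset.expect_congr rfl fun S _ =>
      Finset.expect_congr rfl fun Z _ => Finset.expect_const (families_nonempty S Z) _,
      Finset.expect_congr rfl fun S _ => Finset.expect_const hne _,
      Finset.expect_const (halves_nonempty n)]
  · rw [distNoAccept, sampleExp_eq]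
    have hform : ∀ π ψ, V.acceptProb (permOracle π) ψ =
        ∑ u, ∑ v, collision (2 ^ A) π u v * reDensity ψ.1 u v - ‖∑ x, ψ.1 x‖ ^ 2 / 2 ^ n := by
      intro π ψ
      rw [hV, ← sum_norm_walk_sq, hJc]
    have h1 : ∀ Z ∈ Finset.univ.filter (fun Z : Finset (Bits n) => Zᶜ ≠ ∅),
        Finset.expect (halves n) (fun S => Finset.expect (families S Z) fun F =>
          Finset.expect Zᶜ fun r => V.acceptProb (permOracle (F r)) (Q (oracleLaw Zᶜ F))) ≤
        1 / 2 ^ A + δ / 2 + (Fintype.card (Bits n) : ℝ) / Zᶜ.card * (1 / (2 * δ * 2 ^ A)) := by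
      intro Z hZ
      refine (expect_mono fun S _ => expect_families_walk_le hn hJ hJN hform S Z
        (Finset.nonempty_iff_ne_empty.2 (Finset.mem_filter.1 hZ).2)
        (fun F => Q (oracleLaw Zᶜ F)) hδ).trans (le_of_eq ?_)
      rw [Finset.expect_const (halves_nonempty n), card_bits, hJr]
      push_cast
      rfl
    refine (expect_mono h1).trans ?_
    rw [Finset.expect_add_distrib, Finset.expect_const hne', ← Finset.expect_mul]
    have h3 := mul_le_mul_of_nonneg_right (expect_inv_card_compl_le (Bits n))
      (show (0 : ℝ) ≤ 1 / (2 * δ * 2 ^ A) by positivity)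
    refine (add_le_add le_rfl h3).trans (le_of_eq ?_)
    field_simp
    ring

theorem IsDistQMA.mono {W T : ℕ} {V : DistVerifier n W T} {P : QuantumProver n W} {c s s' : ℝ}
    (h : IsDistQMA V P c s) (hs : s ≤ s') : IsDistQMA V P c s' :=
  ⟨h.1, fun Q => (h.2 Q).trans hs⟩

theorem eventually_exists_isDistQMA (k : ℕ) : ∃ l : ℕ, ∀ᶠ n : ℕ in Filter.atTop,
    ∃ W T : ℕ, W ≤ n ^ l ∧ T ≤ n ^ l ∧
      ∃ (V : DistVerifier n W T) (P : QuantumProver n W), IsDistQMA V P 1 (1 / (n : ℝ) ^ k) := by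
  have h1 : ∀ᶠ n : ℕ in Filter.atTop, (n : ℝ) ^ (2 * k) / 2 ^ n ≤ 1 / 64 :=
    ((tendsto_pow_const_div_const_pow_of_one_lt (2 * k) (one_lt_two : (1 : ℝ) < 2)).eventually
      (gt_mem_nhds (by norm_num : (0 : ℝ) < 1 / 64))).mono fun q hq => hq.le
  refine ⟨2 * k + 1, ?_⟩
  filter_upwards [h1, Filter.eventually_ge_atTop 128] with n hq hn
  have hn1 : 1 ≤ n := by omega
  have hn0 : (0 : ℝ) < n := by exact_mod_cast hn1
  -- The largest power of two `J = 2 ^ A ≤ m` satisfies `J ≥ 32 * n ^ (2 * k)`. With `δ = 1 / n ^ k`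
  -- the soundness is at most `(1 / 32 + 1 / 2 + 1 / 4) / n ^ k`, and `2 * J ≤ 128 * n ^ (2 * k)`
  -- explains the requirement `n ≥ 128`.
  set m := 64 * n ^ (2 * k) with hm
  have hm0 : m ≠ 0 := by positivity
  set A := Nat.log 2 m with hA
  have hAm : 2 ^ A ≤ m := Nat.pow_log_le_self 2 hm0
  have hmA : m < 2 ^ (A + 1) := Nat.lt_pow_succ_log_self (by norm_num) m
  have hmn : m ≤ 2 ^ n := by
    rw [div_le_div_iff₀ (by positivity) (by norm_num)] at hq
    have : ((m : ℕ) : ℝ) ≤ ((2 ^ n : ℕ) : ℝ) := by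
      rw [hm]
      push_cast
      linarith
    exact_mod_cast this
  have hAn : A ≤ n := (Nat.pow_le_pow_iff_right (by norm_num)).1 (hAm.trans hmn)
  obtain ⟨V, P, hVP⟩ := exists_isDistQMA hn1 hAn (δ := 1 / (n : ℝ) ^ k) (by positivity)
  refine ⟨n, 2 * 2 ^ A, Nat.le_self_pow (by omega) n, ?_, V, P, hVP.mono ?_⟩
  · rw [pow_succ]
    have : 0 < n ^ (2 * k) := by positivity
    nlinarith
  · have h2 : 32 * ((n : ℝ) ^ k * (n : ℝ) ^ k) ≤ 2 ^ A := by
      have : ((m : ℕ) : ℝ) ≤ ((2 ^ (A + 1) : ℕ) : ℝ) := by exact_mod_cast hmA.le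
      rw [hm] at this
      push_cast at this
      rw [pow_succ, two_mul k, pow_add] at this
      linarith
    have h3 : (1 : ℝ) ≤ (n : ℝ) ^ k := one_le_pow₀ (by exact_mod_cast hn1)
    have h4 : 1 / (2 : ℝ) ^ A ≤ 1 / (n : ℝ) ^ k * (1 / 32) := by
      rw [div_mul_div_comm, div_le_div_iff₀ (by positivity) (by positivity)]
      nlinarith
    have h5 : 8 / (1 / (n : ℝ) ^ k * 2 ^ A) ≤ 1 / (n : ℝ) ^ k * (1 / 4) := by
      rw [div_mul_div_comm, div_mul_eq_mul_div, one_mul, div_div_eq_mul_div,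
        div_le_div_iff₀ (by positivity) (by positivity)]
      nlinarith
    have h6 : 0 < 1 / (n : ℝ) ^ k := by positivity
    linarith

end QuantumWitness

theorem mainTheorem11 :
    -- the reduction from the distributional game to the interactive game
    (∀ (n W T : ℕ), 1 ≤ n → ∀ (V' : DistVerifier n W T) (P' : ClassicalProver n W) (ε₁ ε₂ : ℝ),
      IsDistQCMA V' P' (1 - ε₁) ε₂ →
        ∃ (V : IntVerifier n W T) (P : IntProver n W), IsIntQCMA V P (3 / 4 - ε₁) (1 / 4 + ε₂)) ∧
    -- the distributional game has a QMA verifier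
    (∀ k : ℕ, ∃ l : ℕ, ∀ᶠ n : ℕ in Filter.atTop,
      ∃ W T : ℕ, W ≤ n ^ l ∧ T ≤ n ^ l ∧
        ∃ (V : DistVerifier n W T) (P : QuantumProver n W), IsDistQMA V P 1 (1 / (n : ℝ) ^ k)) ∧
    -- and no QCMA verifier
    (∀ k : ℕ, ∀ᶠ n : ℕ in Filter.atTop,
      ∀ W T : ℕ, W ≤ n ^ k → T ≤ n ^ k →
        ∀ (V : DistVerifier n W T) (P : ClassicalProver n W), ¬ IsDistQCMA V P (2 / 3) (1 / 3)) :=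
  ⟨fun _ _ _ hn V' P' _ _ h => ⟨_, _, intQCMA_of_distQCMA hn V' P' h⟩,
    eventually_exists_isDistQMA, eventually_not_isDistQCMA⟩

end
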